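/- **Conventions.** In a category $\mathcal E$ with finite limits, a map $f:B\to A$ is a *cover* if the only subobject of $A$ through which it factors is the maximal one. A *positive Heyting category* is a category with finite limits such that every map factors as a cover followed by a monomorphism and these factorisations are stable under pullback; finite sums exist and are disjoint and stable under pullback; and for every $f:Y\to X$ the functor $f^*:\mathrm{Sub}(X)\to\mathrm{Sub}(Y)$ has a right adjoint $\forall_f$. A commuting square with sides $D\to C$, $D\to B$, $g:C\to A$, $p:B\to A$ is *covering* if $p$ and the canonical map $D\to B\times_A C$ are covers. A class $\mathcal S$ of maps in a positive Heyting category $\mathcal E$ is a *class of small maps* if: (A1) it is stable under pullback; (A2) if the pullback of $f$ along a cover is in $\mathcal S$, then so is $f$; (A3) $f,f'\in\mathcal S$ implies $f+f'\in\mathcal S$; (A4) $0\to1$, $1\to1$, $1+1\to1$ are in $\mathcal S$; (A5) it is closed under composition; (A6) if $f$ is a cover and $gf\in\mathcal S$, then $g\in\mathcal S$; (A7) for every cover $p:Y\to X$ and every $f:X\to A$ in $\mathcal S$ there are $Z\to Y$, $g:Z\to B$ in $\mathcal S$ and a cover $B\to A$ making the square with top side $Z\to Y\xrightarrow{p} X$,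 vertical sides $g$ and $f$, and bottom side $B\to A$ covering; (A8) for $f\in\mathcal S$ the functor $\forall_f$ sends subobjects represented by monos in $\mathcal S$ to such subobjects; (A9) all diagonals $X\to X\times X$ are in $\mathcal S$. The pair $(\mathcal E,\mathcal S)$ is a *predicative category with small maps* if moreover: every $f\in\mathcal S$ is exponentiable; for every $f\in\mathcal S$ the W-type of $f$ (the initial algebra of the polynomial functor $P_f$) exists; $\mathcal E$ has a natural numbers object $\mathbb N$, and $\mathbb N\to1$ is in $\mathcal S$; there is $\pi:V\to U$ in $\mathcal S$ such that every $f\in\mathcal S$ is covered, via a covering square whose horizontal sides are covers, by a pullback of $\pi$; and every equivalence relation $R\rightarrowtail X\times X$ in $\mathcal S$ has a quotient $X/R$ such that the diagram $R\rightrightarrows X\to X/R$ is exact and remains exact after pullback along any map into $X/R$. Let $\mathcal C$ be an internal category in $\mathcal E$ whose codomain map $\mathcal C_1\to\mathcal C_0$ is small. The following notions are understood in the internal logic of $\mathcal E$. A *sieve* on $a\in\mathcal C_0$ is a small collection of arrows with codomain $a$ that is closed under precomposition. A *Grothendieck topology* $\mathrm{Cov}$ on $\mathcal C$ (a subobject of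 the object of pairs $(a,S)$ with $S$ a sieve on $a$) assigns to each $a$ a collection $\mathrm{Cov}(a)$ of sieves on $a$ such that: the maximal sieve on $a$ is in $\mathrm{Cov}(a)$; if $S\in\mathrm{Cov}(a)$ and $f:b\to a$, then $f^*S=\{g: fg\in S\}\in\mathrm{Cov}(b)$; and if $S$ is a sieve on $a$ and $R\in\mathrm{Cov}(a)$ is such that $f^*S\in\mathrm{Cov}(b)$ for all $f:b\to a$ in $R$, then $S\in\mathrm{Cov}(a)$. The site $(\mathcal C,\mathrm{Cov})$ is *presentable* if there is a function $\mathrm{BCov}$ assigning to every $a\in\mathcal C_0$ a small collection $\mathrm{BCov}(a)$ of sieves on $a$ such that, for every sieve $S$ on $a$, $S\in\mathrm{Cov}(a)$ if and only if $R\subseteq S$ for some $R\in\mathrm{BCov}(a)$. An internal presheaf $P$ on $\mathcal C$ is a *sheaf* if for every $a$, every $R\in\mathrm{Cov}(a)$ and every compatible family $(x_f\in P(\mathrm{dom} f))_{f\in R}$ (that is, $x_f\cdot g=x_{fg}$) there is a unique $y\in P(a)$ with $y\cdot f=x_f$ for all $f\in R$. Write $\mathrm{Sh}_{\mathcal E}(\mathcal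 C)$ for the full subcategory of the category of internal presheaves on $\mathcal C$ whose objects are the sheaves. **Theorem.** Let $(\mathcal E,\mathcal S)$ be a predicative category with small maps and let $(\mathcal C,\mathrm{Cov})$ be a presentable internal Grothendieck site in $\mathcal E$ whose codomain map $\mathcal C_1\to\mathcal C_0$ is small. Then the category $\mathrm{Sh}_{\mathcal E}(\mathcal C)$ of internal sheaves is a positive Heyting category. -/

import Mathlib

open CategoryTheory CategoryTheory.Limits

namespace AlgSetTheory

universe v u

noncomputable section

/-! ## Positive Heyting categories -/

section Basic

variable {E : Type u} [Category.{v} E]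

/-- A map `f : B ⟶ A` is a *cover* if the only subobject of `A` through which it factors is
the maximal one. -/
def IsCover {B A : E} (f : B ⟶ A) : Prop :=
  ∀ ⦃M : E⦄ (m : M ⟶ A) (g : B ⟶ M), Mono m → g ≫ m = f → IsIso m

variable (E) in
/-- Positive Heyting categories: finite limits; stable (cover, mono)-factorisations; finite sums
which are disjoint and stable under pullback; and universal quantification of subobjects along
every map. -/
class PositiveHeytingCategory : Prop where
  [hasFiniteLimits : HasFiniteLimits E]
  [hasFiniteCoproducts : HasFiniteCoproducts E]
  /-- every map factors as a cover followed by a mono -/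
  exists_factorisation : ∀ {Y X : E} (f : Y ⟶ X),
    ∃ (I : E) (e : Y ⟶ I) (m : I ⟶ X), IsCover e ∧ Mono m ∧ e ≫ m = f
  /-- these factorisations are stable under pullback (monos always are) -/
  cover_stable : ∀ {B A : E} (f : B ⟶ A) {D C : E} (q : D ⟶ B) (g : D ⟶ C) (p : C ⟶ A),
    IsPullback q g f p → IsCover f → IsCover g
  /-- sums are disjoint -/
  mono_inl : ∀ X Y : E, Mono (coprod.inl : X ⟶ X ⨿ Y)
  mono_inr : ∀ X Y : E, Mono (coprod.inr : Y ⟶ X ⨿ Y)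
  disjoint : ∀ X Y : E, IsPullback (initial.to X) (initial.to Y)
    (coprod.inl : X ⟶ X ⨿ Y) (coprod.inr : Y ⟶ X ⨿ Y)
  /-- the empty sum is stable under pullback -/
  initial_stable : ∀ {Z : E} (f : Z ⟶ ⊥_ E), IsIso f
  /-- binary sums are stable under pullback -/
  coprod_stable : ∀ {X Y Z : E} (f : Z ⟶ X ⨿ Y), Nonempty (IsColimit (BinaryCofan.mk
    (pullback.fst f (coprod.inl : X ⟶ X ⨿ Y)) (pullback.fst f (coprod.inr : Y ⟶ X ⨿ Y))))
  /-- pulling back subobjects along `f` has a right adjoint `∀_f` -/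
  forall_exists : ∀ {Y X : E} (f : Y ⟶ X), (Subobject.pullback f).IsLeftAdjoint

attribute [instance] PositiveHeytingCategory.hasFiniteLimits
  PositiveHeytingCategory.hasFiniteCoproducts PositiveHeytingCategory.forall_exists

end Basic

section SmallMaps

variable {E : Type u} [Category.{v} E] [PositiveHeytingCategory E]

/-- The right adjoint `∀_f : Sub Y ⥤ Sub X` to pulling back subobjects along `f : Y ⟶ X`. -/
abbrev univ {Y X : E} (f : Y ⟶ X) : Subobject Y ⥤ Subobject X :=
  (Subobject.pullback f).rightAdjoint

/-- A commuting square with `t : D ⟶ C`, `f : D ⟶ B`, `g : C ⟶ A`, `p : B ⟶ A` is a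
*quasi-pullback* if `D ⟶ B ×_A C` is a cover; it is a *covering square* if moreover `p` is
a cover. -/
def IsCoveringSquare {D C B A : E} (t : D ⟶ C) (f : D ⟶ B) (g : C ⟶ A) (p : B ⟶ A) : Prop :=
  ∃ w : f ≫ p = t ≫ g, IsCover (pullback.lift f t w) ∧ IsCover p

/-! ## Classes of small maps -/

/-- The axioms for a class of small maps. -/
structure IsClassOfSmallMaps (S : MorphismProperty E) : Prop where
  /-- pullback stability -/
  pullback_stable : ∀ {D B C A : E} (q : D ⟶ B) (g : D ⟶ C) (f : B ⟶ A) (p : C ⟶ A),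
    IsPullback q g f p → S f → S g
  /-- descent along covers -/
  descent : ∀ {D B C A : E} (q : D ⟶ B) (g : D ⟶ C) (f : B ⟶ A) (p : C ⟶ A),
    IsPullback q g f p → IsCover p → S g → S f
  /-- sums -/
  sums : ∀ {X Y X' Y' : E} (f : X ⟶ Y) (f' : X' ⟶ Y'), S f → S f' → S (coprod.map f f')
  /-- finiteness: `0 ⟶ 1`, `1 ⟶ 1` and `1 + 1 ⟶ 1` are small -/
  finite_zero : S (initial.to (⊤_ E))
  finite_one : S (𝟙 (⊤_ E))
  finite_two : S (terminal.from ((⊤_ E) ⨿ (⊤_ E)))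
  /-- composition -/
  comp : ∀ {X Y Z : E} (f : X ⟶ Y) (g : Y ⟶ Z), S f → S g → S (f ≫ g)
  /-- quotients -/
  quotients : ∀ {Z Y X : E} (f : Z ⟶ Y) (g : Y ⟶ X), IsCover f → S (f ≫ g) → S g
  /-- collection -/
  collection : ∀ {Y X A : E} (p : Y ⟶ X) (f : X ⟶ A), IsCover p → S f →
    ∃ (Z B : E) (t : Z ⟶ Y) (g : Z ⟶ B) (h : B ⟶ A),
      S g ∧ IsCoveringSquare (t ≫ p) g f h
  /-- `∀_f` along a small map preserves small monos -/
  heyting : ∀ {Y X : E} (f : Y ⟶ X) (A : Subobject Y), S f → S A.arrow →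
    S ((univ f).obj A).arrow
  /-- diagonals are small -/
  diagonals : ∀ X : E, S (diag X)

/-- The polynomial functor `P_f(X) = Σ_{a ∈ A} X^{B_a}` of an exponentiable map `f : B ⟶ A`,
as the composite `E ⥤ E/B ⥤ E/A ⥤ E` of `B^*`, `Π_f` and `Σ_A`. -/
def polynomialFunctor {B A : E} (f : B ⟶ A) [(Over.pullback f).IsLeftAdjoint] : E ⥤ E :=
  Over.star B ⋙ (Over.pullback f).rightAdjoint ⋙ Over.forget A

/-- `N` with `zero` and `succ` is a natural numbers object. -/
def IsNaturalNumbersObject {N : E} (zero : ⊤_ E ⟶ N) (succ : N ⟶ N) : Prop :=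
  ∀ ⦃X : E⦄ (x : ⊤_ E ⟶ X) (s : X ⟶ X), ∃! h : N ⟶ X, zero ≫ h = x ∧ succ ≫ h = h ≫ s

/-- `p q : R ⟶ X` is an equivalence relation on `X`: the map `R ⟶ X × X` is mono and, for
every `T`, the induced relation on `T`-indexed elements of `X` is an equivalence relation. -/
def IsEquivalenceRelation {R X : E} (p q : R ⟶ X) : Prop :=
  Mono (prod.lift p q) ∧
    ∀ T : E, Equivalence fun x y : T ⟶ X => ∃ r : T ⟶ R, r ≫ p = x ∧ r ≫ q = y

/-- `R ⇉ X ⟶ Q` is exact: `p, q` is the kernel pair of `e`, and `e` the coequaliser of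
`p, q`. -/
def IsExact {R X Q : E} (p q : R ⟶ X) (e : X ⟶ Q) : Prop :=
  IsKernelPair e p q ∧ ∃ w : p ≫ e = q ≫ e, Nonempty (IsColimit (Cofork.ofπ e w))

/-- `e : X ⟶ Q` is a stable quotient of `p q : R ⟶ X`: the diagram `R ⇉ X ⟶ Q` is exact and it
remains so after pulling it back along an arbitrary map `h : P ⟶ Q`. -/
def IsStableQuotient {R X Q : E} (p q : R ⟶ X) (e : X ⟶ Q) : Prop :=
  IsExact p q e ∧ ∃ w : p ≫ e = q ≫ e, ∀ ⦃P : E⦄ (h : P ⟶ Q),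
    IsExact
      (pullback.lift (pullback.fst (p ≫ e) h ≫ p) (pullback.snd (p ≫ e) h)
        (by rw [Category.assoc, pullback.condition]) : pullback (p ≫ e) h ⟶ pullback e h)
      (pullback.lift (pullback.fst (p ≫ e) h ≫ q) (pullback.snd (p ≫ e) h)
        (by rw [Category.assoc, ← w, pullback.condition]) : pullback (p ≫ e) h ⟶ pullback e h)
      (pullback.snd e h)

/-- `(E, S)` is a predicative category with small maps. -/
structure IsPredicative (S : MorphismProperty E) : Prop extends IsClassOfSmallMaps S where
  /-- small maps are exponentiable -/
  exponentiable : ∀ {Y X : E} (f : Y ⟶ X), S f → (Over.pullback f).IsLeftAdjoint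
  /-- W-types: the polynomial functor of a small map has an initial algebra -/
  wtypes : ∀ {Y X : E} (f : Y ⟶ X) (_ : S f) [(Over.pullback f).IsLeftAdjoint],
    HasInitial (Endofunctor.Algebra (polynomialFunctor f))
  /-- there is a natural numbers object, and it is small -/
  nno : ∃ (N : E) (zero : ⊤_ E ⟶ N) (succ : N ⟶ N),
    IsNaturalNumbersObject zero succ ∧ S (terminal.from N)
  /-- there is a universal small map `π`: every small map is covered by a pullback of `π` -/
  representability : ∃ (V U : E) (π : V ⟶ U), S π ∧
    ∀ {Y X : E} (f : Y ⟶ X), S f →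
      ∃ (B A : E) (g : B ⟶ A) (t : B ⟶ Y) (p : A ⟶ X) (t' : B ⟶ V) (p' : A ⟶ U),
        IsCover t ∧ IsCoveringSquare t g f p ∧ IsPullback t' g π p'
  /-- bounded exactness: equivalence relations given by small monos have stable quotients -/
  bounded_exactness : ∀ {R X : E} (p q : R ⟶ X), IsEquivalenceRelation p q →
    S (prod.lift p q) → ∃ (Q : E) (e : X ⟶ Q), IsStableQuotient p q e

end SmallMaps

/-! ## Internal categories -/

section InternalCategories

variable (E : Type u) [Category.{v} E] [PositiveHeytingCategory E]

/-- An internal category in `E`. The laws are stated for `T`-indexed families of arrows; here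
`lift f g h ≫ comp` is the composite `f ∘ g`, defined when `dom f = cod g`. -/
structure InternalCategory where
  C₀ : E
  C₁ : E
  dom : C₁ ⟶ C₀
  cod : C₁ ⟶ C₀
  ident : C₀ ⟶ C₁
  comp : pullback dom cod ⟶ C₁
  ident_dom : ident ≫ dom = 𝟙 C₀
  ident_cod : ident ≫ cod = 𝟙 C₀
  comp_dom : comp ≫ dom = pullback.snd dom cod ≫ dom
  comp_cod : comp ≫ cod = pullback.fst dom cod ≫ cod
  comp_ident : ∀ {T : E} (f : T ⟶ C₁),
    pullback.lift f (f ≫ dom ≫ ident) (by simp [ident_cod]) ≫ comp = f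
  ident_comp : ∀ {T : E} (f : T ⟶ C₁),
    pullback.lift (f ≫ cod ≫ ident) f (by simp [ident_dom]) ≫ comp = f
  assoc : ∀ {T : E} (f g k : T ⟶ C₁) (h₁ : f ≫ dom = g ≫ cod) (h₂ : g ≫ dom = k ≫ cod),
    pullback.lift (pullback.lift f g h₁ ≫ comp) k (by
      rw [Category.assoc, comp_dom, pullback.lift_snd_assoc, h₂]) ≫ comp =
      pullback.lift f (pullback.lift g k h₂ ≫ comp) (by
        rw [Category.assoc, comp_cod, pullback.lift_fst_assoc, h₁]) ≫ comp

variable {E}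

namespace InternalCategory

variable (C : InternalCategory E)

/-- The composite `f ∘ g` of `T`-indexed arrows with `dom f = cod g`. -/
def mul {T : E} (f g : T ⟶ C.C₁) (h : f ≫ C.dom = g ≫ C.cod) : T ⟶ C.C₁ :=
  pullback.lift f g h ≫ C.comp

lemma mul_dom {T : E} (f g : T ⟶ C.C₁) (h : f ≫ C.dom = g ≫ C.cod) :
    C.mul f g h ≫ C.dom = g ≫ C.dom := by
  rw [mul, Category.assoc, C.comp_dom, pullback.lift_snd_assoc]

lemma mul_cod {T : E} (f g : T ⟶ C.C₁) (h : f ≫ C.dom = g ≫ C.cod) :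
    C.mul f g h ≫ C.cod = f ≫ C.cod := by
  rw [mul, Category.assoc, C.comp_cod, pullback.lift_fst_assoc]

/-! ## Sieves

For `a : T ⟶ C₀`, a `T`-indexed family `(S_t)_{t ∈ T}` of sets of arrows with `cod f = a t`
for all `f ∈ S_t` is a subobject of `T ×_{C₀} C₁ = pullback a cod`. -/

/-- The object `{(t, f) : cod f = a t}` of arrows into the `T`-indexed object `a`; its maximal
subobject is the maximal sieve on `a`. -/
abbrev arrowsInto {T : E} (a : T ⟶ C.C₀) : E := pullback a C.cod

/-- `f ∈ S_t`, for `T'`-indexed elements `t` of `T` and `f` of `C₁`. -/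
def Mem {T : E} {a : T ⟶ C.C₀} (S : Subobject (C.arrowsInto a)) {T' : E} (t : T' ⟶ T)
    (f : T' ⟶ C.C₁) (h : t ≫ a = f ≫ C.cod) : Prop :=
  S.Factors (pullback.lift t f h)

/-- `S` is a family of sieves on `a`: each `S_t` is small and closed under precomposition. -/
def IsSieve (Sm : MorphismProperty E) {T : E} (a : T ⟶ C.C₀)
    (S : Subobject (C.arrowsInto a)) : Prop :=
  Sm (S.arrow ≫ pullback.fst a C.cod) ∧
    ∀ ⦃T' : E⦄ (t : T' ⟶ T) (f g : T' ⟶ C.C₁) (h : t ≫ a = f ≫ C.cod)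
      (h' : f ≫ C.dom = g ≫ C.cod),
      C.Mem S t f h → C.Mem S t (C.mul f g h') (by rw [mul_cod, h])

/-- The family `(S_{u t})_t`, for a family `S` indexed by `I` and a map `u : T ⟶ I`. -/
def reindex {I : E} {b : I ⟶ C.C₀} (S : Subobject (C.arrowsInto b)) {T : E} (u : T ⟶ I)
    (a : T ⟶ C.C₀) (h : u ≫ b = a) : Subobject (C.arrowsInto a) :=
  (Subobject.pullback (pullback.lift (pullback.fst a C.cod ≫ u) (pullback.snd a C.cod)
    (by rw [Category.assoc, h, pullback.condition]))).obj S

/-- The family of sieves `f^*(S_t) = {g : f ∘ g ∈ S_t}` on `dom f`, for `T'`-indexed elements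
`t` of `T` and `f` of `C₁` with `cod f = a t`. -/
def sievePullback {T : E} {a : T ⟶ C.C₀} (S : Subobject (C.arrowsInto a)) {T' : E}
    (t : T' ⟶ T) (f : T' ⟶ C.C₁) (h : t ≫ a = f ≫ C.cod) :
    Subobject (C.arrowsInto (f ≫ C.dom)) :=
  (Subobject.pullback (pullback.lift (pullback.fst (f ≫ C.dom) C.cod ≫ t)
    (C.mul (pullback.fst (f ≫ C.dom) C.cod ≫ f) (pullback.snd (f ≫ C.dom) C.cod)
      (by rw [Category.assoc, pullback.condition]))
    (by rw [mul_cod, Category.assoc, Category.assoc, h]))).obj S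

end InternalCategory

/-- An internal class of pairs `(a, S)` with `a` an object of `C` and `S` a sieve on `a`, that
is, a subobject of the object of sieves of `C`, presented by means of its universal family:
an object `index` with a family of sieves on `base : index ⟶ C₀` such that elements of `index`
with the same object and the same sieve are equal. Mapping into `index` is the same as giving a
family of objects and sieves which belong to the class. -/
structure SieveClass (Sm : MorphismProperty E) (C : InternalCategory E) where
  index : E
  base : index ⟶ C.C₀
  sieve : Subobject (C.arrowsInto base)
  isSieve : C.IsSieve Sm base sieve
  extensional : ∀ {T : E} (u v : T ⟶ index) (a : T ⟶ C.C₀) (hu : u ≫ base = a)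
    (hv : v ≫ base = a), C.reindex sieve u a hu = C.reindex sieve v a hv → u = v

/-- The pairs `(a_t, S_t)`, for `t ∈ T`, all belong to the class `K`. -/
def SieveClass.Contains {Sm : MorphismProperty E} {C : InternalCategory E}
    (K : SieveClass Sm C) {T : E} (a : T ⟶ C.C₀) (S : Subobject (C.arrowsInto a)) : Prop :=
  ∃ (u : T ⟶ K.index) (h : u ≫ K.base = a), C.reindex K.sieve u a h = S

/-! ## Sites -/

/-- A Grothendieck topology on the internal category `C`. -/
structure Topology (Sm : MorphismProperty E) (C : InternalCategory E) where
  Cov : SieveClass Sm C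
  maximality : ∀ {T : E} (a : T ⟶ C.C₀), Cov.Contains a ⊤
  stability : ∀ {T : E} (a : T ⟶ C.C₀) (S : Subobject (C.arrowsInto a)), Cov.Contains a S →
    ∀ {T' : E} (t : T' ⟶ T) (f : T' ⟶ C.C₁) (h : t ≫ a = f ≫ C.cod),
      Cov.Contains (f ≫ C.dom) (C.sievePullback S t f h)
  local_character : ∀ {T : E} (a : T ⟶ C.C₀) (S R : Subobject (C.arrowsInto a)),
    C.IsSieve Sm a S → Cov.Contains a R →
    (∀ {T' : E} (t : T' ⟶ T) (f : T' ⟶ C.C₁) (h : t ≫ a = f ≫ C.cod),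
      C.Mem R t f h → Cov.Contains (f ≫ C.dom) (C.sievePullback S t f h)) →
    Cov.Contains a S

/-- A presentation of the topology `J`: a class `BCov` of sieves, with `BCov(a)` small for each
object `a`, such that a sieve `S` covers `a` iff there is some `R ∈ BCov(a)` with `R ⊆ S`. The
existential quantifier is that of the internal logic: for a `T`-indexed family the witness `R`
exists after passing to a cover `c` of `T`. -/
def Topology.IsPresentation {Sm : MorphismProperty E} {C : InternalCategory E}
    (J : Topology Sm C) (BCov : SieveClass Sm C) : Prop :=
  Sm BCov.base ∧ ∀ {T : E} (a : T ⟶ C.C₀) (S : Subobject (C.arrowsInto a)),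
    C.IsSieve Sm a S →
    (J.Cov.Contains a S ↔
      ∃ (T' : E) (c : T' ⟶ T) (R : Subobject (C.arrowsInto (c ≫ a))),
        IsCover c ∧ BCov.Contains (c ≫ a) R ∧ R ≤ C.reindex S c (c ≫ a) rfl)

/-- A topology is presentable if it has a presentation. -/
def Topology.IsPresentable {Sm : MorphismProperty E} {C : InternalCategory E}
    (J : Topology Sm C) : Prop :=
  ∃ BCov : SieveClass Sm C, J.IsPresentation BCov

/-! ## Internal presheaves -/

/-- An internal presheaf on `C`: an object `X` over `C₀` with a right action of `C₁`, sending
`x ∈ X(a)` and `f : b ⟶ a` to `x · f ∈ X(b)`. -/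
structure Presheaf (C : InternalCategory E) where
  X : E
  base : X ⟶ C.C₀
  act : pullback base C.cod ⟶ X
  act_base : act ≫ base = pullback.snd base C.cod ≫ C.dom
  act_ident : ∀ {T : E} (x : T ⟶ X),
    pullback.lift x (x ≫ base ≫ C.ident) (by simp [C.ident_cod]) ≫ act = x
  act_mul : ∀ {T : E} (x : T ⟶ X) (f g : T ⟶ C.C₁) (h₁ : x ≫ base = f ≫ C.cod)
    (h₂ : f ≫ C.dom = g ≫ C.cod),
    pullback.lift x (C.mul f g h₂) (by rw [C.mul_cod, h₁]) ≫ act =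
      pullback.lift (pullback.lift x f h₁ ≫ act) g (by
        rw [Category.assoc, act_base, pullback.lift_snd_assoc, h₂]) ≫ act

namespace Presheaf

variable {C : InternalCategory E}

/-- The restriction `x · f`, for `T`-indexed elements. -/
def restrict (P : Presheaf C) {T : E} (x : T ⟶ P.X) (f : T ⟶ C.C₁)
    (h : x ≫ P.base = f ≫ C.cod) : T ⟶ P.X :=
  pullback.lift x f h ≫ P.act

/-- Morphisms of internal presheaves. -/
@[ext]
structure Hom (P Q : Presheaf C) where
  map : P.X ⟶ Q.X
  map_base : map ≫ Q.base = P.base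
  map_restrict : ∀ {T : E} (x : T ⟶ P.X) (f : T ⟶ C.C₁) (h : x ≫ P.base = f ≫ C.cod),
    P.restrict x f h ≫ map =
      Q.restrict (x ≫ map) f (by rw [Category.assoc, map_base, h])

instance : Category (Presheaf C) where
  Hom := Hom
  id P :=
    { map := 𝟙 _
      map_base := Category.id_comp _
      map_restrict := fun x f h => by simp }
  comp F G :=
    { map := F.map ≫ G.map
      map_base := by rw [Category.assoc, G.map_base, F.map_base]
      map_restrict := fun x f h => by
        rw [← Category.assoc, F.map_restrict, G.map_restrict]
        simp only [Category.assoc] }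
  id_comp F := Hom.ext (Category.id_comp _)
  comp_id F := Hom.ext (Category.comp_id _)
  assoc F G H := Hom.ext (Category.assoc _ _ _)

/-- For a `T`-indexed family `R` of sieves on `a`, the map `x` from (the total object of) `R` to
`P.X` is a `T`-indexed compatible family: `x_f ∈ P(dom f)` and `x_f · g = x_{f ∘ g}` for
`f ∈ R_t` and `g` with `cod g = dom f`. Here `r` and `r'` stand for `f ∈ R_t` and
`f ∘ g ∈ R_t`. -/
def IsCompatibleFamily (P : Presheaf C) {T : E} {a : T ⟶ C.C₀}
    (R : Subobject (C.arrowsInto a)) (x : (R : E) ⟶ P.X) : Prop :=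
  ∃ hx : x ≫ P.base = R.arrow ≫ pullback.snd a C.cod ≫ C.dom,
    ∀ {T' : E} (r r' : T' ⟶ (R : E)) (g : T' ⟶ C.C₁)
      (hg : (r ≫ R.arrow ≫ pullback.snd a C.cod) ≫ C.dom = g ≫ C.cod),
      r' ≫ R.arrow ≫ pullback.fst a C.cod = r ≫ R.arrow ≫ pullback.fst a C.cod →
      r' ≫ R.arrow ≫ pullback.snd a C.cod =
        C.mul (r ≫ R.arrow ≫ pullback.snd a C.cod) g hg →
      P.restrict (r ≫ x) g (by rw [Category.assoc, hx, ← hg]; simp only [Category.assoc]) =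
        r' ≫ x

/-- The `T`-indexed element `y` of `P(a)` is an amalgamation (glueing) of the family `x`:
`y_t · f = x_f` for all `f ∈ R_t`. -/
def IsAmalgamation (P : Presheaf C) {T : E} {a : T ⟶ C.C₀}
    (R : Subobject (C.arrowsInto a)) (x : (R : E) ⟶ P.X) (y : T ⟶ P.X) : Prop :=
  ∃ hy : y ≫ P.base = a,
    P.restrict (R.arrow ≫ pullback.fst a C.cod ≫ y) (R.arrow ≫ pullback.snd a C.cod)
      (by simp only [Category.assoc, hy, pullback.condition]) = x

/-- A presheaf is a sheaf if every compatible family on a covering sieve has a unique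
amalgamation. -/
def IsSheaf {Sm : MorphismProperty E} (J : Topology Sm C) : ObjectProperty (Presheaf C) :=
  fun P => ∀ {T : E} (a : T ⟶ C.C₀) (R : Subobject (C.arrowsInto a)), J.Cov.Contains a R →
    ∀ x : (R : E) ⟶ P.X, P.IsCompatibleFamily R x → ∃! y : T ⟶ P.X, P.IsAmalgamation R x y

end Presheaf

/-- The category of internal sheaves, a full subcategory of the category of internal
presheaves. -/
abbrev Sheaves {Sm : MorphismProperty E} {C : InternalCategory E} (J : Topology Sm C) :=
  (Presheaf.IsSheaf J).FullSubcategory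

end InternalCategories

end

end AlgSetTheory

/-!
# Internal sheaves in a predicative category with small maps

The idea is to compare internal sheaves with sheaves in the ordinary sense. A *stage* is a
generalised object `a : T ⟶ C₀` of the internal category `C`; stages form an external category
(`Stage`), and an internal presheaf `P` determines the external presheaf of its generalised elements
(`Presheaf.elems`). This functor is fully faithful, and its essential image consists of the
presheaves which are *representable over `C₀`* (`IsRep`): those with a generic element from which
every other element is obtained by a unique reindexing. Covers and finite sums in `E`, together with
the covering sieves of the internal site, generate a coverage on stages (`Topology.coverage`), and
an internal presheaf is an internal sheaf exactly when its external presheaf is a sheaf. So internal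
sheaves are, by `toTopos`, a full subcategory of a Grothendieck topos `SheafTopos J`, namely that of
the sheaves which are representable over `C₀` (`exists_iso_toTopos`).

A Grothendieck topos has all the structure of a positive Heyting category. It remains to see that
the operations do not lead out of the representable sheaves. For finite limits this is clear
(`IsRep.of_isPullback`), and for universal quantification it follows from universal quantification
in `E` (`SheafTopos.exists_forall`). Images and sums are computed by sheafification, and this is
where small maps are needed. They are quotients of representable objects followed by the
sheafification of a subfunctor, and two facts make this work.

* The subsheaf generated by a subfunctor which is representable, hence already closed under covers
  and sums in `E`, is obtained in one step: an element belongs to it if, after passing to a cover of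
  the stage, all of its restrictions along one covering sieve belong to the subfunctor
  (`Topology.IsStageSheaf.sheafify_eq_closure`). Covering sieves chosen locally can be amalgamated
  into a single one by the collection axiom (`Topology.exists_union`).
* This subsheaf is again representable (`Topology.IsStageSheaf.exists_subRepresents_closure`). Since
  covering sieves are small, hence exponentiable, there is an object of matching families indexed by
  covering sieves (`Topology.IsStageSheaf.exists_matching`). Two such families have the same
  amalgamation if and only if they agree on the arrows which the two sieves have in common; this is
  a small equivalence relation, because universal quantification along small maps preserves small
  subobjects, and its quotient exists by bounded exactness
  (`Topology.IsStageSheaf.exists_subRepresents`).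

The initial sheaf is the subterminal sheaf of the stages which are covered by the empty sieve;
presentability of the site is used to form the object of objects of `C` with this property
(`exists_isInitial`). Sums and images are treated by `isRep_of_isColimit` and `isRep_image`.
Finally, the covers of internal sheaves are those maps which are epimorphisms of the topos
(`isCover_iff_epi_map`), so that stability of factorisations, and of sums, is inherited from the
topos.
-/

open CategoryTheory CategoryTheory.Limits

namespace AlgSetTheory

universe w v u

noncomputable section

attribute [local simp] pullback.lift_fst pullback.lift_snd pullback.lift_fst_assoc
  pullback.lift_snd_assoc prod.lift_fst prod.lift_snd prod.lift_fst_assoc prod.lift_snd_assoc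
  coprod.inl_desc coprod.inr_desc coprod.inl_desc_assoc coprod.inr_desc_assoc

open Opposite

attribute [local simp] InternalCategory.mul_dom InternalCategory.mul_cod
  InternalCategory.ident_dom InternalCategory.ident_cod

/-! ### Covers and universal quantification of monos -/

section Covers

variable {E : Type u} [Category.{v} E]

namespace IsCover

lemma of_isIso {B A : E} (f : B ⟶ A) [IsIso f] : IsCover f := by
  intro M m g _ h
  have : IsSplitEpi m := ⟨⟨inv f ≫ g, by rw [Category.assoc, h, IsIso.inv_hom_id]⟩⟩
  exact isIso_of_mono_of_isSplitEpi m

/-- Membership in a subobject descends along covers. -/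
lemma exists_lift {B A X M : E} [HasPullbacks E] {c : B ⟶ A} (hc : IsCover c) {m : M ⟶ X} [Mono m]
    {f : A ⟶ X} (h : ∃ k, k ≫ m = c ≫ f) : ∃ k, k ≫ m = f := by
  obtain ⟨k, hk⟩ := h
  have := hc (pullback.snd m f) (pullback.lift k c hk) inferInstance (pullback.lift_snd _ _ _)
  exact ⟨inv (pullback.snd m f) ≫ pullback.fst m f, by simp [pullback.condition]⟩

lemma comp [HasPullbacks E] {Z B A : E} {f : Z ⟶ B} {g : B ⟶ A} (hf : IsCover f)
    (hg : IsCover g) : IsCover (f ≫ g) := by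
  intro M m k hm hk
  obtain ⟨l, hl⟩ := hf.exists_lift (m := m) ⟨k, hk⟩
  exact hg m l hm hl

lemma epi [HasEqualizers E] {B A : E} {f : B ⟶ A} (hf : IsCover f) : Epi f := by
  refine ⟨fun g h w => ?_⟩
  have := hf (equalizer.ι g h) (equalizer.lift f w) inferInstance (by simp)
  rw [← cancel_epi (equalizer.ι g h), equalizer.condition]

/-- Coequalisers are covers. -/
lemma of_isColimit {R B A : E} {p q : R ⟶ B} {e : B ⟶ A} (w : p ≫ e = q ≫ e)
    (h : IsColimit (Cofork.ofπ e w)) : IsCover e := by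
  intro M m g hm hg
  have hpq : p ≫ g = q ≫ g := by rw [← cancel_mono m]; simp [hg, w]
  have h1 : e ≫ Cofork.IsColimit.desc h g hpq = g := Cofork.IsColimit.π_desc' h g hpq
  have : IsSplitEpi m := ⟨⟨Cofork.IsColimit.desc h g hpq, by
    refine Cofork.IsColimit.hom_ext h ?_
    simp only [Cofork.π_ofπ]
    rw [← Category.assoc, h1, hg]
    exact (Category.comp_id e).symm⟩⟩
  exact isIso_of_mono_of_isSplitEpi m

lemma coprodMap [HasFiniteCoproducts E] [HasPullbacks E] {B A B' A' : E} {f : B ⟶ A}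
    {f' : B' ⟶ A'} (hf : IsCover f) (hf' : IsCover f') : IsCover (coprod.map f f') := by
  intro M m g hm hg
  obtain ⟨k, hk⟩ := hf.exists_lift (m := m) (f := coprod.inl) ⟨coprod.inl ≫ g, by simp [hg]⟩
  obtain ⟨k', hk'⟩ := hf'.exists_lift (m := m) (f := coprod.inr) ⟨coprod.inr ≫ g, by simp [hg]⟩
  have : IsSplitEpi m := ⟨⟨coprod.desc k k', by ext <;> simp [hk, hk']⟩⟩
  exact isIso_of_mono_of_isSplitEpi m

end IsCover

end Covers

section Heyting

variable {E : Type u} [Category.{v} E] [PositiveHeytingCategory E]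

lemma IsCover.of_isPullback {D B C A : E} {q : D ⟶ B} {g : D ⟶ C} {f : B ⟶ A} {p : C ⟶ A}
    (h : IsPullback q g f p) (hf : IsCover f) : IsCover g :=
  PositiveHeytingCategory.cover_stable f q g p h hf

lemma IsCover.pullback_snd {B C A : E} {f : B ⟶ A} (hf : IsCover f) (p : C ⟶ A) :
    IsCover (pullback.snd f p) :=
  hf.of_isPullback (IsPullback.of_hasPullback f p)

lemma IsCover.pullback_fst {B C A : E} {f : B ⟶ A} (hf : IsCover f) (p : C ⟶ A) :
    IsCover (pullback.fst p f) :=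
  hf.of_isPullback (IsPullback.of_hasPullback p f).flip

/-- Covers are regular epimorphisms: a map which identifies whatever the cover `c` identifies
descends along `c`. -/
lemma IsCover.exists_desc {B A W : E} {c : B ⟶ A} (hc : IsCover c) (g : B ⟶ W)
    (h : ∀ ⦃T : E⦄ (x y : T ⟶ B), x ≫ c = y ≫ c → x ≫ g = y ≫ g) : ∃ k, c ≫ k = g := by
  -- The image of `(c, g)` in `A × W` is the graph of the descended map.
  obtain ⟨I, e, m, he, hm, hem⟩ :=
    PositiveHeytingCategory.exists_factorisation (prod.lift c g)
  have hc1 : e ≫ m ≫ prod.fst = c := by rw [← Category.assoc, hem, prod.lift_fst]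
  have hg1 : e ≫ m ≫ prod.snd = g := by rw [← Category.assoc, hem, prod.lift_snd]
  have : Mono (m ≫ prod.fst) := by
    refine ⟨fun {Z} a b hab => ?_⟩
    have h1 := he.pullback_snd a
    have h2 := he.pullback_snd (pullback.snd e a ≫ b)
    have := (h2.comp h1).epi
    rw [← cancel_epi (pullback.snd e (pullback.snd e a ≫ b) ≫ pullback.snd e a), ← cancel_mono m]
    have ea : (pullback.snd e (pullback.snd e a ≫ b) ≫ pullback.snd e a) ≫ a =
        (pullback.snd e (pullback.snd e a ≫ b) ≫ pullback.fst e a) ≫ e := by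
      simp [pullback.condition]
    have eb : (pullback.snd e (pullback.snd e a ≫ b) ≫ pullback.snd e a) ≫ b =
        pullback.fst e (pullback.snd e a ≫ b) ≫ e := by
      simp [pullback.condition]
    rw [ea, eb]
    have key : (pullback.snd e (pullback.snd e a ≫ b) ≫ pullback.fst e a) ≫ c =
        pullback.fst e (pullback.snd e a ≫ b) ≫ c := by
      rw [← hc1, ← Category.assoc, ← ea, ← Category.assoc _ e, ← eb]
      simp [hab]
    have key2 := h _ _ key
    rw [Category.assoc _ e, Category.assoc _ e, hem]
    ext <;> simp only [Category.assoc, prod.lift_fst, prod.lift_snd]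
    · simpa using key
    · simpa using key2
  have := hc (m ≫ prod.fst) e this hc1
  exact ⟨inv (m ≫ prod.fst) ≫ m ≫ prod.snd, by
    rw [← hg1, ← hc1]; simp⟩

/-- Universal quantification along `f` of a subobject of `Y`, described on generalised elements;
along a small map, small monos are quantified to small monos. -/
lemma exists_forall {Y X M : E} (f : Y ⟶ X) (m : M ⟶ Y) [Mono m] :
    ∃ (N : E) (n : N ⟶ X), Mono n ∧
      (∀ ⦃T : E⦄ (t : T ⟶ X), (∃ k, k ≫ n = t) ↔
        ∀ ⦃T' : E⦄ (s : T' ⟶ T) (y : T' ⟶ Y), y ≫ f = s ≫ t → ∃ k, k ≫ m = y) ∧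
      (∀ S : MorphismProperty E, IsClassOfSmallMaps S → S f → S m → S n) := by
  let A := (univ f).obj (Subobject.mk m)
  let adj := Adjunction.ofIsLeftAdjoint (Subobject.pullback f)
  have gc : ∀ B : Subobject X, (Subobject.pullback f).obj B ≤ Subobject.mk m ↔ B ≤ A := fun B =>
    ⟨fun h => (adj.homEquiv _ _ h.hom).le, fun h => ((adj.homEquiv _ _).symm h.hom).le⟩
  have hA : (Subobject.pullback f).obj A ≤ Subobject.mk m := (gc A).2 le_rfl
  refine ⟨A, A.arrow, inferInstance, fun T t => ⟨?_, fun h => ?_⟩, fun S hS hf hm => ?_⟩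
  · rintro ⟨k, rfl⟩ T' s y hy
    have : ((Subobject.pullback f).obj A).Factors y := by
      rw [Subobject.factors_iff]
      refine ⟨(Subobject.isPullback f A).lift (s ≫ k) y (by simp [hy]), ?_⟩
      exact (Subobject.isPullback f A).lift_snd _ _ _
    have := Subobject.factors_of_le y hA this
    rw [Subobject.mk_factors_iff] at this
    exact this
  · obtain ⟨I, e, i, he, hi, rfl⟩ := PositiveHeytingCategory.exists_factorisation t
    have : (Subobject.mk i) ≤ A := by
      rw [← gc]
      have pb := Subobject.isPullback f (Subobject.mk i)
      let ι := (Subobject.underlyingIso i).inv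
      have hc := he.pullback_fst
        (Subobject.pullbackπ f (Subobject.mk i) ≫ (Subobject.underlyingIso i).hom)
      obtain ⟨k, hk⟩ := hc.exists_lift (m := m)
        (f := ((Subobject.pullback f).obj (Subobject.mk i)).arrow) (h (pullback.snd _ _) _ (by
          rw [Category.assoc, ← pb.w, ← pullback.condition_assoc]
          simp))
      exact Subobject.le_mk_of_comm k hk
    exact ⟨e ≫ Subobject.ofMkLE i A this, by simp⟩
  · refine hS.heyting f _ hf ?_
    have : (Subobject.mk m).arrow = (Subobject.underlyingIso m).hom ≫ m := by simp
    rw [this]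
    refine hS.comp _ _ ?_ hm
    exact hS.pullback_stable (terminal.from _) _ (𝟙 (⊤_ E)) (terminal.from _)
      (IsPullback.of_vert_isIso ⟨Subsingleton.elim _ _⟩) hS.finite_one

end Heyting

/-! ### Sums and small maps -/

section Sums

variable {E : Type u} [Category.{v} E]

/-- `i` and `j` exhibit their common codomain as a binary sum. -/
def IsSum {X Y Z : E} (i : X ⟶ Z) (j : Y ⟶ Z) : Prop :=
  Nonempty (IsColimit (BinaryCofan.mk i j))

/-- `T` is an initial object. -/
def IsEmptyObj (T : E) : Prop := Nonempty (IsInitial T)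

lemma IsEmptyObj.hom_ext {T W : E} (h : IsEmptyObj T) (f g : T ⟶ W) : f = g :=
  h.some.hom_ext f g

lemma IsSum.exists_desc {X Y Z W : E} {i : X ⟶ Z} {j : Y ⟶ Z} (h : IsSum i j) (f : X ⟶ W)
    (g : Y ⟶ W) : ∃ k, i ≫ k = f ∧ j ≫ k = g :=
  ⟨h.some.desc (BinaryCofan.mk f g), h.some.fac (BinaryCofan.mk f g) ⟨WalkingPair.left⟩,
    h.some.fac (BinaryCofan.mk f g) ⟨WalkingPair.right⟩⟩

lemma IsSum.hom_ext {X Y Z W : E} {i : X ⟶ Z} {j : Y ⟶ Z} (h : IsSum i j) {f g : Z ⟶ W}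
    (hi : i ≫ f = i ≫ g) (hj : j ≫ f = j ≫ g) : f = g :=
  BinaryCofan.IsColimit.hom_ext h.some hi hj

lemma IsSum.of_existsUnique {X Y Z : E} {i : X ⟶ Z} {j : Y ⟶ Z}
    (h : ∀ ⦃W : E⦄ (f : X ⟶ W) (g : Y ⟶ W), ∃! k, i ≫ k = f ∧ j ≫ k = g) : IsSum i j :=
  ⟨BinaryCofan.isColimitMk (fun s => (h s.inl s.inr).choose)
    (fun s => (h s.inl s.inr).choose_spec.1.1) (fun s => (h s.inl s.inr).choose_spec.1.2)
    (fun s _ h₁ h₂ => (h s.inl s.inr).choose_spec.2 _ ⟨h₁, h₂⟩)⟩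

lemma IsSum.comp_iso {X Y Z X' Y' Z' : E} {i : X ⟶ Z} {j : Y ⟶ Z} (h : IsSum i j)
    (e : X' ≅ X) (e' : Y' ≅ Y) (l : Z ≅ Z') : IsSum (e.hom ≫ i ≫ l.hom) (e'.hom ≫ j ≫ l.hom) := by
  refine IsSum.of_existsUnique fun W f g => ?_
  obtain ⟨k, hk, hk'⟩ := h.exists_desc (e.inv ≫ f) (e'.inv ≫ g)
  refine ⟨l.inv ≫ k, ⟨by simp [hk], by simp [hk']⟩, ?_⟩
  rintro k' ⟨rfl, rfl⟩
  rw [Iso.eq_inv_comp]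
  exact h.hom_ext (by simp [hk]) (by simp [hk'])

lemma isSum_coprod [HasBinaryCoproducts E] (X Y : E) :
    IsSum (coprod.inl : X ⟶ X ⨿ Y) coprod.inr :=
  ⟨coprodIsCoprod X Y⟩

/-- A map out of a sum factors through a subobject as soon as both of its restrictions do. -/
lemma IsSum.exists_lift {X Y Z M W : E} {i : X ⟶ Z} {j : Y ⟶ Z} (h : IsSum i j) {m : M ⟶ W}
    [Mono m] {f : Z ⟶ W} (hi : ∃ k, k ≫ m = i ≫ f) (hj : ∃ k, k ≫ m = j ≫ f) :
    ∃ k, k ≫ m = f := by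
  obtain ⟨k, hk⟩ := hi
  obtain ⟨l, hl⟩ := hj
  obtain ⟨n, hn, hn'⟩ := h.exists_desc k l
  exact ⟨n, h.hom_ext (by rw [← hk, ← hn, Category.assoc]) (by rw [← hl, ← hn', Category.assoc])⟩

variable [PositiveHeytingCategory E]

/-- Sums are stable under pullback. -/
lemma IsSum.of_isPullback {X Y Z X' Y' Z' : E} {i : X ⟶ Z} {j : Y ⟶ Z} (h : IsSum i j)
    {f : Z' ⟶ Z} {i' : X' ⟶ Z'} {j' : Y' ⟶ Z'} {p : X' ⟶ X} {q : Y' ⟶ Y}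
    (hi : IsPullback i' p f i) (hj : IsPullback j' q f j) : IsSum i' j' := by
  let l : Z ≅ X ⨿ Y := h.some.coconePointUniqueUpToIso (colimit.isColimit (pair X Y))
  have hl : i ≫ l.hom = coprod.inl :=
    h.some.comp_coconePointUniqueUpToIso_hom (colimit.isColimit (pair X Y)) ⟨WalkingPair.left⟩
  have hl' : j ≫ l.hom = coprod.inr :=
    h.some.comp_coconePointUniqueUpToIso_hom (colimit.isColimit (pair X Y)) ⟨WalkingPair.right⟩
  have s : IsSum _ _ := PositiveHeytingCategory.coprod_stable (f ≫ l.hom)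
  have hi' : IsPullback i' p (f ≫ l.hom) coprod.inl := by
    have := hi.paste_vert (IsPullback.of_vert_isIso (fst := i) (snd := 𝟙 X) (f := l.hom)
      (g := coprod.inl) ⟨by simp [hl]⟩ : IsPullback i (𝟙 X) l.hom coprod.inl)
    simpa using this
  have hj' : IsPullback j' q (f ≫ l.hom) coprod.inr := by
    have := hj.paste_vert (IsPullback.of_vert_isIso (fst := j) (snd := 𝟙 Y) (f := l.hom)
      (g := coprod.inr) ⟨by simp [hl']⟩ : IsPullback j (𝟙 Y) l.hom coprod.inr)
    simpa using this
  simpa using s.comp_iso hi'.isoPullback hj'.isoPullback (Iso.refl _)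

lemma IsEmptyObj.of_hom {Z T : E} (h : IsEmptyObj T) (f : Z ⟶ T) : IsEmptyObj Z := by
  have := PositiveHeytingCategory.initial_stable (f ≫ h.some.to (⊥_ E))
  exact ⟨initialIsInitial.ofIso (asIso (f ≫ h.some.to (⊥_ E))).symm⟩

lemma isEmptyObj_initial : IsEmptyObj (⊥_ E) := ⟨initialIsInitial⟩

lemma IsEmptyObj.mono {T A : E} (h : IsEmptyObj T) (f : T ⟶ A) : Mono f :=
  ⟨fun {_} x _ _ => (h.of_hom x).hom_ext _ _⟩

lemma IsSum.mono_left {X Y Z : E} {i : X ⟶ Z} {j : Y ⟶ Z} (h : IsSum i j) : Mono i := by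
  have := PositiveHeytingCategory.mono_inl X Y
  obtain ⟨k, hk, -⟩ := h.exists_desc (coprod.inl : X ⟶ X ⨿ Y) coprod.inr
  exact mono_of_mono_fac hk

lemma IsSum.mono_right {X Y Z : E} {i : X ⟶ Z} {j : Y ⟶ Z} (h : IsSum i j) : Mono j := by
  have := PositiveHeytingCategory.mono_inr X Y
  obtain ⟨k, -, hk⟩ := h.exists_desc (coprod.inl : X ⟶ X ⨿ Y) coprod.inr
  exact mono_of_mono_fac hk

lemma IsSum.isEmptyObj {X Y Z T : E} {i : X ⟶ Z} {j : Y ⟶ Z} (h : IsSum i j) {x : T ⟶ X}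
    {y : T ⟶ Y} (w : x ≫ i = y ≫ j) : IsEmptyObj T := by
  obtain ⟨k, hk, hk'⟩ := h.exists_desc (coprod.inl : X ⟶ X ⨿ Y) coprod.inr
  exact isEmptyObj_initial.of_hom ((PositiveHeytingCategory.disjoint X Y).lift x y (by
    rw [← hk, ← hk', reassoc_of% w]))

lemma IsSum.isCover_desc {X Y Z X' Y' : E} {i : X ⟶ Z} {j : Y ⟶ Z} (h : IsSum i j) {c : X' ⟶ X}
    {d : Y' ⟶ Y} (hc : IsCover c) (hd : IsCover d) :
    IsCover (coprod.desc (c ≫ i) (d ≫ j)) := by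
  have : coprod.desc (c ≫ i) (d ≫ j) = coprod.map c d ≫ coprod.desc i j := by simp
  rw [this]
  refine (hc.coprodMap hd).comp ?_
  obtain ⟨k, hk, hk'⟩ := h.exists_desc (coprod.inl : X ⟶ X ⨿ Y) coprod.inr
  have : IsIso (coprod.desc i j) := ⟨k, by ext <;> simp [hk, hk'],
    h.hom_ext (by rw [reassoc_of% hk]; simp) (by rw [reassoc_of% hk']; simp)⟩
  exact .of_isIso _

end Sums

section Small

variable {E : Type u} [Category.{v} E] [PositiveHeytingCategory E]

namespace IsClassOfSmallMaps

variable {S : MorphismProperty E} (hS : IsClassOfSmallMaps S)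
include hS

lemma of_isPullback {D B C A : E} {q : D ⟶ B} {g : D ⟶ C} {f : B ⟶ A} {p : C ⟶ A}
    (h : IsPullback q g f p) (hf : S f) : S g :=
  hS.pullback_stable q g f p h hf

lemma of_isIso {X Y : E} (f : X ⟶ Y) [IsIso f] : S f :=
  hS.of_isPullback (q := terminal.from _) (f := 𝟙 (⊤_ E)) (p := terminal.from _)
    (IsPullback.of_vert_isIso ⟨Subsingleton.elim _ _⟩) hS.finite_one

lemma pullback_snd {B C A : E} {f : B ⟶ A} (hf : S f) (p : C ⟶ A) : S (pullback.snd f p) :=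
  hS.of_isPullback (IsPullback.of_hasPullback f p) hf

lemma pullback_fst {B C A : E} {f : B ⟶ A} (hf : S f) (p : C ⟶ A) : S (pullback.fst p f) :=
  hS.of_isPullback (IsPullback.of_hasPullback p f).flip hf

lemma equalizer_ι {X Y : E} (f g : X ⟶ Y) : S (equalizer.ι f g) := by
  refine hS.of_isPullback (q := equalizer.ι f g ≫ f) (f := diag Y) (p := prod.lift f g) ?_
    (hS.diagonals Y)
  refine ⟨⟨by ext <;> simp; exact equalizer.condition f g⟩, ⟨PullbackCone.IsLimit.mk _
    (fun s => equalizer.lift s.snd ?_) ?_ ?_ ?_⟩⟩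
  · have h := s.condition
    have h1 := congr($h ≫ prod.fst)
    have h2 := congr($h ≫ prod.snd)
    simp at h1 h2
    rw [← h1, ← h2]
  · intro s
    have h1 := congr($(s.condition) ≫ prod.fst)
    simp at h1
    simp [h1]
  · intro s; simp
  · intro s m _ h2
    ext; simp [h2]

/-- The comparison of a fibre product over `A` with the product is small. -/
lemma lift_pullback {X Y A : E} (f : X ⟶ A) (g : Y ⟶ A) :
    S (prod.lift (pullback.fst f g) (pullback.snd f g)) := by
  refine hS.of_isPullback (q := pullback.fst f g ≫ f) (f := diag A) (p := prod.map f g) ?_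
    (hS.diagonals A)
  refine ⟨⟨by ext <;> simp [pullback.condition]⟩, ⟨PullbackCone.IsLimit.mk _
    (fun s => pullback.lift (s.snd ≫ prod.fst) (s.snd ≫ prod.snd) ?_) ?_ ?_ ?_⟩⟩
  · have h1 := congr($(s.condition) ≫ prod.fst)
    have h2 := congr($(s.condition) ≫ prod.snd)
    simp at h1 h2
    simp [← h1, ← h2]
  · intro s
    have h1 := congr($(s.condition) ≫ prod.fst)
    simp at h1
    simp [h1]
  · intro s; ext <;> simp
  · intro s m _ h2
    ext <;> simp [← h2]

lemma of_isEmptyObj {T : E} (hT : IsEmptyObj T) (X : E) (f : T ⟶ X) : S f := by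
  refine hS.of_isPullback (q := hT.some.to _) (f := initial.to (⊤_ E)) (p := terminal.from X) ?_
    hS.finite_zero
  exact ⟨⟨Subsingleton.elim _ _⟩, ⟨PullbackCone.IsLimit.mk _
    (fun s => (isEmptyObj_initial.of_hom s.fst).some.to _)
    (fun s => (isEmptyObj_initial.of_hom s.fst).hom_ext _ _)
    (fun s => (isEmptyObj_initial.of_hom s.fst).hom_ext _ _)
    (fun s _ _ _ => (isEmptyObj_initial.of_hom s.fst).hom_ext _ _)⟩⟩

/-- The codiagonal of `X` is small, being a pullback of `1 + 1 ⟶ 1`. -/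
lemma codiag (X : E) : S (coprod.desc (𝟙 X) (𝟙 X)) := by
  have key : ∀ i : (⊤_ E) ⟶ (⊤_ E) ⨿ (⊤_ E),
      IsPullback (prod.lift (𝟙 X) (terminal.from X ≫ i) : X ⟶ X ⨯ ((⊤_ E) ⨿ (⊤_ E)))
        (terminal.from X) prod.snd i := fun i => by
    refine ⟨⟨by simp⟩, ⟨PullbackCone.IsLimit.mk _ (fun s => s.fst ≫ prod.fst) ?_ ?_ ?_⟩⟩
    · intro s
      ext
      · simp
      · simp only [Category.assoc, prod.lift_snd, s.condition]
        rw [← Category.assoc, ← Category.assoc]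
        congr 1
        exact Subsingleton.elim _ _
    · intro s; exact Subsingleton.elim _ _
    · intro s m h1 _
      simp [← h1]
  have hs := (isSum_coprod (⊤_ E) (⊤_ E)).of_isPullback (key coprod.inl) (key coprod.inr)
  obtain ⟨k, hk, hk'⟩ := hs.exists_desc (coprod.inl : X ⟶ X ⨿ X) coprod.inr
  let l : X ⨿ X ⟶ X ⨯ ((⊤_ E) ⨿ (⊤_ E)) := coprod.desc
    (prod.lift (𝟙 X) (terminal.from X ≫ coprod.inl)) (prod.lift (𝟙 X) (terminal.from X ≫ coprod.inr))
  have : IsIso l := ⟨k, by ext <;> simp [l, hk, hk'],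
    hs.hom_ext (by rw [reassoc_of% hk]; simp [l]) (by rw [reassoc_of% hk']; simp [l])⟩
  have e : coprod.desc (𝟙 X) (𝟙 X) = l ≫ prod.fst := by ext <;> simp [l]
  rw [e]
  refine hS.comp _ _ (hS.of_isIso l) ?_
  exact hS.of_isPullback (q := prod.snd) (f := terminal.from ((⊤_ E) ⨿ (⊤_ E)))
    (p := terminal.from X) (IsPullback.of_isLimit_binaryFan_of_isTerminal
      (prodIsProd _ _) terminalIsTerminal).flip hS.finite_two

end IsClassOfSmallMaps

/-- Unions of subobjects, described on generalised elements; unions of small monos are small. -/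
lemma exists_union {X M₁ M₂ : E} (m₁ : M₁ ⟶ X) (m₂ : M₂ ⟶ X) :
    ∃ (N : E) (n : N ⟶ X), Mono n ∧
      (∀ ⦃T : E⦄ (t : T ⟶ X), (∃ k, k ≫ n = t) ↔
        ∃ (T' T₁ T₂ : E) (c : T' ⟶ T) (i : T₁ ⟶ T') (j : T₂ ⟶ T'), IsCover c ∧ IsSum i j ∧
          (∃ k, k ≫ m₁ = i ≫ c ≫ t) ∧ (∃ k, k ≫ m₂ = j ≫ c ≫ t)) ∧
      (∀ S : MorphismProperty E, IsClassOfSmallMaps S → S m₁ → S m₂ → S n) := by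
  obtain ⟨N, e, n, he, hn, hen⟩ :=
    PositiveHeytingCategory.exists_factorisation (coprod.desc m₁ m₂)
  have h₁ : coprod.inl ≫ e ≫ n = m₁ := by simp [hen]
  have h₂ : coprod.inr ≫ e ≫ n = m₂ := by simp [hen]
  refine ⟨N, n, hn, fun T t => ⟨?_, ?_⟩, fun S hS hm₁ hm₂ => ?_⟩
  · rintro ⟨k, rfl⟩
    let f := pullback.fst e k
    refine ⟨_, _, _, pullback.snd e k, pullback.fst f coprod.inl, pullback.fst f coprod.inr,
      he.pullback_snd k, PositiveHeytingCategory.coprod_stable f,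
      ⟨pullback.snd f coprod.inl, ?_⟩, ⟨pullback.snd f coprod.inr, ?_⟩⟩
    · rw [← h₁, ← pullback.condition_assoc, ← pullback.condition_assoc]
    · rw [← h₂, ← pullback.condition_assoc, ← pullback.condition_assoc]
  · rintro ⟨T', T₁, T₂, c, i, j, hc, hij, ⟨k, hk⟩, l, hl⟩
    refine hc.exists_lift (hij.exists_lift ⟨k ≫ coprod.inl ≫ e, ?_⟩ ⟨l ≫ coprod.inr ≫ e, ?_⟩)
    · simp only [Category.assoc, h₁, hk]
    · simp only [Category.assoc, h₂, hl]
  · refine hS.quotients e n he ?_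
    have : e ≫ n = coprod.map m₁ m₂ ≫ coprod.desc (𝟙 X) (𝟙 X) := by rw [hen]; simp
    rw [this]
    exact hS.comp _ _ (hS.sums _ _ hm₁ hm₂) (hS.codiag X)

end Small

/-! ### Stages and representable presheaves -/

section Stages

variable {E : Type u} [Category.{v} E] [PositiveHeytingCategory E]

namespace InternalCategory

variable (C : InternalCategory E)

lemma comp_mul {T T' : E} (t : T' ⟶ T) (f g : T ⟶ C.C₁) (h : f ≫ C.dom = g ≫ C.cod) :
    t ≫ C.mul f g h = C.mul (t ≫ f) (t ≫ g) (by simp [h]) := by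
  rw [mul, mul, ← Category.assoc]
  congr 1
  ext <;> simp

lemma mul_ident {T : E} (f : T ⟶ C.C₁) (b : T ⟶ C.C₀) (h : f ≫ C.dom = (b ≫ C.ident) ≫ C.cod) :
    C.mul f (b ≫ C.ident) h = f := by
  obtain rfl : b = f ≫ C.dom := by rw [h]; simp
  simpa [mul] using C.comp_ident f

lemma ident_mul {T : E} (f : T ⟶ C.C₁) (b : T ⟶ C.C₀) (h : (b ≫ C.ident) ≫ C.dom = f ≫ C.cod) :
    C.mul (b ≫ C.ident) f h = f := by
  obtain rfl : b = f ≫ C.cod := by rw [← h]; simp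
  simpa [mul] using C.ident_comp f

lemma mul_assoc {T : E} (f g k : T ⟶ C.C₁) (h₁ : f ≫ C.dom = g ≫ C.cod)
    (h₂ : g ≫ C.dom = k ≫ C.cod) :
    C.mul (C.mul f g h₁) k (by simp [h₂]) = C.mul f (C.mul g k h₂) (by simp [h₁]) :=
  C.assoc f g k h₁ h₂

end InternalCategory

/-- A stage is a generalised object `a : T ⟶ C₀` of the internal category `C`. Stages are the
objects of an external category, the total category of the externalisation of `C`. -/
structure Stage (C : InternalCategory E) where
  T : E
  a : T ⟶ C.C₀

variable {C : InternalCategory E}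

namespace Stage

/-- A morphism of stages `(T', b) ⟶ (T, a)` is a map `t : T' ⟶ T` together with a `T'`-indexed
arrow of `C` from `b` to `a ∘ t`. -/
@[ext]
structure Hom (X Y : Stage C) where
  map : X.T ⟶ Y.T
  arr : X.T ⟶ C.C₁
  arr_cod : arr ≫ C.cod = map ≫ Y.a
  arr_dom : arr ≫ C.dom = X.a

attribute [local simp] Hom.arr_cod Hom.arr_dom

instance : Category (Stage C) where
  Hom := Hom
  id X := ⟨𝟙 _, X.a ≫ C.ident, by simp, by simp⟩
  comp f g := ⟨f.map ≫ g.map, C.mul (f.map ≫ g.arr) f.arr (by simp), by simp, by simp⟩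
  id_comp f := Hom.ext (Category.id_comp _) (by simp [C.mul_ident])
  comp_id f := Hom.ext (Category.comp_id _) (by
    have := C.ident_mul f.arr (f.map ≫ (Stage.a _)) (by simp)
    simpa using this)
  assoc f g h := Hom.ext (Category.assoc _ _ _) (by
    simp only [C.comp_mul, Category.assoc]
    exact (C.mul_assoc _ _ _ (by simp) (by simp)).symm)

@[ext]
lemma hom_ext {X Y : Stage C} {f g : X ⟶ Y} (h : f.map = g.map) (h' : f.arr = g.arr) : f = g :=
  Hom.ext h h'

@[simp] lemma id_map (X : Stage C) : Hom.map (𝟙 X) = 𝟙 X.T := rfl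
@[simp] lemma id_arr (X : Stage C) : Hom.arr (𝟙 X) = X.a ≫ C.ident := rfl
@[simp] lemma comp_map {X Y Z : Stage C} (f : X ⟶ Y) (g : Y ⟶ Z) :
    (f ≫ g).map = f.map ≫ g.map := rfl
lemma comp_arr {X Y Z : Stage C} (f : X ⟶ Y) (g : Y ⟶ Z) :
    (f ≫ g).arr = C.mul (f.map ≫ g.arr) f.arr (by simp) := rfl

/-- The constructor of morphisms of stages. -/
def homMk {X Y : Stage C} (t : X.T ⟶ Y.T) (f : X.T ⟶ C.C₁) (h : f ≫ C.cod = t ≫ Y.a)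
    (h' : f ≫ C.dom = X.a) : X ⟶ Y := ⟨t, f, h, h'⟩

@[simp] lemma homMk_map {X Y : Stage C} (t : X.T ⟶ Y.T) (f : X.T ⟶ C.C₁)
    (h : f ≫ C.cod = t ≫ Y.a) (h' : f ≫ C.dom = X.a) : (homMk t f h h').map = t := rfl
@[simp] lemma homMk_arr {X Y : Stage C} (t : X.T ⟶ Y.T) (f : X.T ⟶ C.C₁)
    (h : f ≫ C.cod = t ≫ Y.a) (h' : f ≫ C.dom = X.a) : (homMk t f h h').arr = f := rfl

/-- The vertical morphism of stages given by a map over `C₀`. -/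
def vert {X Y : Stage C} (c : X.T ⟶ Y.T) (h : c ≫ Y.a = X.a) : X ⟶ Y :=
  ⟨c, X.a ≫ C.ident, by simp [h], by simp⟩

@[simp] lemma vert_map {X Y : Stage C} (c : X.T ⟶ Y.T) (h : c ≫ Y.a = X.a) :
    (vert c h).map = c := rfl
@[simp] lemma vert_arr {X Y : Stage C} (c : X.T ⟶ Y.T) (h : c ≫ Y.a = X.a) :
    (vert c h).arr = X.a ≫ C.ident := rfl

@[simp] lemma vert_comp_arr {X Y Z : Stage C} (c : X.T ⟶ Y.T) (h : c ≫ Y.a = X.a) (f : Y ⟶ Z) :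
    (vert c h ≫ f).arr = c ≫ f.arr := by
  rw [comp_arr]
  exact C.mul_ident _ _ _

@[simp] lemma comp_vert_arr {X Y Z : Stage C} (f : X ⟶ Y) (c : Y.T ⟶ Z.T) (h : c ≫ Z.a = Y.a) :
    (f ≫ vert c h).arr = f.arr := by
  rw [comp_arr]
  have := C.ident_mul f.arr (f.map ≫ Y.a) (by simp)
  simpa using this

lemma vert_comp_vert {X Y Z : Stage C} (c : X.T ⟶ Y.T) (h : c ≫ Y.a = X.a) (d : Y.T ⟶ Z.T)
    (h' : d ≫ Z.a = Y.a) : vert c h ≫ vert d h' = vert (c ≫ d) (by simp [h, h']) := by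
  ext <;> simp

lemma vert_id (X : Stage C) (h) : vert (𝟙 X.T) h = 𝟙 X := rfl

lemma map_op_congr (F : (Stage C)ᵒᵖ ⥤ Type w) {X Y : Stage C} {f g : X ⟶ Y} (h : f.map = g.map)
    (h' : f.arr = g.arr) (z : F.obj (op Y)) : F.map f.op z = F.map g.op z := by
  rw [hom_ext h h']

lemma map_op_map_op (F : (Stage C)ᵒᵖ ⥤ Type w) {X Y Z : Stage C} (f : X ⟶ Y) (g : Y ⟶ Z)
    (z : F.obj (op Z)) : F.map f.op (F.map g.op z) = F.map (f ≫ g).op z := by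
  rw [op_comp, Functor.map_comp_apply]

end Stage

namespace Presheaf

variable (P : Presheaf C)

lemma comp_restrict {T T' : E} (t : T' ⟶ T) (x : T ⟶ P.X) (f : T ⟶ C.C₁)
    (h : x ≫ P.base = f ≫ C.cod) :
    t ≫ P.restrict x f h = P.restrict (t ≫ x) (t ≫ f) (by simp [h]) := by
  rw [restrict, restrict, ← Category.assoc]
  congr 1
  ext <;> simp

lemma restrict_base {T : E} (x : T ⟶ P.X) (f : T ⟶ C.C₁) (h : x ≫ P.base = f ≫ C.cod) :
    P.restrict x f h ≫ P.base = f ≫ C.dom := by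
  simp [restrict, P.act_base]

lemma restrict_ident {T : E} (x : T ⟶ P.X) (b : T ⟶ C.C₀)
    (h : x ≫ P.base = (b ≫ C.ident) ≫ C.cod) : P.restrict x (b ≫ C.ident) h = x := by
  obtain rfl : b = x ≫ P.base := by rw [h]; simp
  simpa [restrict] using P.act_ident x

lemma restrict_mul {T : E} (x : T ⟶ P.X) (f g : T ⟶ C.C₁) (h₁ : x ≫ P.base = f ≫ C.cod)
    (h₂ : f ≫ C.dom = g ≫ C.cod) :
    P.restrict x (C.mul f g h₂) (by simp [h₁]) =
      P.restrict (P.restrict x f h₁) g (by rw [restrict_base, h₂]) :=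
  P.act_mul x f g h₁ h₂

/-- The external presheaf of generalised elements of an internal presheaf. The values are lifted to
a universe in which presheaves on the category of stages can be sheafified. -/
def elems : Presheaf C ⥤ (Stage C)ᵒᵖ ⥤ Type (max u v) where
  obj P :=
    { obj := fun X => ULift.{u} {x : X.unop.T ⟶ P.X // x ≫ P.base = X.unop.a}
      map := fun f => TypeCat.ofHom fun x =>
        ⟨P.restrict (f.unop.map ≫ x.down.1) f.unop.arr
          (by rw [Category.assoc, x.down.2, f.unop.arr_cod]),
          by rw [restrict_base, f.unop.arr_dom]⟩
      map_id := fun X => by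
        ext x
        simp [restrict_ident]
      map_comp := fun f g => by
        ext x
        have := x.down.2
        change P.restrict ((g.unop.map ≫ f.unop.map) ≫ x.down.1)
          (C.mul (g.unop.map ≫ f.unop.arr) g.unop.arr _) _ =
          P.restrict (g.unop.map ≫ P.restrict (f.unop.map ≫ x.down.1) f.unop.arr _) g.unop.arr _
        rw [restrict_mul (h₁ := by simp [this, f.unop.arr_cod])]
        simp [comp_restrict] }
  map η :=
    { app := fun X => TypeCat.ofHom fun x => ⟨x.down.1 ≫ η.map, by
        rw [Category.assoc, η.map_base, x.down.2]⟩
      naturality := fun X Y f => by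
        ext x
        exact (η.map_restrict (f.unop.map ≫ x.down.1) f.unop.arr
          (by rw [Category.assoc, x.down.2, f.unop.arr_cod])).trans
            (by simp only [Category.assoc]; rfl) }
  map_id P := by
    ext X x
    exact Category.comp_id _
  map_comp f g := by
    ext X x
    exact (Category.assoc _ _ _).symm

/-- A generalised element of `P`, as an element of `elems.obj P`. -/
def mkElem {X : Stage C} (x : X.T ⟶ P.X) (h : x ≫ P.base = X.a) : (elems.obj P).obj (op X) :=
  ⟨x, h⟩

variable {P}

/-- The map underlying an element of `elems.obj P`. -/
def elemMap {X : Stage C} (z : (elems.obj P).obj (op X)) : X.T ⟶ P.X := z.down.1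

lemma elemMap_base {X : Stage C} (z : (elems.obj P).obj (op X)) : elemMap z ≫ P.base = X.a :=
  z.down.2

@[simp] lemma elemMap_mkElem {X : Stage C} (x : X.T ⟶ P.X) (h : x ≫ P.base = X.a) :
    elemMap (P.mkElem x h) = x := rfl

lemma elem_ext {X : Stage C} {z z' : (elems.obj P).obj (op X)} (h : elemMap z = elemMap z') :
    z = z' :=
  ULift.ext _ _ (Subtype.ext h)

lemma elemMap_map {X Y : Stage C} (f : X ⟶ Y) (z : (elems.obj P).obj (op Y)) :
    elemMap ((elems.obj P).map f.op z) = P.restrict (f.map ≫ elemMap z) f.arr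
      (by rw [Category.assoc, elemMap_base, f.arr_cod]) := rfl

@[simp] lemma elemMap_vert {X Y : Stage C} (c : X.T ⟶ Y.T) (h : c ≫ Y.a = X.a)
    (z : (elems.obj P).obj (op Y)) :
    elemMap ((elems.obj P).map (Stage.vert c h).op z) = c ≫ elemMap z := by
  rw [elemMap_map]
  exact P.restrict_ident _ _ _

lemma elemMap_app {Q : Presheaf C} (η : P ⟶ Q) {X : Stage C} (z : (elems.obj P).obj (op X)) :
    elemMap ((elems.map η).app (op X) z) = elemMap z ≫ Hom.map η := rfl

/-- The generic element. -/
def generic (P : Presheaf C) : (elems.obj P).obj (op ⟨P.X, P.base⟩) :=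
  P.mkElem (X := ⟨P.X, P.base⟩) (𝟙 _) (Category.id_comp _)

lemma vert_generic {X : Stage C} (z : (elems.obj P).obj (op X)) :
    (elems.obj P).map (Stage.vert (Y := ⟨P.X, P.base⟩) (elemMap z) (elemMap_base z)).op P.generic
      = z :=
  elem_ext (by simp [generic])

/-- Internal presheaves are determined by their external presheaves of elements. -/
def fullyFaithfulElems : (elems (C := C)).FullyFaithful where
  preimage {P Q} η :=
    have key : ∀ {X : Stage C} (z : (elems.obj P).obj (op X)),
        elemMap (η.app _ z) = elemMap z ≫ elemMap (η.app _ P.generic) := fun {X} z => by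
      conv_lhs => rw [← vert_generic z, NatTrans.naturality_apply]
      simp
    { map := elemMap (η.app _ P.generic)
      map_base := elemMap_base _
      map_restrict := fun {T} x f h => by
        let y : (elems.obj P).obj (op ⟨T, x ≫ P.base⟩) := P.mkElem (X := ⟨T, x ≫ P.base⟩) x rfl
        have h1 := key ((elems.obj P).map (Stage.homMk (X := ⟨T, f ≫ C.dom⟩)
          (Y := ⟨T, x ≫ P.base⟩) (𝟙 T) f (by simp [h]) rfl).op y)
        have h2 : elemMap (η.app _ y) = x ≫ elemMap (η.app _ P.generic) := key y
        have h3 : elemMap y = x := rfl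
        rw [NatTrans.naturality_apply, elemMap_map, elemMap_map] at h1
        simp only [Stage.homMk_map, Stage.homMk_arr, Category.id_comp] at h1
        simp only [h2, h3] at h1
        exact h1.symm }
  map_preimage {P Q} η := by
    ext ⟨X⟩ z
    apply elem_ext (X := X)
    change elemMap z ≫ elemMap (η.app _ P.generic) = elemMap (η.app (op X) z)
    conv_rhs => rw [← vert_generic z, NatTrans.naturality_apply]
    simp
  preimage_map {P Q} η := Hom.ext (by
    change elemMap ((elems.map η).app _ P.generic) = _
    rw [elemMap_app]
    exact Category.id_comp _)

end Presheaf

/-- The element `ξ` represents `F`: over each stage, the elements of `F` are the vertical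
restrictions of `ξ` along unique maps. -/
def Represents (F : (Stage C)ᵒᵖ ⥤ Type w) (Z : Stage C) (ξ : F.obj (op Z)) : Prop :=
  ∀ ⦃X : Stage C⦄ (z : F.obj (op X)),
    ∃! q : X.T ⟶ Z.T, ∃ h : q ≫ Z.a = X.a, F.map (Stage.vert q h).op ξ = z

/-- The external presheaf `F` is representable over `C₀`. -/
def IsRep (F : (Stage C)ᵒᵖ ⥤ Type w) : Prop := ∃ Z ξ, Represents F Z ξ

lemma represents_elems (P : Presheaf C) :
    Represents (Presheaf.elems.obj P) ⟨P.X, P.base⟩ P.generic := by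
  intro X z
  refine ⟨Presheaf.elemMap z, ⟨Presheaf.elemMap_base z, Presheaf.vert_generic z⟩, ?_⟩
  rintro q ⟨h, rfl⟩
  simp [Presheaf.generic]

namespace Represents

variable {F : (Stage C)ᵒᵖ ⥤ Type w} {Z : Stage C} {ξ : F.obj (op Z)} (hF : Represents F Z ξ)
include hF

/-- The map classifying an element. -/
def classify {X : Stage C} (z : F.obj (op X)) : X.T ⟶ Z.T := (hF z).choose

lemma classify_a {X : Stage C} (z : F.obj (op X)) : hF.classify z ≫ Z.a = X.a :=
  (hF z).choose_spec.1.choose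

lemma map_classify {X : Stage C} (z : F.obj (op X)) :
    F.map (Stage.vert (hF.classify z) (hF.classify_a z)).op ξ = z :=
  (hF z).choose_spec.1.choose_spec

lemma eq_classify {X : Stage C} {z : F.obj (op X)} (q : X.T ⟶ Z.T) (h : q ≫ Z.a = X.a)
    (e : F.map (Stage.vert q h).op ξ = z) : q = hF.classify z :=
  (hF z).choose_spec.2 q ⟨h, e⟩

lemma classify_injective {X : Stage C} {z z' : F.obj (op X)}
    (h : hF.classify z = hF.classify z') : z = z' := by
  rw [← hF.map_classify z, ← hF.map_classify z']
  simp only [h]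

lemma comp_classify {X Y : Stage C} (c : X.T ⟶ Y.T) (h : c ≫ Y.a = X.a) (z : F.obj (op Y)) :
    c ≫ hF.classify z = hF.classify (F.map (Stage.vert c h).op z) := by
  refine hF.eq_classify _ (by rw [Category.assoc, classify_a, h]) ?_
  conv_rhs => rw [← hF.map_classify z, ← Functor.map_comp_apply, ← op_comp,
    Stage.vert_comp_vert]

/-- The action of `C` on the object representing `F`: it classifies the restrictions of `ξ` along
arrows of `C`. -/
def act : pullback Z.a C.cod ⟶ Z.T :=
  hF.classify (X := ⟨pullback Z.a C.cod, pullback.snd Z.a C.cod ≫ C.dom⟩)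
    (F.map (Stage.homMk (pullback.fst Z.a C.cod) (pullback.snd Z.a C.cod)
      pullback.condition.symm rfl).op ξ)

lemma lift_act {T : E} (x : T ⟶ Z.T) (f : T ⟶ C.C₁) (h : x ≫ Z.a = f ≫ C.cod) (b : T ⟶ C.C₀)
    (hb : f ≫ C.dom = b) : pullback.lift x f h ≫ hF.act =
      hF.classify (X := ⟨T, b⟩) (F.map (Stage.homMk x f h.symm hb).op ξ) := by
  refine (hF.comp_classify (X := ⟨T, b⟩)
    (Y := ⟨pullback Z.a C.cod, pullback.snd Z.a C.cod ≫ C.dom⟩) _ (by simp [hb]) _).trans ?_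
  rw [← Functor.map_comp_apply, ← op_comp]
  have e : Stage.vert (X := ⟨T, b⟩) (Y := ⟨pullback Z.a C.cod, pullback.snd Z.a C.cod ≫ C.dom⟩)
      (pullback.lift x f h) (by simp [hb]) ≫ Stage.homMk (pullback.fst Z.a C.cod)
        (pullback.snd Z.a C.cod) pullback.condition.symm rfl =
      Stage.homMk (Y := Z) x f h.symm hb := by
    ext <;> simp
  rw [e]

/-- The internal presheaf with a given external presheaf of elements. -/
def presheaf : Presheaf C where
  X := Z.T
  base := Z.a
  act := hF.act
  act_base := hF.classify_a _
  act_ident {T} x := by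
    rw [hF.lift_act x _ _ (x ≫ Z.a) (by simp)]
    refine (hF.eq_classify (X := ⟨T, x ≫ Z.a⟩) x rfl ?_).symm
    refine Stage.map_op_congr F ?_ ?_ ξ <;> simp
  act_mul {T} x f g h₁ h₂ := by
    rw [hF.lift_act x _ _ (g ≫ C.dom) (by simp)]
    simp only [hF.lift_act x _ h₁ _ rfl]
    rw [hF.lift_act _ _ _ (g ≫ C.dom) rfl]
    congr 1
    have h := hF.map_classify (F.map (Stage.homMk (X := ⟨T, f ≫ C.dom⟩) x f h₁.symm rfl).op ξ)
    have h' := congr(F.map (Stage.homMk (X := ⟨T, g ≫ C.dom⟩) (Y := ⟨T, f ≫ C.dom⟩) (𝟙 T) g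
      (by simp [h₂]) rfl).op $h)
    rw [← Functor.map_comp_apply, ← Functor.map_comp_apply, ← op_comp, ← op_comp] at h'
    refine Eq.trans ?_ (h'.symm.trans ?_)
    · exact Stage.map_op_congr F (by simp) (by simp [Stage.comp_arr]) ξ
    · exact Stage.map_op_congr F (by simp) (by simp) ξ

/-- The elements of the internal presheaf represented by `ξ` are the elements of `F`. -/
def elemsIso (F : (Stage C)ᵒᵖ ⥤ Type (max u v)) {Z : Stage C} {ξ : F.obj (op Z)}
    (hF : Represents F Z ξ) : Presheaf.elems.obj hF.presheaf ≅ F :=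
  NatIso.ofComponents (fun X => Equiv.toIso
    { toFun := fun z => F.map (Stage.vert (Y := Z) (Presheaf.elemMap z)
        (Presheaf.elemMap_base (P := hF.presheaf) z)).op ξ
      invFun := fun z => hF.presheaf.mkElem (hF.classify z) (hF.classify_a z)
      left_inv := fun z => Presheaf.elem_ext (P := hF.presheaf)
        (hF.eq_classify (X := X.unop) _ (Presheaf.elemMap_base (P := hF.presheaf) z) rfl).symm
      right_inv := fun z => hF.map_classify z }) (by
    rintro ⟨X⟩ ⟨Y⟩ ⟨f⟩
    ext z
    let q : X.T ⟶ Z.T := Presheaf.elemMap z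
    have hq : q ≫ Z.a = X.a := Presheaf.elemMap_base (P := hF.presheaf) z
    have hr : (f.map ≫ q) ≫ Z.a = f.arr ≫ C.cod := by rw [Category.assoc, hq, f.arr_cod]
    have e := hF.map_classify (X := Y) (F.map (Stage.homMk (X := Y) (Y := Z)
      (f.map ≫ q) f.arr hr.symm f.arr_dom).op ξ)
    refine Eq.trans ?_ (e.trans ?_)
    · refine Stage.map_op_congr F (f := Stage.vert (X := Y) (Y := Z)
        (hF.presheaf.restrict (f.map ≫ q) f.arr hr)
        ((hF.presheaf.restrict_base _ _ hr).trans f.arr_dom)) ?_ ?_ ξ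
      · exact hF.lift_act _ _ _ Y.a f.arr_dom
      · rfl
    · refine Eq.trans ?_ (Stage.map_op_map_op F f (Stage.vert q hq) ξ).symm
      exact Stage.map_op_congr F (by simp) (by simp) ξ)

end Represents

end Stages

/-! ### Sieves -/

section Sieves

variable {E : Type u} [Category.{v} E] [PositiveHeytingCategory E]

/-- The first factor of a small composite is small. -/
lemma IsClassOfSmallMaps.of_comp {S : MorphismProperty E} (hS : IsClassOfSmallMaps S) {X Y Z : E}
    (f : X ⟶ Y) (g : Y ⟶ Z) (h : S (f ≫ g)) : S f := by
  -- `f` is its graph followed by a pullback of `f ≫ g`, and graphs are equalisers.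
  let Γ : X ⟶ pullback (f ≫ g) g := pullback.lift (𝟙 X) f (by simp)
  have hΓ : S Γ := by
    let l : X ⟶ equalizer (pullback.fst (f ≫ g) g ≫ f) (pullback.snd (f ≫ g) g) :=
      equalizer.lift Γ (by simp [Γ])
    have : IsIso l := ⟨equalizer.ι _ _ ≫ pullback.fst _ _, by simp [l, Γ], by
      ext
      · simp [l, Γ]
      · simpa [l, Γ] using equalizer.condition _ _⟩
    have e : Γ = l ≫ equalizer.ι _ _ := by simp [l]
    rw [e]
    exact hS.comp _ _ (hS.of_isIso l) (hS.equalizer_ι _ _)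
  have e : f = Γ ≫ pullback.snd (f ≫ g) g := by simp [Γ]
  rw [e]
  exact hS.comp _ _ hΓ (hS.pullback_snd h g)

lemma pullback_factors_iff {X Y T : E} (f : X ⟶ Y) (A : Subobject Y) (x : T ⟶ X) :
    ((Subobject.pullback f).obj A).Factors x ↔ A.Factors (x ≫ f) := by
  constructor
  · intro h
    rw [← Subobject.factorThru_arrow _ x h, Category.assoc, ← (Subobject.isPullback f A).w,
      ← Category.assoc]
    exact Subobject.factors_comp_arrow _
  · intro h
    have e : ((Subobject.isPullback f A).lift (A.factorThru _ h) x (by simp)) ≫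
        ((Subobject.pullback f).obj A).arrow = x := (Subobject.isPullback f A).lift_snd _ _ _
    rw [← e]
    exact Subobject.factors_comp_arrow _

omit [PositiveHeytingCategory E] in
lemma factors_iff_exists {X T : E} (A : Subobject X) (x : T ⟶ X) :
    A.Factors x ↔ ∃ k, k ≫ A.arrow = x :=
  ⟨fun h => ⟨A.factorThru x h, by simp⟩, by rintro ⟨k, rfl⟩; exact Subobject.factors_comp_arrow _⟩

lemma IsCover.factors {T' T X : E} {c : T' ⟶ T} (hc : IsCover c) {A : Subobject X} {x : T ⟶ X}
    (h : A.Factors (c ≫ x)) : A.Factors x := by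
  rw [factors_iff_exists] at h ⊢
  exact hc.exists_lift h

namespace InternalCategory

variable {C : InternalCategory E}

lemma le_of_mem {T : E} {a : T ⟶ C.C₀} {R S : Subobject (C.arrowsInto a)}
    (h : ∀ ⦃T' : E⦄ (t : T' ⟶ T) (f : T' ⟶ C.C₁) (e : t ≫ a = f ≫ C.cod),
      C.Mem R t f e → C.Mem S t f e) : R ≤ S := by
  have := h (R.arrow ≫ pullback.fst a C.cod) (R.arrow ≫ pullback.snd a C.cod)
    (by simp [pullback.condition]) (by
      have e : pullback.lift (R.arrow ≫ pullback.fst a C.cod) (R.arrow ≫ pullback.snd a C.cod)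
        (by simp [pullback.condition]) = R.arrow := by ext <;> simp
      rw [Mem, e]
      exact Subobject.factors_self _)
  have e : pullback.lift (R.arrow ≫ pullback.fst a C.cod) (R.arrow ≫ pullback.snd a C.cod)
        (by simp [pullback.condition]) = R.arrow := by ext <;> simp
  rw [Mem, e] at this
  exact Subobject.le_of_comm (S.factorThru _ this) (by simp)

lemma Mem.of_le {T : E} {a : T ⟶ C.C₀} {R S : Subobject (C.arrowsInto a)} (h : R ≤ S) {T' : E}
    {t : T' ⟶ T} {f : T' ⟶ C.C₁} {e : t ≫ a = f ≫ C.cod} (hm : C.Mem R t f e) :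
    C.Mem S t f e :=
  Subobject.factors_of_le _ h hm

lemma mem_reindex {I : E} {b : I ⟶ C.C₀} {S : Subobject (C.arrowsInto b)} {T : E} {u : T ⟶ I}
    {a : T ⟶ C.C₀} {h : u ≫ b = a} {T' : E} {t : T' ⟶ T} {f : T' ⟶ C.C₁}
    {e : t ≫ a = f ≫ C.cod} :
    C.Mem (C.reindex S u a h) t f e ↔ C.Mem S (t ≫ u) f (by simp [h, e]) := by
  rw [Mem, reindex, pullback_factors_iff, Mem]
  congr! 1
  ext <;> simp

lemma mem_sievePullback {T : E} {a : T ⟶ C.C₀} {S : Subobject (C.arrowsInto a)} {T' : E}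
    {t : T' ⟶ T} {f : T' ⟶ C.C₁} {h : t ≫ a = f ≫ C.cod} {T'' : E} {s : T'' ⟶ T'}
    {g : T'' ⟶ C.C₁} {e : s ≫ f ≫ C.dom = g ≫ C.cod} :
    C.Mem (C.sievePullback S t f h) s g e ↔
      C.Mem S (s ≫ t) (C.mul (s ≫ f) g (by simp [e])) (by simp [h]) := by
  rw [Mem, sievePullback, pullback_factors_iff, Mem]
  congr! 1
  ext <;> simp [C.comp_mul]

lemma Mem.of_cover {T : E} {a : T ⟶ C.C₀} {S : Subobject (C.arrowsInto a)} {T' T'' : E}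
    {t : T' ⟶ T} {f : T' ⟶ C.C₁} {e : t ≫ a = f ≫ C.cod} {c : T'' ⟶ T'} (hc : IsCover c)
    (h : C.Mem S (c ≫ t) (c ≫ f) (by simp [e])) : C.Mem S t f e := by
  refine hc.factors ?_
  rw [Mem] at h
  convert h using 1
  ext <;> simp

lemma Mem.comp {T : E} {a : T ⟶ C.C₀} {S : Subobject (C.arrowsInto a)} {T' T'' : E}
    {t : T' ⟶ T} {f : T' ⟶ C.C₁} {e : t ≫ a = f ≫ C.cod} (h : C.Mem S t f e) (c : T'' ⟶ T') :
    C.Mem S (c ≫ t) (c ≫ f) (by simp [e]) := by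
  rw [Mem] at h ⊢
  have := Subobject.factors_of_factors_right (P := S) c h
  convert this using 1
  ext <;> simp

lemma mem_top {T : E} {a : T ⟶ C.C₀} {T' : E} (t : T' ⟶ T) (f : T' ⟶ C.C₁)
    (e : t ≫ a = f ≫ C.cod) : C.Mem ⊤ t f e := Subobject.top_factors _

lemma IsSieve.reindex {Sm : MorphismProperty E} (hSm : IsClassOfSmallMaps Sm) {I : E}
    {b : I ⟶ C.C₀} {S : Subobject (C.arrowsInto b)} (hS : C.IsSieve Sm b S) {T : E} (u : T ⟶ I)
    (a : T ⟶ C.C₀) (h : u ≫ b = a) : C.IsSieve Sm a (C.reindex S u a h) := by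
  refine ⟨?_, fun T' t f g e e' hm => ?_⟩
  · refine hSm.of_isPullback ((Subobject.isPullback _ S).paste_vert (?_ : IsPullback
      (pullback.lift (pullback.fst a C.cod ≫ u) (pullback.snd a C.cod)
        (by rw [Category.assoc, h, pullback.condition])) (pullback.fst a C.cod)
        (pullback.fst b C.cod) u)) hS.1
    refine IsPullback.of_right ?_ (by simp) (IsPullback.of_hasPullback b C.cod).flip
    simpa [h] using (IsPullback.of_hasPullback a C.cod).flip
  · rw [mem_reindex] at hm ⊢
    exact hS.2 _ _ _ _ e' hm

lemma IsSieve.sievePullback {Sm : MorphismProperty E} (hSm : IsClassOfSmallMaps Sm)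
    (hcod : Sm C.cod) {T : E} {a : T ⟶ C.C₀} {S : Subobject (C.arrowsInto a)}
    (hS : C.IsSieve Sm a S) {T' : E} (t : T' ⟶ T) (f : T' ⟶ C.C₁) (h : t ≫ a = f ≫ C.cod) :
    C.IsSieve Sm (f ≫ C.dom) (C.sievePullback S t f h) := by
  refine ⟨?_, fun T'' s g k e e' hm => ?_⟩
  · exact hSm.comp _ _ (hSm.of_isPullback (Subobject.isPullback _ S)
      (hSm.of_comp _ _ hS.1)) (hSm.pullback_fst hcod _)
  · rw [mem_sievePullback] at hm ⊢
    have := hS.2 _ _ k _ (by simp [e']) hm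
    simp only [C.mul_assoc _ _ _ _ e'] at this
    exact this

end InternalCategory

namespace SieveClass

variable {Sm : MorphismProperty E} {C : InternalCategory E} (K : SieveClass Sm C)

/-- The object of pairs `(R, f)` with `R` in the class `K` and `f ∈ R`. -/
abbrev total : E := (K.sieve : E)

/-- The projection `(R, f) ↦ R`. -/
def proj : K.total ⟶ K.index := K.sieve.arrow ≫ pullback.fst K.base C.cod

/-- The projection `(R, f) ↦ f`. -/
def arrow : K.total ⟶ C.C₁ := K.sieve.arrow ≫ pullback.snd K.base C.cod

lemma arrow_cod : K.arrow ≫ C.cod = K.proj ≫ K.base := by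
  simp [arrow, proj, pullback.condition]

lemma small_proj : Sm K.proj := K.isSieve.1

variable {K}

lemma total_hom_ext {T : E} {x y : T ⟶ K.total} (h : x ≫ K.proj = y ≫ K.proj)
    (h' : x ≫ K.arrow = y ≫ K.arrow) : x = y := by
  rw [← cancel_mono K.sieve.arrow]
  ext
  · simpa [proj] using h
  · simpa [arrow] using h'

lemma exists_total_iff {T : E} {u : T ⟶ K.index} {f : T ⟶ C.C₁} (h : u ≫ K.base = f ≫ C.cod) :
    (∃ k : T ⟶ K.total, k ≫ K.proj = u ∧ k ≫ K.arrow = f) ↔ C.Mem K.sieve u f h := by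
  rw [InternalCategory.Mem, factors_iff_exists]
  refine exists_congr fun k => ⟨?_, ?_⟩
  · rintro ⟨rfl, rfl⟩
    ext <;> simp [proj, arrow]
  · intro e
    have h1 := congr($e ≫ pullback.fst _ _)
    have h2 := congr($e ≫ pullback.snd _ _)
    simp only [pullback.lift_fst, pullback.lift_snd] at h1 h2
    exact ⟨by rw [proj, ← Category.assoc, h1], by rw [arrow, ← Category.assoc, h2]⟩

/-- The sieves of the class are closed under precomposition. -/
lemma total_comp {T : E} {k : T ⟶ K.total} {g : T ⟶ C.C₁} (h : (k ≫ K.arrow) ≫ C.dom = g ≫ C.cod) :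
    ∃ k' : T ⟶ K.total, k' ≫ K.proj = k ≫ K.proj ∧ k' ≫ K.arrow = C.mul (k ≫ K.arrow) g h :=
  (exists_total_iff (by simp [K.arrow_cod])).2 (K.isSieve.2 _ _ _
    (by simp [K.arrow_cod]) h ((exists_total_iff (by simp [K.arrow_cod])).1 ⟨k, rfl, rfl⟩))

/-- The sieves of the class are determined by their elements. -/
lemma index_hom_ext {T : E} {u v : T ⟶ K.index} (h : u ≫ K.base = v ≫ K.base)
    (H : ∀ ⦃T' : E⦄ (t : T' ⟶ T) (f : T' ⟶ C.C₁) (e : (t ≫ u) ≫ K.base = f ≫ C.cod)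
      (e' : (t ≫ v) ≫ K.base = f ≫ C.cod),
      C.Mem K.sieve (t ≫ u) f e ↔ C.Mem K.sieve (t ≫ v) f e') : u = v := by
  refine K.extensional u v _ h rfl (le_antisymm ?_ ?_)
  · refine InternalCategory.le_of_mem fun T' t f e hm => ?_
    rw [InternalCategory.mem_reindex] at hm ⊢
    exact (H t f _ _).1 hm
  · refine InternalCategory.le_of_mem fun T' t f e hm => ?_
    rw [InternalCategory.mem_reindex] at hm ⊢
    exact (H t f (by simpa [h] using e) _).2 hm

lemma contains_iff {T : E} {a : T ⟶ C.C₀} {S : Subobject (C.arrowsInto a)} :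
    K.Contains a S ↔ ∃ (u : T ⟶ K.index) (h : u ≫ K.base = a),
      ∀ ⦃T' : E⦄ (t : T' ⟶ T) (f : T' ⟶ C.C₁) (e : t ≫ a = f ≫ C.cod),
        C.Mem K.sieve (t ≫ u) f (by simp [h, e]) ↔ C.Mem S t f e := by
  refine exists_congr fun u => exists_congr fun h => ⟨?_, fun H => le_antisymm ?_ ?_⟩
  · rintro rfl T' t f e
    rw [InternalCategory.mem_reindex]
  · refine InternalCategory.le_of_mem fun T' t f e hm => ?_
    rw [InternalCategory.mem_reindex] at hm
    exact (H _ _ e).1 hm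
  · refine InternalCategory.le_of_mem fun T' t f e hm => ?_
    rw [InternalCategory.mem_reindex]
    exact (H _ _ e).2 hm

lemma contains_reindex {T : E} (u : T ⟶ K.index) (a : T ⟶ C.C₀) (h : u ≫ K.base = a) :
    K.Contains a (C.reindex K.sieve u a h) := ⟨u, h, rfl⟩

/-- Membership in the class `K` is a local property. -/
lemma contains_of_cover {T T' : E} {a : T ⟶ C.C₀} {S : Subobject (C.arrowsInto a)} {d : T' ⟶ T}
    (hd : IsCover d) (h : K.Contains (d ≫ a) (C.reindex S d _ rfl)) : K.Contains a S := by
  rw [contains_iff] at h ⊢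
  obtain ⟨u, hu, H⟩ := h
  simp only [InternalCategory.mem_reindex] at H
  obtain ⟨k, rfl⟩ := hd.exists_desc u (fun W x y hxy => by
    refine index_hom_ext (by simp only [Category.assoc, hu, reassoc_of% hxy]) fun V t f e e' => ?_
    have h1 := H (t ≫ x) f (by simpa [hu] using e)
    have h2 := H (t ≫ y) f (by simpa [hu] using e')
    simp only [Category.assoc, hxy] at h1 h2 ⊢
    rw [h1, h2])
  have := hd.epi
  refine ⟨k, by simpa [cancel_epi] using hu, fun V t f e => ?_⟩
  have hc := hd.pullback_snd t
  have h1 := H (pullback.fst d t) (pullback.snd d t ≫ f)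
    (by rw [pullback.condition_assoc, e, Category.assoc])
  simp only [pullback.condition, pullback.condition_assoc] at h1
  constructor
  · intro hm
    exact .of_cover hc (h1.1 (hm.comp _))
  · intro hm
    exact .of_cover hc (h1.2 (hm.comp _))

end SieveClass

end Sieves

/-! ### Grothendieck topologies -/

section Topologies

variable {E : Type u} [Category.{v} E] [PositiveHeytingCategory E] {S : MorphismProperty E}
  {C : InternalCategory E} (J : Topology S C)

namespace Topology

/-- The maximal sieve on `a`, as a generalised covering sieve. -/
lemma exists_maximal {T : E} (a : T ⟶ C.C₀) : ∃ (u : T ⟶ J.Cov.index), u ≫ J.Cov.base = a ∧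
    ∀ ⦃T' : E⦄ (t : T' ⟶ T) (f : T' ⟶ C.C₁), t ≫ a = f ≫ C.cod →
      ∃ k : T' ⟶ J.Cov.total, k ≫ J.Cov.proj = t ≫ u ∧ k ≫ J.Cov.arrow = f := by
  obtain ⟨u, hu, H⟩ := SieveClass.contains_iff.1 (J.maximality a)
  exact ⟨u, hu, fun T' t f e => (SieveClass.exists_total_iff (by simp [hu, e])).2
    ((H t f e).2 (InternalCategory.mem_top _ _ _))⟩

/-- The pullback of a covering sieve, as a generalised covering sieve. -/
lemma exists_pullback {T T' : E} {a : T ⟶ C.C₀} (u : T ⟶ J.Cov.index) (hu : u ≫ J.Cov.base = a)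
    (t : T' ⟶ T) (f : T' ⟶ C.C₁) (h : t ≫ a = f ≫ C.cod) :
    ∃ (w : T' ⟶ J.Cov.index), w ≫ J.Cov.base = f ≫ C.dom ∧
      ∀ ⦃T'' : E⦄ (k : T'' ⟶ J.Cov.total) (s : T'' ⟶ T')
        (e : (s ≫ f) ≫ C.dom = (k ≫ J.Cov.arrow) ≫ C.cod),
        k ≫ J.Cov.proj = s ≫ w → ∃ k' : T'' ⟶ J.Cov.total, k' ≫ J.Cov.proj = (s ≫ t) ≫ u ∧
          k' ≫ J.Cov.arrow = C.mul (s ≫ f) (k ≫ J.Cov.arrow) e := by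
  obtain ⟨w, hw, H⟩ := SieveClass.contains_iff.1
    (J.stability a _ (J.Cov.contains_reindex u a hu) t f h)
  refine ⟨w, hw, fun T'' k s e hk => ?_⟩
  have h1 := (H s (k ≫ J.Cov.arrow) (by simpa using e)).1
    ((SieveClass.exists_total_iff _).1 ⟨k, hk, rfl⟩)
  rw [InternalCategory.mem_sievePullback, InternalCategory.mem_reindex] at h1
  exact (SieveClass.exists_total_iff _).2 h1

variable {J}

/-- A sieve which contains a covering sieve is covering. -/
lemma contains_of_le {T : E} {a : T ⟶ C.C₀} {R R' : Subobject (C.arrowsInto a)}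
    (h : J.Cov.Contains a R) (hR' : C.IsSieve S a R') (hle : R ≤ R') : J.Cov.Contains a R' := by
  refine J.local_character a R' R hR' h fun {T'} t f e hm => ?_
  have : C.sievePullback R' t f e = ⊤ := by
    refine top_le_iff.1 (InternalCategory.le_of_mem fun T'' s g e' _ => ?_)
    rw [InternalCategory.mem_sievePullback]
    exact hR'.2 _ _ _ _ _ ((InternalCategory.Mem.of_le hle hm).comp s)
  rw [this]
  exact J.maximality _

variable (hS : IsClassOfSmallMaps S) (hcod : S C.cod)
include hS hcod

/-- Suppose that over each arrow of a covering sieve `u` there is locally (after passing to the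
cover `c`) a covering sieve `v` on the domain. By collection, the composites `f ∘ g` of a locally
small selection of them form a covering sieve `w`. -/
lemma exists_union {T Z Y : E} {a : T ⟶ C.C₀} {u : T ⟶ J.Cov.index} (hu : u ≫ J.Cov.base = a)
    {p : Z ⟶ T} {l : Z ⟶ J.Cov.total} (hZ : IsPullback p l u J.Cov.proj) {c : Y ⟶ Z}
    (hc : IsCover c) (v : Y ⟶ J.Cov.index)
    (hv : v ≫ J.Cov.base = c ≫ (l ≫ J.Cov.arrow) ≫ C.dom) :
    ∃ (B : E) (h : B ⟶ T) (w : B ⟶ J.Cov.index), IsCover h ∧ w ≫ J.Cov.base = h ≫ a ∧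
      ∀ ⦃V : E⦄ (s : V ⟶ B) (m : V ⟶ J.Cov.total), s ≫ w = m ≫ J.Cov.proj →
        ∃ (Q : E) (q : Q ⟶ V) (y : Q ⟶ Y) (n : Q ⟶ J.Cov.total)
          (hn : n ≫ J.Cov.proj = y ≫ v), IsCover q ∧ q ≫ s ≫ h = y ≫ c ≫ p ∧
          q ≫ m ≫ J.Cov.arrow = C.mul (y ≫ c ≫ l ≫ J.Cov.arrow) (n ≫ J.Cov.arrow)
            (by simp [SieveClass.arrow_cod, reassoc_of% hn, hv]) := by
  have small_p : S p := hS.of_isPullback hZ.flip J.Cov.small_proj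
  obtain ⟨X, B, t, g, h, hg, hcov, hl, hh⟩ := hS.collection c p hc small_p
  let N := pullback (t ≫ v) J.Cov.proj
  let nX : N ⟶ X := pullback.fst _ _
  let n : N ⟶ J.Cov.total := pullback.snd _ _
  have hn : n ≫ J.Cov.proj = nX ≫ t ≫ v := pullback.condition.symm
  have small_nX : S nX := hS.pullback_fst J.Cov.small_proj _
  let f : X ⟶ C.C₁ := t ≫ c ≫ l ≫ J.Cov.arrow
  have hf : f ≫ C.cod = g ≫ h ≫ a := by
    simp [f, SieveClass.arrow_cod, ← reassoc_of% hZ.w, hu, reassoc_of% hcov]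
  have hfn : (nX ≫ f) ≫ C.dom = (n ≫ J.Cov.arrow) ≫ C.cod := by
    simp [f, SieveClass.arrow_cod, reassoc_of% hn, hv]
  -- The composites `f ∘ g`, as a family of sieves over `B`.
  obtain ⟨M, e, m, he, hm, hem⟩ := PositiveHeytingCategory.exists_factorisation
    (pullback.lift (nX ≫ g) (C.mul (nX ≫ f) (n ≫ J.Cov.arrow) hfn) (by simp [hf]) :
      N ⟶ C.arrowsInto (h ≫ a))
  have mem : ∀ ⦃V : E⦄ (s : V ⟶ B) (φ : V ⟶ C.C₁) (hφ : s ≫ h ≫ a = φ ≫ C.cod),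
      C.Mem (Subobject.mk m) s φ hφ ↔ ∃ (V' : E) (d : V' ⟶ V) (x : V' ⟶ N), IsCover d ∧
        x ≫ nX ≫ g = d ≫ s ∧ x ≫ C.mul (nX ≫ f) (n ≫ J.Cov.arrow) hfn = d ≫ φ := by
    intro V s φ hφ
    rw [InternalCategory.Mem, Subobject.mk_factors_iff]
    change (∃ k : V ⟶ M, k ≫ m = _) ↔ _
    constructor
    · rintro ⟨k, hk⟩
      refine ⟨_, pullback.snd e k, pullback.fst e k, he.pullback_snd k, ?_, ?_⟩
      · have := congr(pullback.snd e k ≫ $hk ≫ pullback.fst _ _)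
        rw [Category.assoc, ← pullback.condition_assoc, reassoc_of% hem] at this
        simpa using this
      · have := congr(pullback.snd e k ≫ $hk ≫ pullback.snd _ _)
        rw [Category.assoc, ← pullback.condition_assoc, reassoc_of% hem] at this
        simpa using this
    · rintro ⟨V', d, x, hd, h1, h2⟩
      refine hd.exists_lift (m := m) ⟨x ≫ e, ?_⟩
      rw [Category.assoc, hem]
      ext
      · simpa using h1
      · simpa using h2
  have sieve : C.IsSieve S (h ≫ a) (Subobject.mk m) := by
    refine ⟨?_, fun V s φ k hφ hk H => ?_⟩
    · rw [← Subobject.underlyingIso_hom_comp_eq_mk, Category.assoc]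
      refine hS.comp _ _ (hS.of_isIso _) (hS.quotients e _ he ?_)
      rw [reassoc_of% hem]
      simpa using hS.comp _ _ small_nX hg
    · rw [mem] at H ⊢
      obtain ⟨V', d, x, hd, h1, h2⟩ := H
      have hxk : ((x ≫ n) ≫ J.Cov.arrow) ≫ C.dom = (d ≫ k) ≫ C.cod := by
        have := congr($h2 ≫ C.dom)
        simp only [Category.assoc, C.mul_dom] at this
        simp [this, hk]
      obtain ⟨n', hn', hn''⟩ := SieveClass.total_comp hxk
      refine ⟨V', d, pullback.lift (x ≫ nX) n' (by rw [hn']; simp [hn]), hd, ?_, ?_⟩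
      · simpa [nX] using h1
      · simp only [C.comp_mul, nX, n, pullback.lift_fst_assoc, pullback.lift_snd_assoc, hn'']
        rw [← C.mul_assoc]
        · simp only [← h2]
          simp [C.comp_mul, nX, n]
        · simpa [C.comp_mul] using congr(x ≫ $hfn)
  have cov : J.Cov.Contains (h ≫ a) (Subobject.mk m) := by
    refine J.local_character _ _ _ sieve
      (J.Cov.contains_reindex (h ≫ u) (h ≫ a) (by simp [hu])) fun {V} s φ hφ H => ?_
    rw [InternalCategory.mem_reindex, ← SieveClass.exists_total_iff] at H
    obtain ⟨k, hk, rfl⟩ := H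
    let r : V ⟶ Z := hZ.lift (s ≫ h) k (by simpa using hk.symm)
    have hr : r ≫ p = s ≫ h := hZ.lift_fst _ _ _
    have hr' : r ≫ l = k := hZ.lift_snd _ _ _
    let r' : V ⟶ pullback h p := pullback.lift s r hr.symm
    let d := pullback.snd (pullback.lift g (t ≫ c) hcov) r'
    let x := pullback.fst (pullback.lift g (t ≫ c) hcov) r'
    have hd : IsCover d := hl.pullback_snd r'
    have hx : x ≫ g = d ≫ s := by
      simpa [r'] using congr($(pullback.condition (f := pullback.lift g (t ≫ c) hcov) (g := r')) ≫
        pullback.fst _ _)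
    have hx' : x ≫ t ≫ c = d ≫ r := by
      simpa [r'] using congr($(pullback.condition (f := pullback.lift g (t ≫ c) hcov) (g := r')) ≫
        pullback.snd _ _)
    have hxf : x ≫ f = d ≫ k ≫ J.Cov.arrow := by
      simp only [f, reassoc_of% hx', reassoc_of% hr']
    refine SieveClass.contains_of_cover hd ?_
    refine contains_of_le (J.Cov.contains_reindex (x ≫ t ≫ v) _ ?_)
      ((sieve.sievePullback hS hcod _ _ _).reindex hS _ _ _) ?_
    · simp [hv, reassoc_of% hx', reassoc_of% hr']
    · refine InternalCategory.le_of_mem fun W b ψ eψ hψ => ?_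
      rw [InternalCategory.mem_reindex, ← SieveClass.exists_total_iff] at hψ
      obtain ⟨j, hj, rfl⟩ := hψ
      rw [InternalCategory.mem_reindex, InternalCategory.mem_sievePullback, mem]
      refine ⟨W, 𝟙 W, pullback.lift (b ≫ x) j (by simpa using hj.symm), .of_isIso _, ?_, ?_⟩
      · simp [nX, hx]
      · simp [C.comp_mul, nX, n, hxf]
  obtain ⟨w, hw, H⟩ := SieveClass.contains_iff.1 cov
  refine ⟨B, h, w, hh, hw, fun V s k hk => ?_⟩
  have h1 := (H s (k ≫ J.Cov.arrow) (by rw [← hw]; simp [SieveClass.arrow_cod, reassoc_of% hk])).1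
    ((SieveClass.exists_total_iff _).1 ⟨k, hk.symm, rfl⟩)
  rw [mem] at h1
  obtain ⟨V', d, x, hd, h1, h2⟩ := h1
  refine ⟨V', d, x ≫ nX ≫ t, x ≫ n, by simp [hn], hd, ?_, ?_⟩
  · rw [← reassoc_of% h1, hcov]
    simp
  · rw [← h2, C.comp_mul]
    simp [f]

end Topology

end Topologies

/-! ### The external coverage on stages -/

section Site

variable {E : Type u} [Category.{v} E] [PositiveHeytingCategory E] {S : MorphismProperty E}
  {C : InternalCategory E} (J : Topology S C)

namespace Topology

/-- The generating covering families of stages: vertical covers of `E`, vertical finite sums of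
`E`, and the tautological families `(f)_{f ∈ u}` for generalised covering sieves `u`. -/
inductive Generator : ∀ X : Stage C, Presieve X → Prop
  | cover {X Y : Stage C} (c : Y.T ⟶ X.T) (h : c ≫ X.a = Y.a) (hc : IsCover c) :
      Generator X (Presieve.singleton (Stage.vert c h))
  | sum {X Y Z : Stage C} (i : Y.T ⟶ X.T) (j : Z.T ⟶ X.T) (hi : i ≫ X.a = Y.a)
      (hj : j ≫ X.a = Z.a) (h : IsSum i j) :
      Generator X (Presieve.singleton (Stage.vert i hi) ⊔ Presieve.singleton (Stage.vert j hj))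
  | empty {X : Stage C} (h : IsEmptyObj X.T) : Generator X ⊥
  | site {X Y : Stage C} (u : X.T ⟶ J.Cov.index) (hu : u ≫ J.Cov.base = X.a) (f : Y ⟶ X)
      (k : Y.T ⟶ J.Cov.total) (h : IsPullback f.map k u J.Cov.proj)
      (hk : k ≫ J.Cov.arrow = f.arr) : Generator X (Presieve.singleton f)

lemma vertical_factors {X Y W W' : Stage C} (c : Y.T ⟶ X.T) (h : c ≫ X.a = Y.a) (g : W ⟶ X)
    (c' : W'.T ⟶ W.T) (h' : c' ≫ W.a = W'.a) (p : W'.T ⟶ Y.T) (w : p ≫ c = c' ≫ g.map) :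
    ∃ i : W' ⟶ Y, i ≫ Stage.vert c h = Stage.vert c' h' ≫ g :=
  ⟨Stage.homMk p (c' ≫ g.arr) (by rw [Category.assoc, g.arr_cod, ← h, reassoc_of% w])
    (by rw [Category.assoc, g.arr_dom, h']), by ext <;> simp [w]⟩

/-- The coverage on stages of which internal sheaves are the sheaves. -/
def coverage : Coverage (Stage C) where
  coverings X := {R | J.Generator X R}
  pullback := by
    rintro X W g R (hR : J.Generator X R)
    cases hR with
    | @cover Y c h hc =>
      let W' : Stage C := ⟨_, pullback.snd c g.map ≫ W.a⟩
      refine ⟨_, Generator.cover (X := W) (Y := W') _ rfl (hc.pullback_snd g.map), ?_⟩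
      rintro _ _ ⟨⟩
      obtain ⟨i, hi⟩ := vertical_factors c h g (W' := W') (pullback.snd c g.map) rfl
        (pullback.fst c g.map) pullback.condition
      exact ⟨_, i, _, ⟨⟩, hi⟩
    | @sum Y Z i j hi hj h =>
      let Y' : Stage C := ⟨_, pullback.snd i g.map ≫ W.a⟩
      let Z' : Stage C := ⟨_, pullback.snd j g.map ≫ W.a⟩
      refine ⟨_, Generator.sum (X := W) (Y := Y') (Z := Z') _ _ rfl rfl
        (h.of_isPullback (IsPullback.of_hasPullback i g.map).flip
          (IsPullback.of_hasPullback j g.map).flip), ?_⟩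
      rintro _ _ (⟨⟨⟩⟩ | ⟨⟨⟩⟩)
      · obtain ⟨l, hl⟩ := vertical_factors i hi g (W' := Y') (pullback.snd i g.map) rfl
          (pullback.fst i g.map) pullback.condition
        exact ⟨_, l, _, Or.inl ⟨⟩, hl⟩
      · obtain ⟨l, hl⟩ := vertical_factors j hj g (W' := Z') (pullback.snd j g.map) rfl
          (pullback.fst j g.map) pullback.condition
        exact ⟨_, l, _, Or.inr ⟨⟩, hl⟩
    | empty h =>
      exact ⟨_, Generator.empty (h.of_hom g.map), fun _ _ h => h.elim⟩
    | @site Y u hu f k h hk =>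
      obtain ⟨w, hw, H⟩ := J.exists_pullback u hu g.map g.arr g.arr_cod.symm
      let W' : Stage C := ⟨pullback w J.Cov.proj, pullback.snd w J.Cov.proj ≫ J.Cov.arrow ≫ C.dom⟩
      let p : W' ⟶ W := Stage.homMk (X := W') (pullback.fst w J.Cov.proj)
        (pullback.snd w J.Cov.proj ≫ J.Cov.arrow)
        (by simp [SieveClass.arrow_cod, ← pullback.condition_assoc, hw, g.arr_dom]) (by simp [W'])
      obtain ⟨k', hk', hk''⟩ := H (pullback.snd w J.Cov.proj) (pullback.fst w J.Cov.proj)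
        (by simp [SieveClass.arrow_cod, ← pullback.condition_assoc, hw]) pullback.condition.symm
      refine ⟨_, Generator.site w (by rw [hw, g.arr_dom]) p (pullback.snd w J.Cov.proj)
        (IsPullback.of_hasPullback _ _) rfl, ?_⟩
      rintro _ _ ⟨⟩
      obtain ⟨l, hl', hl⟩ : ∃ l, l ≫ f.map = pullback.fst w J.Cov.proj ≫ g.map ∧ l ≫ k = k' :=
        ⟨h.lift _ k' hk'.symm, h.lift_fst _ _ _, h.lift_snd _ _ _⟩
      refine ⟨_, Stage.vert (X := W') l ?_, f, ⟨⟩, ?_⟩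
      · rw [← f.arr_dom, ← hk, Category.assoc, reassoc_of% hl, reassoc_of% hk'']
        simp [W']
      · ext
        · simp [p, hl']
        · rw [Stage.vert_comp_arr, Stage.comp_arr, ← hk, reassoc_of% hl, hk'']
          simp [p]

variable {J} {F : (Stage C)ᵒᵖ ⥤ Type w}

/-- The property of being a sheaf for the generating families of stages. -/
abbrev IsStageSheaf (J : Topology S C) (F : (Stage C)ᵒᵖ ⥤ Type w) : Prop :=
  Presieve.IsSheaf J.coverage.toGrothendieck F

lemma isStageSheaf_iff :
    J.IsStageSheaf F ↔ ∀ ⦃X : Stage C⦄ (R : Presieve X), J.Generator X R → R.IsSheafFor F :=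
  Presieve.isSheaf_coverage _ _

namespace IsStageSheaf

variable (hF : J.IsStageSheaf F)
include hF

lemma cover_ext {X Y : Stage C} {c : Y.T ⟶ X.T} (h : c ≫ X.a = Y.a) (hc : IsCover c)
    {z z' : F.obj (op X)}
    (e : F.map (Stage.vert c h).op z = F.map (Stage.vert c h).op z') : z = z' :=
  Presieve.isSeparatedFor_singleton.1 ((isStageSheaf_iff.1 hF) _ (.cover c h hc)).isSeparatedFor e

lemma cover_glue {X Y : Stage C} {c : Y.T ⟶ X.T} (h : c ≫ X.a = Y.a) (hc : IsCover c)
    (z : F.obj (op Y)) (H : ∀ ⦃V : Stage C⦄ (x y : V.T ⟶ Y.T) (hx : x ≫ Y.a = V.a)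
      (hy : y ≫ Y.a = V.a), x ≫ c = y ≫ c →
        F.map (Stage.vert x hx).op z = F.map (Stage.vert y hy).op z) :
    ∃ z', F.map (Stage.vert c h).op z' = z := by
  refine (Presieve.isSheafFor_singleton.1
    ((isStageSheaf_iff.1 hF) _ (.cover c h hc)) z fun {V} p q w => ?_).exists
  have h1 : p.map ≫ c = q.map ≫ c := congr($(w).map)
  have h2 : p.arr = q.arr := by simpa using congr($(w).arr)
  have h3 : q.map ≫ Y.a = p.map ≫ Y.a := by rw [← h, reassoc_of% h1]
  let V' : Stage C := ⟨V.T, p.map ≫ Y.a⟩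
  let r : V ⟶ V' := Stage.homMk (𝟙 V.T) p.arr (by simp [V', p.arr_cod]) p.arr_dom
  have h4 := congr(F.map r.op $(H (V := V') p.map q.map rfl h3 h1))
  rw [Stage.map_op_map_op, Stage.map_op_map_op] at h4
  refine Eq.trans ?_ (h4.trans ?_)
  · refine Stage.map_op_congr F ?_ ?_ z <;> simp [r]
  · refine Stage.map_op_congr F ?_ ?_ z <;> simp [r, h2]

lemma empty_ext {X : Stage C} (h : IsEmptyObj X.T) (z z' : F.obj (op X)) : z = z' :=
  ((isStageSheaf_iff.1 hF) _ (.empty h)).isSeparatedFor.ext (fun _ _ h => h.elim)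

lemma empty_exists {X : Stage C} (h : IsEmptyObj X.T) : Nonempty (F.obj (op X)) :=
  ⟨((isStageSheaf_iff.1 hF) _ (.empty h)).amalgamate (fun _ _ h => h.elim)
    (fun _ _ _ _ _ _ _ h => h.elim)⟩

lemma sum_ext {X Y Z : Stage C} {i : Y.T ⟶ X.T} {j : Z.T ⟶ X.T} (hi : i ≫ X.a = Y.a)
    (hj : j ≫ X.a = Z.a) (h : IsSum i j) {z z' : F.obj (op X)}
    (e : F.map (Stage.vert i hi).op z = F.map (Stage.vert i hi).op z')
    (e' : F.map (Stage.vert j hj).op z = F.map (Stage.vert j hj).op z') : z = z' := by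
  refine ((isStageSheaf_iff.1 hF) _ (.sum i j hi hj h)).isSeparatedFor.ext ?_
  rintro _ _ (⟨⟨⟩⟩ | ⟨⟨⟩⟩)
  exacts [e, e']

lemma sum_glue {X Y Z : Stage C} {i : Y.T ⟶ X.T} {j : Z.T ⟶ X.T} (hi : i ≫ X.a = Y.a)
    (hj : j ≫ X.a = Z.a) (h : IsSum i j) (y : F.obj (op Y)) (z : F.obj (op Z)) :
    ∃ x : F.obj (op X), F.map (Stage.vert i hi).op x = y ∧ F.map (Stage.vert j hj).op x = z := by
  have mi := h.mono_left
  have mj := h.mono_right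
  have mono : ∀ {Y V : Stage C} {i : Y.T ⟶ X.T} (hi : i ≫ X.a = Y.a) [Mono i] (p q : V ⟶ Y),
      p ≫ Stage.vert i hi = q ≫ Stage.vert i hi → p = q := fun {Y V i} hi _ p q w => by
    ext
    · simpa [cancel_mono] using congr($(w).map)
    · simpa using congr($(w).arr)
  have disj : ∀ {V : Stage C} (p : V ⟶ Y) (q : V ⟶ Z),
      p ≫ Stage.vert i hi = q ≫ Stage.vert j hj → F.map p.op y = F.map q.op z :=
    fun {V} p q w => hF.empty_ext (h.isEmptyObj congr($(w).map)) _ _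
  have hs := (isStageSheaf_iff.1 hF) _ (.sum i j hi hj h)
  let R := Presieve.singleton (Stage.vert i hi) ⊔ Presieve.singleton (Stage.vert j hj)
  have hRi : R (Stage.vert i hi) := Or.inl ⟨⟩
  have hRj : R (Stage.vert j hj) := Or.inr ⟨⟩
  have key : ∀ ⦃V : Stage C⦄ (p : V ⟶ X), R p → ∃ t : F.obj (op V),
      (∀ r : V ⟶ Y, r ≫ Stage.vert i hi = p → t = F.map r.op y) ∧
      (∀ r : V ⟶ Z, r ≫ Stage.vert j hj = p → t = F.map r.op z) := by
    rintro _ _ (⟨⟨⟩⟩ | ⟨⟨⟩⟩)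
    · refine ⟨y, fun r hr => ?_, fun r hr => ?_⟩
      · rw [mono hi r (𝟙 _) (by simpa using hr)]; simp
      · rw [← disj (𝟙 _) r (by simpa using hr.symm)]; simp
    · refine ⟨z, fun r hr => ?_, fun r hr => ?_⟩
      · rw [disj r (𝟙 _) (by simpa using hr)]; simp
      · rw [mono hj r (𝟙 _) (by simpa using hr)]; simp
  choose fam hfi hfj using key
  have hy := hfi _ hRi (𝟙 _) (Category.id_comp _)
  have hz := hfj _ hRj (𝟙 _) (Category.id_comp _)
  simp only [op_id, Functor.map_id_apply] at hy hz
  have comp : Presieve.FamilyOfElements.Compatible (fam : R.FamilyOfElements F) := by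
    rintro _ _ V p q _ _ (⟨⟨⟩⟩ | ⟨⟨⟩⟩) (⟨⟨⟩⟩ | ⟨⟨⟩⟩) w
    · rw [mono hi _ _ w]
    · exact (congr_arg _ hy).trans ((disj _ _ w).trans (congr_arg _ hz.symm))
    · exact (congr_arg _ hz).trans ((disj _ _ w.symm).symm.trans (congr_arg _ hy.symm))
    · rw [mono hj _ _ w]
  exact ⟨hs.amalgamate fam comp, (hs.valid_glue comp _ hRi).trans hy,
    (hs.valid_glue comp _ hRj).trans hz⟩

lemma site_ext {X Y : Stage C} {u : X.T ⟶ J.Cov.index} (hu : u ≫ J.Cov.base = X.a) {f : Y ⟶ X}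
    {k : Y.T ⟶ J.Cov.total} (h : IsPullback f.map k u J.Cov.proj)
    (hk : k ≫ J.Cov.arrow = f.arr) {z z' : F.obj (op X)} (e : F.map f.op z = F.map f.op z') :
    z = z' :=
  Presieve.isSeparatedFor_singleton.1
    ((isStageSheaf_iff.1 hF) _ (.site u hu f k h hk)).isSeparatedFor e

lemma site_glue {X Y : Stage C} {u : X.T ⟶ J.Cov.index} (hu : u ≫ J.Cov.base = X.a) {f : Y ⟶ X}
    {k : Y.T ⟶ J.Cov.total} (h : IsPullback f.map k u J.Cov.proj)
    (hk : k ≫ J.Cov.arrow = f.arr) (z : F.obj (op Y)) (H : ∀ ⦃V : Stage C⦄ (p q : V ⟶ Y),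
      p ≫ f = q ≫ f → F.map p.op z = F.map q.op z) : ∃ z', F.map f.op z' = z :=
  (Presieve.isSheafFor_singleton.1 ((isStageSheaf_iff.1 hF) _ (.site u hu f k h hk)) z
    (fun {_} p q w => H p q w)).exists

end IsStageSheaf

/-- A subfunctor of a sheaf which is closed under the generating families is a sheaf. -/
lemma IsStageSheaf.subfunctor (hF : J.IsStageSheaf F) (A : Subfunctor F)
    (h : ∀ ⦃X : Stage C⦄ (R : Presieve X), J.Generator X R → ∀ z : F.obj (op X),
      (∀ ⦃Y : Stage C⦄ (f : Y ⟶ X), R f → F.map f.op z ∈ A.obj (op Y)) → z ∈ A.obj (op X)) :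
    J.IsStageSheaf A.toFunctor := by
  rw [isStageSheaf_iff]
  intro X R hR fam hfam
  have hs := (isStageSheaf_iff.1 hF) R hR
  have hc : Presieve.FamilyOfElements.Compatible
      (fun Y f hf => (fam f hf).1 : Presieve.FamilyOfElements F R) :=
    fun _ _ _ g₁ g₂ _ _ h₁ h₂ w => congr_arg Subtype.val (hfam g₁ g₂ h₁ h₂ w)
  have hv := fun Y (f : Y ⟶ X) hf => hs.valid_glue hc f hf
  refine ⟨⟨hs.amalgamate _ hc, h R hR _ fun Y f hf => ?_⟩, fun Y f hf => Subtype.ext (hv Y f hf),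
    fun y hy => Subtype.ext (hs.isSeparatedFor.ext fun Y f hf => ?_)⟩
  · rw [hv Y f hf]
    exact (fam f hf).2
  · rw [hv Y f hf]
    exact congr_arg Subtype.val (hy f hf)

end Topology
end Site

/-! ### Internal sheaves as external sheaves -/

section SheafComparison

variable {E : Type u} [Category.{v} E] [PositiveHeytingCategory E] {S : MorphismProperty E}
  {C : InternalCategory E} {J : Topology S C} {P : Presheaf C}

open Presheaf

/-- The sieve classified by `u` is the pullback along `u` of the family of all sieves of the
class. -/
lemma reindex_isPullback {K : SieveClass S C} {T : E} (u : T ⟶ K.index) (a : T ⟶ C.C₀)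
    (h : u ≫ K.base = a) : ∃ k : (C.reindex K.sieve u a h : E) ⟶ K.total,
      IsPullback ((C.reindex K.sieve u a h).arrow ≫ pullback.fst a C.cod) k u K.proj ∧
        k ≫ K.arrow = (C.reindex K.sieve u a h).arrow ≫ pullback.snd a C.cod := by
  refine ⟨Subobject.pullbackπ _ K.sieve, ?_, ?_⟩
  · refine ((Subobject.isPullback _ K.sieve).paste_vert (?_ : IsPullback
      (pullback.lift (pullback.fst a C.cod ≫ u) (pullback.snd a C.cod)
        (by rw [Category.assoc, h, pullback.condition])) (pullback.fst a C.cod)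
        (pullback.fst K.base C.cod) u)).flip
    refine IsPullback.of_right ?_ (by simp) (IsPullback.of_hasPullback K.base C.cod).flip
    simpa [h] using (IsPullback.of_hasPullback a C.cod).flip
  · have := congr($((Subobject.isPullback (pullback.lift (pullback.fst a C.cod ≫ u)
      (pullback.snd a C.cod) (by rw [Category.assoc, h, pullback.condition])) K.sieve).w) ≫
        pullback.snd K.base C.cod)
    simp only [Category.assoc, pullback.lift_snd] at this
    exact this

/-- The external presheaf of elements of an internal sheaf is a sheaf. -/
lemma Presheaf.IsSheaf.isStageSheaf (hP : IsSheaf J P) : J.IsStageSheaf (elems.obj P) := by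
  rw [Topology.isStageSheaf_iff]
  intro X R hR
  cases hR with
  | @cover Y c h hc =>
    have := hc.epi
    rw [Presieve.isSheafFor_singleton]
    intro z hz
    obtain ⟨k, hk⟩ := hc.exists_desc (elemMap z) (fun T x y w => by
      have := congr(elemMap $(hz (Stage.vert (X := ⟨T, x ≫ Y.a⟩) x rfl)
        (Stage.vert (X := ⟨T, x ≫ Y.a⟩) y (by rw [← h, reassoc_of% w]))
          (by ext <;> simp [w])))
      simpa using this)
    refine ⟨P.mkElem k ?_, elem_ext ?_, fun z' hz' => elem_ext ?_⟩
    · rw [← cancel_epi c, reassoc_of% hk, elemMap_base, h]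
    · simp [hk]
    · rw [← cancel_epi c, ← elemMap_vert c h, hz']
      simp [hk]
  | @sum Y Z i j hi hj h =>
    intro fam hfam
    obtain ⟨k, hk, hk'⟩ := h.exists_desc (elemMap (fam (Stage.vert i hi) (Or.inl ⟨⟩)))
      (elemMap (fam (Stage.vert j hj) (Or.inr ⟨⟩)))
    refine ⟨P.mkElem k (h.hom_ext ?_ ?_), ?_, fun z hz => elem_ext (h.hom_ext ?_ ?_)⟩
    · rw [reassoc_of% hk, elemMap_base, hi]
    · rw [reassoc_of% hk', elemMap_base, hj]
    · rintro _ _ (⟨⟨⟩⟩ | ⟨⟨⟩⟩) <;> exact elem_ext (by simp [hk, hk'])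
    · rw [← elemMap_vert i hi, hz _ (Or.inl ⟨⟩)]
      simp [hk]
    · rw [← elemMap_vert j hj, hz _ (Or.inr ⟨⟩)]
      simp [hk']
  | empty h =>
    exact fun _ _ => ⟨P.mkElem (h.some.to _) (h.hom_ext _ _), fun _ _ h => h.elim,
      fun _ _ => elem_ext (h.hom_ext _ _)⟩
  | @site Y u hu f k h hk =>
    obtain ⟨k', h', hk'⟩ := reindex_isPullback u X.a hu
    let R := C.reindex J.Cov.sieve u X.a hu
    let e : (R : E) ≅ Y.T := h'.isoIsPullback _ _ h
    have e₁ : e.hom ≫ f.map = R.arrow ≫ pullback.fst X.a C.cod := h'.isoIsPullback_hom_fst _ _ h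
    have e₂ : e.hom ≫ f.arr = R.arrow ≫ pullback.snd X.a C.cod := by
      rw [← hk, ← hk', ← Category.assoc, h'.isoIsPullback_hom_snd _ _ h]
    rw [Presieve.isSheafFor_singleton]
    intro z hz
    have hcomp : P.IsCompatibleFamily R (e.hom ≫ elemMap z) := by
      refine ⟨by rw [Category.assoc, elemMap_base, ← reassoc_of% e₂, f.arr_dom], ?_⟩
      intro T r r' g hg h₁ h₂
      have hg' : g ≫ C.cod = (r ≫ e.hom) ≫ Y.a := by
        rw [← hg, ← e₂]; simp [f.arr_dom]
      have hr' : (r' ≫ e.hom) ≫ Y.a = g ≫ C.dom := by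
        have := congr($h₂ ≫ C.dom)
        rw [C.mul_dom] at this
        rw [← this, ← f.arr_dom]
        simp only [Category.assoc, reassoc_of% e₂]
      have := congr(elemMap $(hz (Stage.homMk (X := ⟨T, g ≫ C.dom⟩) (r ≫ e.hom) g hg' rfl)
        (Stage.vert (X := ⟨T, g ≫ C.dom⟩) (r' ≫ e.hom) hr') (by
          ext
          · simp [e₁, h₁]
          · rw [Stage.vert_comp_arr, Stage.comp_arr]
            simp [e₂, h₂])))
      rw [elemMap_map, elemMap_vert] at this
      simpa using this
    have ham : ∀ y : (elems.obj P).obj (op X), P.IsAmalgamation R (e.hom ≫ elemMap z) (elemMap y) ↔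
        (elems.obj P).map f.op y = z := by
      intro y
      have : (elems.obj P).map f.op y = z ↔
          e.hom ≫ elemMap ((elems.obj P).map f.op y) = e.hom ≫ elemMap z := by
        rw [cancel_epi]
        exact ⟨fun h => h ▸ rfl, elem_ext⟩
      rw [this, elemMap_map, P.comp_restrict]
      simp only [reassoc_of% e₁, e₂]
      exact ⟨fun h => h.2, fun h => ⟨elemMap_base y, h⟩⟩
    obtain ⟨y, hy, huniq⟩ := hP X.a R ⟨u, hu, rfl⟩ _ hcomp
    exact ⟨P.mkElem y hy.1, (ham _).1 hy, fun y' hy' => elem_ext (huniq _ ((ham y').2 hy'))⟩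

/-- An internal presheaf whose external presheaf of elements is a sheaf is itself a sheaf. -/
lemma Presheaf.IsSheaf.of_isStageSheaf (hP : J.IsStageSheaf (elems.obj P)) : IsSheaf J P := by
  intro T a R ⟨u, hu, hR⟩ x ⟨hx, hcomp⟩
  have hsieve : ∀ ⦃T' : E⦄ (r : T' ⟶ (R : E)) (g : T' ⟶ C.C₁)
      (h : (r ≫ R.arrow ≫ pullback.snd a C.cod) ≫ C.dom = g ≫ C.cod), ∃ r' : T' ⟶ (R : E),
        r' ≫ R.arrow ≫ pullback.fst a C.cod = r ≫ R.arrow ≫ pullback.fst a C.cod ∧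
        r' ≫ R.arrow ≫ pullback.snd a C.cod = C.mul (r ≫ R.arrow ≫ pullback.snd a C.cod) g h := by
    subst hR
    intro T' r g h
    obtain ⟨k, hpb, hk⟩ := reindex_isPullback u a hu
    obtain ⟨k', hk', hk''⟩ := SieveClass.total_comp (k := r ≫ k) (g := g) (by simpa [hk] using h)
    refine ⟨hpb.lift (r ≫ (C.reindex J.Cov.sieve u a hu).arrow ≫ pullback.fst a C.cod) k' ?_,
      hpb.lift_fst _ _ _, ?_⟩
    · exact (Category.assoc _ _ _).trans
        ((congr_arg (r ≫ ·) hpb.w).trans ((Category.assoc _ _ _).symm.trans hk'.symm))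
    · refine (congr_arg (hpb.lift _ k' _ ≫ ·) hk.symm).trans ?_
      rw [hpb.lift_snd_assoc, hk'']
      simp [hk]
  obtain ⟨k, hpb, hk⟩ : ∃ k : (R : E) ⟶ J.Cov.total,
      IsPullback (R.arrow ≫ pullback.fst a C.cod) k u J.Cov.proj ∧
        k ≫ J.Cov.arrow = R.arrow ≫ pullback.snd a C.cod := by
    subst hR
    exact reindex_isPullback u a hu
  let X : Stage C := ⟨T, a⟩
  let Y : Stage C := ⟨R, R.arrow ≫ pullback.snd a C.cod ≫ C.dom⟩
  let f : Y ⟶ X := Stage.homMk (X := Y) (Y := X) (R.arrow ≫ pullback.fst a C.cod)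
    (R.arrow ≫ pullback.snd a C.cod) (by simp [X, pullback.condition]) (by simp [Y])
  let z : (elems.obj P).obj (op Y) := P.mkElem (X := Y) x hx
  have hgen := (Topology.isStageSheaf_iff.1 hP) _ (.site (X := X) u hu f k hpb hk)
  rw [Presieve.isSheafFor_singleton] at hgen
  have ham : ∀ (y : T ⟶ P.X) (hy : y ≫ P.base = a), P.IsAmalgamation R x y ↔
      (elems.obj P).map f.op (P.mkElem (X := X) y hy) = z := by
    intro y hy
    have hr : P.restrict (R.arrow ≫ pullback.fst a C.cod ≫ y) (R.arrow ≫ pullback.snd a C.cod)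
        (by simp only [Category.assoc, hy, pullback.condition]) =
        elemMap ((elems.obj P).map f.op (P.mkElem (X := X) y hy)) := by
      rw [elemMap_map]
      congr 1
      exact (Category.assoc _ _ _).symm
    constructor
    · exact fun h => elem_ext (hr.symm.trans h.2)
    · exact fun h => ⟨hy, hr.trans congr(elemMap $h)⟩
  obtain ⟨y, hy, huniq⟩ := hgen z (fun {V} p q w => elem_ext (by
    have key : ∀ p : V ⟶ Y, ∃ r' : V.T ⟶ (R : E), r' ≫ R.arrow ≫ pullback.fst a C.cod =
        p.map ≫ R.arrow ≫ pullback.fst a C.cod ∧ r' ≫ R.arrow ≫ pullback.snd a C.cod =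
        (p ≫ f).arr ∧ elemMap ((elems.obj P).map p.op z) = r' ≫ x := by
      intro p
      obtain ⟨r, hr, hr'⟩ := hsieve p.map p.arr (by simp [p.arr_cod, Y])
      exact ⟨r, hr, hr', hcomp _ _ _ _ hr hr'⟩
    obtain ⟨r, hr, hr', hr''⟩ := key p
    obtain ⟨s, hs, hs', hs''⟩ := key q
    rw [hr'', hs'']
    congr 1
    rw [← cancel_mono R.arrow]
    ext
    · simpa using hr.trans ((congr($(w).map) : _).trans hs.symm)
    · simpa using hr'.trans ((congr($(w).arr) : _).trans hs'.symm)))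
  exact ⟨elemMap y, (ham _ (elemMap_base y)).2 hy,
    fun y' hy' => congr(elemMap $(huniq (P.mkElem (X := X) y' hy'.1) ((ham _ hy'.1).1 hy')))⟩

end SheafComparison

/-! ### Local and represented subfunctors -/

section Closure

variable {E : Type u} [Category.{v} E] [PositiveHeytingCategory E] {S : MorphismProperty E}
  {C : InternalCategory E} {J : Topology S C} {F : (Stage C)ᵒᵖ ⥤ Type w}

/-- A subfunctor of an external presheaf is local if membership can be tested on vertical covers
and on vertical finite sums. -/
structure IsLocal (A : Subfunctor F) : Prop where
  cover : ∀ ⦃X Y : Stage C⦄ (c : Y.T ⟶ X.T) (h : c ≫ X.a = Y.a), IsCover c →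
    ∀ z : F.obj (op X), F.map (Stage.vert c h).op z ∈ A.obj (op Y) → z ∈ A.obj (op X)
  sum : ∀ ⦃X Y Z : Stage C⦄ (i : Y.T ⟶ X.T) (j : Z.T ⟶ X.T) (hi : i ≫ X.a = Y.a)
    (hj : j ≫ X.a = Z.a), IsSum i j → ∀ z : F.obj (op X),
      F.map (Stage.vert i hi).op z ∈ A.obj (op Y) →
      F.map (Stage.vert j hj).op z ∈ A.obj (op Z) → z ∈ A.obj (op X)
  empty : ∀ ⦃X : Stage C⦄, IsEmptyObj X.T → ∀ z : F.obj (op X), z ∈ A.obj (op X)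

/-- The subfunctor `A` is represented by its element `ξ`: the elements of `A` are the vertical
restrictions of `ξ` along unique maps. -/
structure SubRepresents (A : Subfunctor F) (Q : Stage C) (ξ : F.obj (op Q)) : Prop where
  mem : ξ ∈ A.obj (op Q)
  exists_map : ∀ ⦃X : Stage C⦄ (z : F.obj (op X)), z ∈ A.obj (op X) →
    ∃ (q : X.T ⟶ Q.T) (h : q ≫ Q.a = X.a), F.map (Stage.vert q h).op ξ = z
  unique : ∀ ⦃X : Stage C⦄ (q q' : X.T ⟶ Q.T) (h : q ≫ Q.a = X.a) (h' : q' ≫ Q.a = X.a),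
    F.map (Stage.vert q h).op ξ = F.map (Stage.vert q' h').op ξ → q = q'

lemma isRep_toFunctor_iff {A : Subfunctor F} :
    IsRep A.toFunctor ↔ ∃ Q ξ, SubRepresents A Q ξ := by
  constructor
  · rintro ⟨Q, ξ, h⟩
    refine ⟨Q, ξ.1, ξ.2, fun X z hz => ?_, fun X q q' hq hq' e => ?_⟩
    · exact ⟨h.classify ⟨z, hz⟩, h.classify_a _, congr_arg Subtype.val (h.map_classify ⟨z, hz⟩)⟩
    · exact (h _).unique ⟨hq, rfl⟩ ⟨hq', Subtype.ext e.symm⟩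
  · rintro ⟨Q, ξ, h⟩
    refine ⟨Q, ⟨ξ, h.mem⟩, fun X z => ?_⟩
    obtain ⟨q, hq, e⟩ := h.exists_map z.1 z.2
    refine ⟨q, ⟨hq, Subtype.ext e⟩, ?_⟩
    rintro q' ⟨hq', e'⟩
    exact h.unique _ _ _ _ ((congr_arg Subtype.val e').trans e.symm)

/-- A subfunctor of a sheaf which is representable over `C₀` is local. -/
lemma SubRepresents.isLocal {A : Subfunctor F} {Q : Stage C} {ξ : F.obj (op Q)}
    (hA : SubRepresents A Q ξ) (hF : J.IsStageSheaf F) : IsLocal A := by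
  have mem : ∀ {X : Stage C} (q : X.T ⟶ Q.T) (h : q ≫ Q.a = X.a),
      F.map (Stage.vert q h).op ξ ∈ A.obj (op X) := fun q h => A.map _ hA.mem
  refine ⟨fun X Y c h hc z hz => ?_, fun X Y Z i j hi hj hs z hz hz' => ?_, fun X h z => ?_⟩
  · have := hc.epi
    obtain ⟨k, hka, hk⟩ := hA.exists_map _ hz
    obtain ⟨q, hq⟩ := hc.exists_desc k (fun T x y w => by
      have hy : y ≫ Y.a = x ≫ Y.a := by rw [← h, reassoc_of% w]
      refine hA.unique (X := ⟨T, x ≫ Y.a⟩) _ _ (by simp [hka]) (by simp [hka, hy]) ?_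
      have := congr(F.map (Stage.vert (X := ⟨T, x ≫ Y.a⟩) x rfl).op $hk)
      have this' := congr(F.map (Stage.vert (X := ⟨T, x ≫ Y.a⟩) y hy).op $hk)
      rw [Stage.map_op_map_op, Stage.map_op_map_op, Stage.vert_comp_vert,
        Stage.vert_comp_vert] at this this'
      rw [this, this']
      simp only [w])
    have hqa : q ≫ Q.a = X.a := by rw [← cancel_epi c, reassoc_of% hq, hka, h]
    have : F.map (Stage.vert q hqa).op ξ = z := by
      refine hF.cover_ext h hc ?_
      rw [Stage.map_op_map_op, Stage.vert_comp_vert, ← hk]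
      simp only [hq]
    exact this ▸ mem q hqa
  · obtain ⟨k, hka, hk⟩ := hA.exists_map _ hz
    obtain ⟨k', hka', hk'⟩ := hA.exists_map _ hz'
    obtain ⟨q, hq, hq'⟩ := hs.exists_desc k k'
    have hqa : q ≫ Q.a = X.a := hs.hom_ext
      (by rw [reassoc_of% hq, hka, hi]) (by rw [reassoc_of% hq', hka', hj])
    have : F.map (Stage.vert q hqa).op ξ = z := by
      refine hF.sum_ext hi hj hs ?_ ?_
      · rw [Stage.map_op_map_op, Stage.vert_comp_vert, ← hk]
        simp only [hq]
      · rw [Stage.map_op_map_op, Stage.vert_comp_vert, ← hk']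
        simp only [hq']
    exact this ▸ mem q hqa
  · exact hF.empty_ext h (F.map (Stage.vert (h.some.to Q.T) (h.hom_ext _ _)).op ξ) z ▸ mem _ _

namespace Topology

/-- A subsheaf of a sheaf is local. -/
lemma IsStageSheaf.isLocal (hF : J.IsStageSheaf F) {A : Subfunctor F}
    (hA : J.IsStageSheaf A.toFunctor) : IsLocal A := by
  have key : ∀ ⦃X : Stage C⦄ (R : Presieve X), J.Generator X R → ∀ z : F.obj (op X),
      (∀ ⦃Y : Stage C⦄ (f : Y ⟶ X), R f → F.map f.op z ∈ A.obj (op Y)) → z ∈ A.obj (op X) := by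
    intro X R hR z hz
    refine (A.isSheaf_iff hF).1 hA _ z ?_
    refine GrothendieckTopology.superset_covering _ ?_
      (Coverage.Saturate.of X R hR : Sieve.generate R ∈ J.coverage.toGrothendieck X)
    rw [Sieve.generate_le_iff]
    exact fun Y f hf => hz f hf
  refine ⟨fun X Y c h hc z hz => ?_, fun X Y Z i j hi hj hs z hz hz' => ?_, fun X h z => ?_⟩
  · refine key _ (.cover c h hc) z ?_
    rintro _ _ ⟨⟩
    exact hz
  · refine key _ (.sum i j hi hj hs) z ?_
    rintro _ _ (⟨⟨⟩⟩ | ⟨⟨⟩⟩)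
    exacts [hz, hz']
  · exact key _ (.empty h) z fun _ _ h => h.elim

variable (J) in
/-- The element `z` over `X` belongs to the family of sieves `u` (defined after passing to the
cover `c` of `X`) of the subfunctor `A`: its restriction along any arrow in `u` lies in `A`. -/
def RestrictsTo (A : Subfunctor F) {X : Stage C} (z : F.obj (op X)) {T : E} (c : T ⟶ X.T)
    (u : T ⟶ J.Cov.index) : Prop :=
  ∀ ⦃V : Stage C⦄ (s : V.T ⟶ T) (g : V ⟶ X) (m : V.T ⟶ J.Cov.total), s ≫ u = m ≫ J.Cov.proj →
    g.map = s ≫ c → g.arr = m ≫ J.Cov.arrow → F.map g.op z ∈ A.obj (op V)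

variable (J) in
/-- The closure of a subfunctor `A`: the elements which, locally in `E`, restrict to elements of
`A` along all arrows of some covering sieve. -/
def closure (A : Subfunctor F) : Subfunctor F where
  obj X := {z | ∃ (T : E) (c : T ⟶ X.unop.T) (u : T ⟶ J.Cov.index), IsCover c ∧
    u ≫ J.Cov.base = c ≫ X.unop.a ∧ J.RestrictsTo A z c u}
  map := by
    rintro ⟨X⟩ ⟨Y⟩ ⟨f⟩ z ⟨T, c, u, hc, hu, H⟩
    obtain ⟨w, hw, H'⟩ := J.exists_pullback u hu (pullback.fst c f.map)
      (pullback.snd c f.map ≫ f.arr) (by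
        have : c ≫ X.a = c ≫ X.a := rfl
        rw [Category.assoc, f.arr_cod]
        exact pullback.condition_assoc _)
    refine ⟨pullback c f.map, pullback.snd c f.map, w, hc.pullback_snd _, ?_, ?_⟩
    · rw [hw, Category.assoc, f.arr_dom]
    · intro V s g m hs hg hg'
      obtain ⟨k, hk, hk'⟩ := H' m s (by
        rw [← hg', g.arr_cod, hg, Category.assoc, Category.assoc, f.arr_dom, Category.assoc])
        hs.symm
      have := H (V := V) (s ≫ pullback.fst c f.map) (g ≫ f) k hk.symm
        (by rw [Stage.comp_map, hg, Category.assoc, Category.assoc, pullback.condition])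
        (by rw [hk', Stage.comp_arr]; simp [hg, hg'])
      rw [← Stage.map_op_map_op] at this
      exact this

lemma le_closure (A : Subfunctor F) : A ≤ J.closure A := by
  rintro ⟨X⟩ z hz
  obtain ⟨u, hu, -⟩ := J.exists_maximal X.a
  exact ⟨X.T, 𝟙 _, u, .of_isIso _, by simp [hu], fun V s g m _ _ _ => A.map g.op hz⟩

variable (hS : IsClassOfSmallMaps S) (hcod : S C.cod)
include hS hcod

/-- The closure of a local subfunctor of a sheaf is a sheaf. -/
lemma IsStageSheaf.closure (hF : J.IsStageSheaf F) {A : Subfunctor F} (hA : IsLocal A) :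
    J.IsStageSheaf (J.closure A).toFunctor := by
  refine hF.subfunctor _ fun X R hR z hz => ?_
  cases hR with
  | @cover Y d h hd =>
    obtain ⟨T, c, u, hc, hu, H⟩ := hz _ ⟨⟩
    refine ⟨T, c ≫ d, u, hc.comp hd, by rw [hu, ← h, Category.assoc], ?_⟩
    intro V s g m hs hg hg'
    let g' : V ⟶ Y := Stage.homMk (s ≫ c) g.arr
      (by rw [g.arr_cod, hg, ← h]; simp only [Category.assoc]) g.arr_dom
    have := H s g' m hs rfl hg'
    rw [Stage.map_op_map_op] at this
    refine (Stage.map_op_congr F ?_ ?_ z ▸ this :)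
    · simp [g', hg]
    · simp [g']
  | @sum Y Z i j hi hj hij =>
    obtain ⟨T, c, u, hc, hu, H⟩ := hz _ (Or.inl ⟨⟩)
    obtain ⟨T', c', u', hc', hu', H'⟩ := hz _ (Or.inr ⟨⟩)
    refine ⟨T ⨿ T', coprod.desc (c ≫ i) (c' ≫ j), coprod.desc u u', hij.isCover_desc hc hc', ?_, ?_⟩
    · ext
      · simpa [hi] using hu
      · simpa [hj] using hu'
    intro V s g m hs hg hg'
    let V₁ : Stage C := ⟨pullback s coprod.inl, pullback.fst s coprod.inl ≫ V.a⟩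
    let V₂ : Stage C := ⟨pullback s coprod.inr, pullback.fst s coprod.inr ≫ V.a⟩
    refine hA.sum (Y := V₁) (Z := V₂) (pullback.fst s coprod.inl) (pullback.fst s coprod.inr)
      rfl rfl ((isSum_coprod T T').of_isPullback (IsPullback.of_hasPullback _ _)
        (IsPullback.of_hasPullback _ _)) _ ?_ ?_
    · have e : pullback.fst s coprod.inl ≫ g.map = (pullback.snd s coprod.inl ≫ c) ≫ i := by
        rw [hg, pullback.condition_assoc]; simp
      let g₁ : V₁ ⟶ Y := Stage.homMk (X := V₁) (pullback.snd s coprod.inl ≫ c)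
        (pullback.fst s coprod.inl ≫ g.arr)
        (by rw [Category.assoc, g.arr_cod, reassoc_of% e, ← hi]; simp)
        (by rw [Category.assoc, g.arr_dom])
      have := H (V := V₁) (pullback.snd s coprod.inl) g₁ (pullback.fst s coprod.inl ≫ m)
        (by rw [Category.assoc, ← hs, pullback.condition_assoc]; simp) rfl (by simp [g₁, hg'])
      rw [Stage.map_op_map_op] at this ⊢
      refine (Stage.map_op_congr F ?_ ?_ z ▸ this :)
      · simp [g₁, e]
      · simp [g₁]
    · have e : pullback.fst s coprod.inr ≫ g.map = (pullback.snd s coprod.inr ≫ c') ≫ j := by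
        rw [hg, pullback.condition_assoc]; simp
      let g₁ : V₂ ⟶ Z := Stage.homMk (X := V₂) (pullback.snd s coprod.inr ≫ c')
        (pullback.fst s coprod.inr ≫ g.arr)
        (by rw [Category.assoc, g.arr_cod, reassoc_of% e, ← hj]; simp)
        (by rw [Category.assoc, g.arr_dom])
      have := H' (V := V₂) (pullback.snd s coprod.inr) g₁ (pullback.fst s coprod.inr ≫ m)
        (by rw [Category.assoc, ← hs, pullback.condition_assoc]; simp) rfl (by simp [g₁, hg'])
      rw [Stage.map_op_map_op] at this ⊢
      refine (Stage.map_op_congr F ?_ ?_ z ▸ this :)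
      · simp [g₁, e]
      · simp [g₁]
  | empty h =>
    obtain ⟨u, hu, -⟩ := J.exists_maximal X.a
    exact ⟨X.T, 𝟙 _, u, .of_isIso _, by simp [hu], fun V s g m _ _ _ => hA.empty (h.of_hom s) _⟩
  | @site Y u hu f k h hk =>
    obtain ⟨T, c, v, hc, hv, H⟩ := hz _ ⟨⟩
    obtain ⟨B, b, w, hb, hw, H'⟩ := J.exists_union hS hcod hu h hc v
      (by rw [hv, hk, f.arr_dom])
    refine ⟨B, b, w, hb, hw, fun V s g m hs hg hg' => ?_⟩
    obtain ⟨Q, q, y, n, hn, hq, e, e'⟩ := H' s m hs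
    let V' : Stage C := ⟨Q, q ≫ V.a⟩
    refine hA.cover (Y := V') q rfl hq _ ?_
    let g' : V' ⟶ Y := Stage.homMk (X := V') (y ≫ c) (n ≫ J.Cov.arrow)
      (by simp [SieveClass.arrow_cod, reassoc_of% hn, hv]) (by
        have := congr($e' ≫ C.dom)
        rw [C.mul_dom] at this
        rw [← this, ← hg', Category.assoc, g.arr_dom])
    have := H (V := V') y g' n hn.symm rfl rfl
    rw [Stage.map_op_map_op] at this ⊢
    refine (Stage.map_op_congr F ?_ ?_ z ▸ this :)
    · simp [g', hg, e]
    · rw [Stage.comp_arr, Stage.vert_comp_arr, hg']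
      simp [g', ← hk, e']

/-- The closure of a local subfunctor of a sheaf is its sheafification. -/
lemma IsStageSheaf.sheafify_eq_closure (hF : J.IsStageSheaf F) {A : Subfunctor F}
    (hA : IsLocal A) : A.sheafify J.coverage.toGrothendieck = J.closure A := by
  refine le_antisymm (A.sheafify_le _ (le_closure A) hF (hF.closure hS hcod hA)) ?_
  rintro ⟨X⟩ z ⟨T, c, u, hc, hu, H⟩
  have hsh := A.sheafify_isSheaf hF
  have hl := hF.isLocal hsh
  let X' : Stage C := ⟨T, c ≫ X.a⟩
  refine hl.cover (Y := X') c rfl hc z ?_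
  let Y : Stage C := ⟨pullback u J.Cov.proj, pullback.snd u J.Cov.proj ≫ J.Cov.arrow ≫ C.dom⟩
  let f : Y ⟶ X' := Stage.homMk (X := Y) (Y := X') (pullback.fst u J.Cov.proj)
    (pullback.snd u J.Cov.proj ≫ J.Cov.arrow)
    (by simp [X', SieveClass.arrow_cod, ← pullback.condition_assoc, hu]) (by simp [Y])
  refine ((A.sheafify _).isSheaf_iff hF).1 hsh _ _ ?_
  refine GrothendieckTopology.superset_covering _ ?_
    (Coverage.Saturate.of X' _ (.site (X := X') (Y := Y) u hu f (pullback.snd u J.Cov.proj)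
      (IsPullback.of_hasPullback _ _) rfl) :
      Sieve.generate _ ∈ J.coverage.toGrothendieck X')
  rw [Sieve.generate_le_iff]
  intro _ _ hf
  cases hf
  refine A.le_sheafify _ _ ?_
  have := H (V := Y) (pullback.fst u J.Cov.proj) (f ≫ Stage.vert (X := X') c rfl)
    (pullback.snd u J.Cov.proj) pullback.condition (by simp [f]) (by simp [f])
  rw [← Stage.map_op_map_op] at this
  exact this

end Topology
end Closure

/-! ### Quotients and dependent products -/

section Quotients

variable {E : Type u} [Category.{v} E] [PositiveHeytingCategory E] {S : MorphismProperty E}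
  {C : InternalCategory E} {J : Topology S C} {F : (Stage C)ᵒᵖ ⥤ Type w}

/-- The vertical restrictions of `ζ` along `x` and `y` are equal. -/
def Identifies {V : Stage C} (ζ : F.obj (op V)) {T : E} (x y : T ⟶ V.T) : Prop :=
  ∃ (a : T ⟶ C.C₀) (hx : x ≫ V.a = a) (hy : y ≫ V.a = a),
    F.map (Stage.vert (X := ⟨T, a⟩) x hx).op ζ = F.map (Stage.vert (X := ⟨T, a⟩) y hy).op ζ

/-- Locally in `E`, the element `z` is a vertical restriction of `ζ`. -/
def LocallyRestricts {V : Stage C} (ζ : F.obj (op V)) {X : Stage C} (z : F.obj (op X)) : Prop :=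
  ∃ (X' : Stage C) (c : X'.T ⟶ X.T) (h : c ≫ X.a = X'.a) (t : X'.T ⟶ V.T)
    (ht : t ≫ V.a = X'.a), IsCover c ∧
      F.map (Stage.vert c h).op z = F.map (Stage.vert t ht).op ζ

lemma identifies_iff {V : Stage C} {ζ : F.obj (op V)} {X : Stage C} {x y : X.T ⟶ V.T}
    (hx : x ≫ V.a = X.a) (hy : y ≫ V.a = X.a) :
    Identifies ζ x y ↔ F.map (Stage.vert x hx).op ζ = F.map (Stage.vert y hy).op ζ :=
  ⟨fun ⟨_, h, _, e⟩ => by obtain rfl := h.symm.trans hx; exact e, fun e => ⟨_, hx, hy, e⟩⟩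

lemma Identifies.equivalence {V : Stage C} (ζ : F.obj (op V)) (T : E) :
    Equivalence (Identifies ζ (T := T)) :=
  ⟨fun x => ⟨_, rfl, rfl, rfl⟩, fun ⟨a, hx, hy, e⟩ => ⟨a, hy, hx, e.symm⟩,
    fun ⟨a, hx, hy, e⟩ ⟨b, hx', hy', e'⟩ => by
      obtain rfl := hy.symm.trans hx'
      exact ⟨_, hx, hy', e.trans e'⟩⟩

/-- Elements of a subfunctor that are locally restrictions of `ζ` are represented by the quotient
of `V` by the relation of having equal restrictions of `ζ`, provided that this relation is
given by a small mono. -/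
lemma Topology.IsStageSheaf.exists_subRepresents (hS : IsPredicative S) (hF : J.IsStageSheaf F)
    {A : Subfunctor F} (hA : ∀ ⦃X Y : Stage C⦄ (c : Y.T ⟶ X.T) (h : c ≫ X.a = Y.a), IsCover c →
      ∀ z : F.obj (op X), F.map (Stage.vert c h).op z ∈ A.obj (op Y) → z ∈ A.obj (op X))
    {V : Stage C} {ζ : F.obj (op V)} (hζ : ζ ∈ A.obj (op V))
    (hloc : ∀ ⦃X : Stage C⦄ (z : F.obj (op X)), z ∈ A.obj (op X) → LocallyRestricts ζ z)
    {N : E} (n : N ⟶ pullback V.a V.a) [Mono n] (hn : S n)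
    (hker : ∀ ⦃T : E⦄ (t : T ⟶ pullback V.a V.a), (∃ k, k ≫ n = t) ↔
      Identifies ζ (t ≫ pullback.fst V.a V.a) (t ≫ pullback.snd V.a V.a)) :
    ∃ Q ξ, SubRepresents A Q ξ := by
  have hrel : ∀ {T : E} (x y : T ⟶ V.T), (∃ r, r ≫ n ≫ pullback.fst V.a V.a = x ∧
      r ≫ n ≫ pullback.snd V.a V.a = y) ↔ Identifies ζ x y := by
    intro T x y
    constructor
    · rintro ⟨r, rfl, rfl⟩
      simpa using (hker (r ≫ n)).1 ⟨r, rfl⟩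
    · intro h
      obtain ⟨a, hx, hy, e⟩ := id h
      obtain ⟨r, hr⟩ := (hker (pullback.lift x y (hx.trans hy.symm))).2 (by simpa using h)
      exact ⟨r, by rw [reassoc_of% hr]; simp, by rw [reassoc_of% hr]; simp⟩
  have hfac : prod.lift (n ≫ pullback.fst V.a V.a) (n ≫ pullback.snd V.a V.a) =
      n ≫ prod.lift (pullback.fst V.a V.a) (pullback.snd V.a V.a) := by ext <;> simp
  have hmono : Mono (prod.lift (n ≫ pullback.fst V.a V.a) (n ≫ pullback.snd V.a V.a)) := by
    refine ⟨fun x y e => ?_⟩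
    rw [← cancel_mono n]
    ext
    · simpa using congr($e ≫ prod.fst)
    · simpa using congr($e ≫ prod.snd)
  obtain ⟨Q, e, ⟨⟨hk, w, ⟨hcol⟩⟩, -⟩⟩ := hS.bounded_exactness (n ≫ pullback.fst V.a V.a)
    (n ≫ pullback.snd V.a V.a) ⟨hmono, fun T => by
      simpa only [hrel] using Identifies.equivalence ζ T⟩ (by
      rw [hfac]
      exact hS.comp _ _ hn (hS.toIsClassOfSmallMaps.lift_pullback _ _))
  have he : IsCover e := .of_isColimit w hcol
  have hker' : ∀ {T : E} (x y : T ⟶ V.T), x ≫ e = y ≫ e ↔ Identifies ζ x y := by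
    intro T x y
    rw [← hrel]
    constructor
    · exact fun h => ⟨hk.lift x y h, hk.lift_fst _ _ _, hk.lift_snd _ _ _⟩
    · rintro ⟨r, rfl, rfl⟩
      simp only [Category.assoc] at w ⊢
      rw [w]
  obtain ⟨b, hb⟩ := he.exists_desc V.a fun T x y h => by
    obtain ⟨a, hx, hy, -⟩ := (hker' x y).1 h
    exact hx.trans hy.symm
  obtain ⟨ξ, hξ⟩ := hF.cover_glue (X := ⟨Q, b⟩) hb he ζ fun W x y hx hy h =>
    (identifies_iff hx hy).1 ((hker' x y).1 h)
  have hres : ∀ {X : Stage C} (t : X.T ⟶ V.T) (ht : t ≫ V.a = X.a) (h' : (t ≫ e) ≫ b = X.a),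
      F.map (Stage.vert (Y := ⟨Q, b⟩) (t ≫ e) h').op ξ = F.map (Stage.vert t ht).op ζ := by
    intro X t ht h'
    rw [← hξ, Stage.map_op_map_op, Stage.vert_comp_vert]
  refine ⟨⟨Q, b⟩, ξ, hA (X := ⟨Q, b⟩) e hb he ξ (hξ ▸ hζ), fun X z hz => ?_,
    fun X q q' h h' H => ?_⟩
  · obtain ⟨X', c, hc', t, ht, hc, hz'⟩ := hloc z hz
    have := hc.epi
    obtain ⟨q, hq⟩ := hc.exists_desc (t ≫ e) fun T x y hxy => by
      have hy : y ≫ X'.a = x ≫ X'.a := by rw [← hc', reassoc_of% hxy]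
      have := (hker' (x ≫ t) (y ≫ t)).2
        ((identifies_iff (X := ⟨T, x ≫ X'.a⟩) (by simp [ht]) (by simp [ht, hy])).2 (by
          have h1 := congr(F.map (Stage.vert (X := ⟨T, x ≫ X'.a⟩) x rfl).op $hz')
          have h2 := congr(F.map (Stage.vert (X := ⟨T, x ≫ X'.a⟩) y hy).op $hz')
          rw [Stage.map_op_map_op, Stage.map_op_map_op, Stage.vert_comp_vert,
            Stage.vert_comp_vert] at h1 h2
          rw [← h1, ← h2]
          simp only [hxy]))
      simpa using this
    have hqb : q ≫ b = X.a := by rw [← cancel_epi c, reassoc_of% hq, hb, ht, hc']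
    refine ⟨q, hqb, hF.cover_ext hc' hc ?_⟩
    rw [hz', ← hres t ht (by rw [Category.assoc, hb, ht]), Stage.map_op_map_op,
      Stage.vert_comp_vert]
    simp only [hq]
  · -- Locally, both maps lift to `V`.
    let T₁ := pullback e q
    let T₂ := pullback e (pullback.snd e q ≫ q')
    let c : T₂ ⟶ X.T := pullback.snd e _ ≫ pullback.snd e q
    have hc : IsCover c := (he.pullback_snd _).comp (he.pullback_snd _)
    let x : T₂ ⟶ V.T := pullback.snd e _ ≫ pullback.fst e q
    let y : T₂ ⟶ V.T := pullback.fst e _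
    have hx : x ≫ e = c ≫ q := by simp [x, c, pullback.condition]
    have hy : y ≫ e = c ≫ q' := by simp [y, c, pullback.condition]
    have := hc.epi
    have hxa : x ≫ V.a = c ≫ X.a := by rw [← hb, reassoc_of% hx, h]
    have hya : y ≫ V.a = c ≫ X.a := by rw [← hb, reassoc_of% hy, h']
    have hx' := hres (X := ⟨T₂, c ≫ X.a⟩) x hxa
      ((Category.assoc _ _ _).trans ((congr_arg (x ≫ ·) hb).trans hxa))
    have hy' := hres (X := ⟨T₂, c ≫ X.a⟩) y hya
      ((Category.assoc _ _ _).trans ((congr_arg (y ≫ ·) hb).trans hya))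
    rw [← cancel_epi c, ← hx, ← hy, hker', identifies_iff (X := ⟨T₂, c ≫ X.a⟩) hxa hya, ← hx',
      ← hy']
    have H' := congr(F.map (Stage.vert (X := ⟨T₂, c ≫ X.a⟩) c rfl).op $H)
    rw [Stage.map_op_map_op, Stage.map_op_map_op, Stage.vert_comp_vert,
      Stage.vert_comp_vert] at H'
    simpa only [hx, hy] using H'

/-- Dependent products along an exponentiable map `ρ : Z ⟶ I`, described on elements: a map
`T ⟶ M` is a map `u : T ⟶ I` together with a map `T ×_I Z ⟶ Q` over `A`. -/
lemma exists_dependentProduct {Z I A Q : E} (ρ : Z ⟶ I) [(Over.pullback ρ).IsLeftAdjoint]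
    (b : Z ⟶ A) (a : Q ⟶ A) : ∃ (M P : E) (μ : M ⟶ I) (p : P ⟶ M) (k : P ⟶ Z) (ε : P ⟶ Q),
      IsPullback p k μ ρ ∧ ε ≫ a = k ≫ b ∧
      (∀ ⦃T W : E⦄ (u : T ⟶ I) (p' : W ⟶ T) (k' : W ⟶ Z) (e : W ⟶ Q), IsPullback p' k' u ρ →
        e ≫ a = k' ≫ b →
          ∃ (t : T ⟶ M) (l : W ⟶ P), t ≫ μ = u ∧ l ≫ p = p' ≫ t ∧ l ≫ k = k' ∧ l ≫ ε = e) ∧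
      (∀ ⦃T : E⦄ (t t' : T ⟶ M), t ≫ μ = t' ≫ μ →
        (∀ ⦃V : E⦄ (r r' : V ⟶ P) (s : V ⟶ T), r ≫ p = s ≫ t → r' ≫ p = s ≫ t' →
          r ≫ k = r' ≫ k → r ≫ ε = r' ≫ ε) → t = t') := by
  let adj := Adjunction.ofIsLeftAdjoint (Over.pullback ρ)
  let D : Over Z := Over.mk (pullback.fst b a)
  let M := (Over.pullback ρ).rightAdjoint.obj D
  let η : (Over.pullback ρ).obj M ⟶ D := adj.counit.app D
  let η' : pullback M.hom ρ ⟶ pullback b a := η.left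
  have hη : η' ≫ pullback.fst b a = pullback.snd M.hom ρ := Over.w η
  refine ⟨M.left, pullback M.hom ρ, M.hom, pullback.fst _ _, pullback.snd _ _,
    η' ≫ pullback.snd b a, IsPullback.of_hasPullback _ _, ?_, ?_, ?_⟩
  · rw [← hη, Category.assoc, Category.assoc, pullback.condition]
  · intro T W u p' k' e hW he
    let i := hW.isoPullback
    let e' : (Over.pullback ρ).obj (Over.mk u) ⟶ D :=
      Over.homMk (pullback.lift (pullback.snd u ρ) (i.inv ≫ e)
        (by rw [Category.assoc, he, ← Category.assoc, hW.isoPullback_inv_snd])) (by simp [D])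
    let t : Over.mk u ⟶ M := adj.homEquiv _ _ e'
    have ht : (Over.pullback ρ).map t ≫ η = e' := by
      rw [← adj.homEquiv_counit]
      exact (adj.homEquiv _ _).symm_apply_apply e'
    have ht' := congr(($ht).left ≫ pullback.snd b a)
    refine ⟨t.left, i.hom ≫ ((Over.pullback ρ).map t).left, Over.w t, ?_, ?_, ?_⟩
    · simp [i]
    · simp [i]
    · simp only [Over.comp_left, Category.assoc] at ht' ⊢
      refine (congr(i.hom ≫ $ht')).trans ?_
      simp [e']
  · intro T t t' h H
    let f : Over.mk (t ≫ M.hom) ⟶ M := Over.homMk t rfl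
    let f' : Over.mk (t ≫ M.hom) ⟶ M := Over.homMk t' h.symm
    have : f = f' := by
      refine (adj.homEquiv _ _).symm.injective ?_
      rw [adj.homEquiv_counit, adj.homEquiv_counit]
      ext
      have hf := Over.w ((Over.pullback ρ).map f ≫ η)
      have hf' := Over.w ((Over.pullback ρ).map f' ≫ η)
      refine pullback.hom_ext (hf.trans hf'.symm) ?_
      have := H ((Over.pullback ρ).map f).left ((Over.pullback ρ).map f').left
        (pullback.fst (t ≫ M.hom) ρ) (by simp [f]) (by simp [f']) (by simp)
      simpa [η'] using this
    exact congr(($this).left)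

end Quotients

/-! ### Small matching families -/

section ClosureRepresentable

variable {E : Type u} [Category.{v} E] [PositiveHeytingCategory E] {S : MorphismProperty E}
  {C : InternalCategory E} {J : Topology S C} {F : (Stage C)ᵒᵖ ⥤ Type w}

/-- The object `M` of pairs of a covering sieve `u` and a matching family on `u` of elements of a
representable subfunctor `A` of a sheaf `F`; here `P` is the object of arrows in these covering
sieves, and `ζ` the amalgamation in `F` of the generic matching family `ε`. -/
lemma Topology.IsStageSheaf.exists_matching (hS : IsPredicative S) (hF : J.IsStageSheaf F)
    {A : Subfunctor F} {Q : Stage C} {ξ : F.obj (op Q)} (hA : SubRepresents A Q ξ) :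
    ∃ (M P : Stage C) (u : M.T ⟶ J.Cov.index) (f : P ⟶ M) (k : P.T ⟶ J.Cov.total)
      (ε : P.T ⟶ Q.T) (hε : ε ≫ Q.a = P.a) (ζ : F.obj (op M)), u ≫ J.Cov.base = M.a ∧
      IsPullback f.map k u J.Cov.proj ∧ k ≫ J.Cov.arrow = f.arr ∧
      F.map f.op ζ = F.map (Stage.vert ε hε).op ξ ∧
      ∀ ⦃X : Stage C⦄ (u' : X.T ⟶ J.Cov.index) (z : F.obj (op X)), u' ≫ J.Cov.base = X.a →
        J.RestrictsTo A z (𝟙 X.T) u' → ∃ (t : X.T ⟶ M.T) (ht : t ≫ M.a = X.a),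
          F.map (Stage.vert t ht).op ζ = z := by
  have := hS.exponentiable _ J.Cov.small_proj
  obtain ⟨M₀, P₀, μ, p₀, k₀, ε₀, hP₀, hε₀, hex, -⟩ :=
    exists_dependentProduct J.Cov.proj (J.Cov.arrow ≫ C.dom) Q.a
  let SM : Stage C := ⟨M₀, μ ≫ J.Cov.base⟩
  let SP : Stage C := ⟨P₀, k₀ ≫ J.Cov.arrow ≫ C.dom⟩
  let f₀ : SP ⟶ SM := Stage.homMk (X := SP) (Y := SM) p₀ (k₀ ≫ J.Cov.arrow)
    (by simp [SM, SieveClass.arrow_cod, hP₀.w_assoc]) (by simp [SP])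
  let σ : F.obj (op SP) := F.map (Stage.vert (X := SP) ε₀ hε₀).op ξ
  have hσ : σ ∈ A.obj (op SP) := A.map _ hA.mem
  have hσr : ∀ {V : Stage C} (r : V.T ⟶ P₀) (hr : r ≫ SP.a = V.a) (h : (r ≫ ε₀) ≫ Q.a = V.a),
      F.map (Stage.vert (Y := SP) r hr).op σ = F.map (Stage.vert (r ≫ ε₀) h).op ξ := by
    intro V r hr h
    rw [Stage.map_op_map_op, Stage.vert_comp_vert]
  clear_value σ
  have hf₀ : ∀ {V : E} {r r' : V ⟶ P₀}, r ≫ p₀ = r' ≫ p₀ →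
      r ≫ k₀ ≫ J.Cov.arrow = r' ≫ k₀ ≫ J.Cov.arrow → r = r' := by
    intro V r r' h h'
    refine hP₀.hom_ext h (SieveClass.total_hom_ext ?_ (by simpa using h'))
    rw [Category.assoc, Category.assoc, ← hP₀.w, reassoc_of% h]
  have hnorm : ∀ {V : Stage C} (g : V ⟶ SP), ∃ (r : V.T ⟶ P₀) (hr : r ≫ SP.a = V.a),
      Stage.vert (Y := SP) r hr ≫ f₀ = g ≫ f₀ := by
    intro V g
    obtain ⟨k', hk', hk''⟩ := SieveClass.total_comp (k := g.map ≫ k₀) (g := g.arr)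
      (by simp [g.arr_cod, SP])
    have hw : (g.map ≫ p₀) ≫ μ = k' ≫ J.Cov.proj := by simp [hk', hP₀.w]
    refine ⟨hP₀.lift _ k' hw, ?_, ?_⟩
    · simp only [SP]
      rw [hP₀.lift_snd_assoc, reassoc_of% hk'', C.mul_dom, g.arr_dom]
    · ext
      · simp [f₀]
      · rw [Stage.vert_comp_arr, Stage.comp_arr]
        simp [f₀, hk'']
  -- The generic arrow `g` composable with the generic arrow of a generic covering sieve.
  let G : Stage C := ⟨pullback (k₀ ≫ J.Cov.arrow ≫ C.dom) C.cod, pullback.snd _ _ ≫ C.dom⟩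
  let γ : G ⟶ SP := Stage.homMk (X := G) (Y := SP) (pullback.fst _ _) (pullback.snd _ _)
    pullback.condition.symm rfl
  obtain ⟨r₀, hr₀, hrγ⟩ := hnorm γ
  obtain ⟨e, he, heq⟩ := hA.exists_map (F.map γ.op σ) (A.map _ hσ)
  -- The families which match: the compatibility condition, quantified over all composable arrows.
  obtain ⟨M, n, hn, hM, -⟩ := exists_forall (γ.map ≫ p₀) (equalizer.ι e (r₀ ≫ ε₀))
  have hM' : ∀ {T : E} (t : T ⟶ M₀), (∃ l, l ≫ n = t) ↔ ∀ ⦃T' : E⦄ (s : T' ⟶ T) (y : T' ⟶ G.T),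
      y ≫ γ.map ≫ p₀ = s ≫ t → y ≫ e = y ≫ r₀ ≫ ε₀ := by
    intro T t
    rw [hM]
    refine forall_congr' fun T' => forall_congr' fun s => forall_congr' fun y => imp_congr_right
      fun _ => ⟨?_, fun h => ⟨equalizer.lift y h, by simp⟩⟩
    rintro ⟨l, rfl⟩
    simp only [Category.assoc]
    exact congr(l ≫ $(equalizer.condition e (r₀ ≫ ε₀)))
  have hγ : ∀ {V : Stage C} (g : V ⟶ SP), ∃ (y : V.T ⟶ G.T) (hy : y ≫ G.a = V.a),
      g = Stage.vert y hy ≫ γ := by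
    intro V g
    refine ⟨pullback.lift g.map g.arr g.arr_cod.symm, by simp [G, g.arr_dom], ?_⟩
    ext <;> simp [γ]
  have hres : ∀ {V : Stage C} (y : V.T ⟶ G.T) (hy : y ≫ G.a = V.a) (h : (y ≫ e) ≫ Q.a = V.a),
      F.map (Stage.vert y hy ≫ γ).op σ = F.map (Stage.vert (y ≫ e) h).op ξ := by
    intro V y hy h
    rw [← Stage.map_op_map_op, ← heq, Stage.map_op_map_op, Stage.vert_comp_vert]
  have hcompat : ∀ {V : Stage C} (g : V ⟶ SP) (v : V.T ⟶ M), g.map ≫ p₀ = v ≫ n →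
      ∀ (r : V.T ⟶ P₀) (hr : r ≫ SP.a = V.a), Stage.vert (Y := SP) r hr ≫ f₀ = g ≫ f₀ →
        F.map g.op σ = F.map (Stage.vert (Y := SP) r hr).op σ := by
    intro V g v hv r hr hg
    obtain ⟨y, hy, rfl⟩ := hγ g
    have hye : y ≫ e = y ≫ r₀ ≫ ε₀ := (hM' n).1 ⟨𝟙 _, Category.id_comp _⟩ v y (by simpa using hv)
    rw [hres y hy (by rw [Category.assoc, he, hy])]
    have : r = y ≫ r₀ := by
      refine hf₀ ?_ ?_
      · have h1 := congr(Stage.Hom.map $hg)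
        have h2 := congr(Stage.Hom.map $hrγ)
        simp only [Stage.comp_map, Stage.vert_map, Category.assoc, f₀, Stage.homMk_map] at h1 h2
        rw [h1, Category.assoc, h2]
      · have h1 := congr(Stage.Hom.arr $hg)
        have h2 := congr(Stage.Hom.arr $hrγ)
        rw [Category.assoc] at h1
        rw [Stage.vert_comp_arr, Stage.vert_comp_arr, ← h2, Stage.vert_comp_arr] at h1
        simpa [f₀] using h1
    rw [hσr r hr (by rw [Category.assoc, hε₀]; exact hr)]
    simp only [hye, this, Category.assoc]
  let X₁ : Stage C := ⟨M, n ≫ μ ≫ J.Cov.base⟩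
  let P : Stage C := ⟨pullback n p₀, pullback.snd n p₀ ≫ k₀ ≫ J.Cov.arrow ≫ C.dom⟩
  let f : P ⟶ X₁ := Stage.homMk (X := P) (Y := X₁) (pullback.fst n p₀)
    (pullback.snd n p₀ ≫ k₀ ≫ J.Cov.arrow)
    (by simp [X₁, SieveClass.arrow_cod, pullback.condition_assoc, hP₀.w_assoc]) (by simp [P])
  have hPB : IsPullback f.map (pullback.snd n p₀ ≫ k₀) (n ≫ μ) J.Cov.proj :=
    ((IsPullback.of_hasPullback n p₀).flip.paste_horiz hP₀.flip).flip
  have hff₀ : Stage.vert (X := P) (Y := SP) (pullback.snd n p₀) rfl ≫ f₀ =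
      f ≫ Stage.vert (Y := SM) n rfl := by
    ext
    · simp [f, f₀, pullback.condition]
    · simp [f, f₀]
  let σ₁ : F.obj (op P) := F.map (Stage.vert (X := P) (Y := SP) (pullback.snd n p₀) rfl).op σ
  obtain ⟨ζ, hζ⟩ := hF.site_glue (X := X₁) (Y := P) (u := n ≫ μ) (f := f)
    (by simp [X₁]) hPB (by simp [f]) σ₁ (fun V g g' hg => by
      obtain ⟨r, hr, hr'⟩ := hnorm (g ≫ Stage.vert (Y := SP) (pullback.snd n p₀) rfl)
      have hgg : (g ≫ Stage.vert (Y := SP) (pullback.snd n p₀) rfl) ≫ f₀ =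
          (g' ≫ Stage.vert (Y := SP) (pullback.snd n p₀) rfl) ≫ f₀ := by
        rw [Category.assoc, hff₀, reassoc_of% hg, Category.assoc, hff₀]
      rw [Stage.map_op_map_op, Stage.map_op_map_op,
        hcompat _ (g.map ≫ pullback.fst n p₀) (by simp [pullback.condition]) r hr hr',
        hcompat _ (g'.map ≫ pullback.fst n p₀) (by simp [pullback.condition]) r hr
          (hr'.trans hgg)])
  refine ⟨X₁, P, n ≫ μ, f, pullback.snd n p₀ ≫ k₀, pullback.snd n p₀ ≫ ε₀,
    by simp [P, hε₀], ζ, by simp [X₁], hPB, by simp [f], ?_, ?_⟩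
  · rw [hζ]
    exact hσr (V := P) _ _ _
  -- A matching family of restrictions of `z` gives a map to `M`.
  intro X u' z hu' hz
  let W : Stage C := ⟨pullback u' J.Cov.proj, pullback.snd u' J.Cov.proj ≫ J.Cov.arrow ≫ C.dom⟩
  let fW : W ⟶ X := Stage.homMk (X := W) (pullback.fst u' J.Cov.proj)
    (pullback.snd u' J.Cov.proj ≫ J.Cov.arrow)
    (by simp [SieveClass.arrow_cod, ← hu', pullback.condition_assoc]) (by simp [W])
  obtain ⟨e', he', heq'⟩ := hA.exists_map (F.map fW.op z)
    (hz (V := W) (pullback.fst u' J.Cov.proj) fW (pullback.snd u' J.Cov.proj) pullback.condition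
      (by simp [fW]) rfl)
  obtain ⟨t₀, l, ht₀, hl, hl', hl''⟩ := hex u' (pullback.fst u' J.Cov.proj)
    (pullback.snd u' J.Cov.proj) e' (IsPullback.of_hasPullback _ _) he'
  have hzr : ∀ {V : Stage C} (r : V.T ⟶ P₀) (hr : r ≫ SP.a = V.a) (g : V ⟶ X),
      r ≫ p₀ = g.map ≫ t₀ → r ≫ k₀ ≫ J.Cov.arrow = g.arr →
        F.map (Stage.vert (Y := SP) r hr).op σ = F.map g.op z := by
    intro V r hr g h h'
    obtain ⟨w, hw, hw'⟩ : ∃ w : V.T ⟶ W.T, w ≫ pullback.fst u' J.Cov.proj = g.map ∧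
        w ≫ pullback.snd u' J.Cov.proj = r ≫ k₀ :=
      ⟨pullback.lift g.map (r ≫ k₀) (by rw [Category.assoc, ← hP₀.w, reassoc_of% h, ht₀]),
        pullback.lift_fst _ _ _, pullback.lift_snd _ _ _⟩
    have hwl : w ≫ l = r := by
      refine hP₀.hom_ext ?_ ?_
      · rw [Category.assoc, hl, reassoc_of% hw, h]
      · rw [Category.assoc, hl', hw']
    have hwa : w ≫ W.a = V.a := by
      simp only [W]
      rw [reassoc_of% hw']
      exact hr
    have hwg : Stage.vert w hwa ≫ fW = g := by
      ext
      · simp [fW, hw]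
      · simp [fW, reassoc_of% hw', h']
    rw [← hwg, ← Stage.map_op_map_op, ← heq', Stage.map_op_map_op, Stage.vert_comp_vert,
      hσr r hr (by rw [Category.assoc, hε₀]; exact hr)]
    simp only [← hwl, Category.assoc, hl'']
  obtain ⟨t, ht⟩ := (hM' t₀).2 fun T s y hy => by
    let V : Stage C := ⟨T, y ≫ G.a⟩
    have hya : (y ≫ r₀) ≫ SP.a = V.a := by rw [Category.assoc, hr₀]
    refine hA.unique (X := V) _ _ (by rw [Category.assoc, he]) (by
      rw [Category.assoc, Category.assoc, hε₀]; exact (Category.assoc _ _ _).symm.trans hya) ?_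
    rw [← hres (V := V) y rfl]
    obtain ⟨r, hr, hg⟩ : ∃ (r : T ⟶ P₀) (hr : r ≫ SP.a = r ≫ SP.a), r = y ≫ γ.map :=
      ⟨_, rfl, rfl⟩
    let V' : Stage C := ⟨T, r ≫ SP.a⟩
    let g₁ : V ⟶ V' := Stage.homMk (𝟙 T) (y ≫ γ.arr)
      (by
        simp only [V', hg, γ.arr_cod, Category.assoc]
        exact (Category.id_comp _).symm) (by simp [V, γ.arr_dom])
    let g₂ : V' ⟶ X := Stage.homMk s (r ≫ k₀ ≫ J.Cov.arrow) (by
        have : r ≫ p₀ = s ≫ t₀ := by rw [hg, Category.assoc, hy]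
        simp only [Category.assoc, SieveClass.arrow_cod, ← hP₀.w_assoc]
        rw [reassoc_of% this, reassoc_of% ht₀, hu']) (by simp [V', SP])
    have e₁ : Stage.vert (X := V) y rfl ≫ γ = g₁ ≫ Stage.vert (X := V') (Y := SP) r rfl := by
      ext
      · simp only [Stage.comp_map, Stage.vert_map, g₁, hg, Stage.homMk_map]
        exact (Category.id_comp _).symm
      · simp [g₁]
    rw [e₁, ← Stage.map_op_map_op, hzr (V := V') r rfl g₂ (by simp [hg, hy, g₂]) rfl,
      Stage.map_op_map_op]
    have h1 := congr(Stage.Hom.map $hrγ)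
    have h2 := congr(Stage.Hom.arr $hrγ)
    simp only [Stage.comp_map, Stage.vert_map, f₀, Stage.homMk_map] at h1
    rw [Stage.vert_comp_arr] at h2
    have := hzr (V := V) (y ≫ r₀) hya (g₁ ≫ g₂)
      (by
        simp only [Category.assoc, h1, hy, g₁, g₂, Stage.comp_map, Stage.homMk_map]
        exact (Category.id_comp _).symm) (by
      have h3 : r₀ ≫ k₀ ≫ J.Cov.arrow = (γ ≫ f₀).arr := h2
      rw [Category.assoc, h3, Stage.comp_arr, Stage.comp_arr, C.comp_mul]
      simp only [g₁, g₂, hg, f₀, Stage.homMk_map, Stage.homMk_arr, Category.assoc]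
      congr 1
      exact (Category.id_comp _).symm)
    rw [← this, hσr (V := V) (y ≫ r₀) hya (by
      rw [Category.assoc, hε₀]; exact hya)]
    simp only [Category.assoc]
  have hta : t ≫ X₁.a = X.a := by
    simp only [X₁]
    rw [reassoc_of% ht, reassoc_of% ht₀, hu']
  refine ⟨t, hta, hF.site_ext (Y := W) (f := fW) hu' (IsPullback.of_hasPullback _ _) rfl ?_⟩
  obtain ⟨w, hw, hw'⟩ : ∃ w : W.T ⟶ P.T, w ≫ pullback.fst n p₀ =
      pullback.fst u' J.Cov.proj ≫ t ∧ w ≫ pullback.snd n p₀ = l :=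
    ⟨pullback.lift _ l (by rw [Category.assoc, ht, hl]), pullback.lift_fst _ _ _,
      pullback.lift_snd _ _ _⟩
  have hwa : w ≫ P.a = W.a := by
    simp only [P, W]
    rw [reassoc_of% hw', reassoc_of% hl']
  have e₂ : fW ≫ Stage.vert t hta = Stage.vert w hwa ≫ f := by
    ext
    · simp [fW, f, hw]
    · simp [fW, f, reassoc_of% hw', reassoc_of% hl']
  rw [Stage.map_op_map_op, e₂, ← Stage.map_op_map_op, hζ, Stage.map_op_map_op,
    Stage.vert_comp_vert]
  have hla : l ≫ SP.a = W.a := by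
    simp only [SP, W]
    rw [reassoc_of% hl']
  have := hzr (V := W) l hla fW hl (by simp [fW, reassoc_of% hl'])
  rw [← this]
  simp only [hw']

end ClosureRepresentable

/-! ### Representability of the generated subsheaf -/

section ClosureRepresentable

variable {E : Type u} [Category.{v} E] [PositiveHeytingCategory E] {S : MorphismProperty E}
  {C : InternalCategory E} {J : Topology S C} {F : (Stage C)ᵒᵖ ⥤ Type w}

/-- The closure of a representable subfunctor of a sheaf is representable: it is the quotient of
the object of matching families by the relation of agreeing on the common arrows of the two
covering sieves, which is given by a small mono. -/
lemma Topology.IsStageSheaf.exists_subRepresents_closure (hS : IsPredicative S) (hcod : S C.cod)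
    (hF : J.IsStageSheaf F) {A : Subfunctor F} {Q : Stage C} {ξ : F.obj (op Q)}
    (hA : SubRepresents A Q ξ) : ∃ Q' ξ', SubRepresents (J.closure A) Q' ξ' := by
  have hS' := hS.toIsClassOfSmallMaps
  obtain ⟨M, P, u, f, k, ε, hε, ζ, hu, hP, hk, hζ, huniv⟩ := hF.exists_matching hS hA
  have small_f : S f.map := hS'.of_isPullback hP.flip J.Cov.small_proj
  have hval : ∀ {V X : Stage C} (r : V.T ⟶ P.T) (hr : r ≫ ε ≫ Q.a = V.a) (x : X.T ⟶ M.T)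
      (hx : x ≫ M.a = X.a) (g : V ⟶ X), g.map ≫ x = r ≫ f.map → g.arr = r ≫ f.arr →
      F.map g.op (F.map (Stage.vert x hx).op ζ) =
        F.map (Stage.vert (r ≫ ε) (by rw [Category.assoc, hr])).op ξ := by
    intro V X r hr x hx g h h'
    have hr' : r ≫ P.a = V.a := by rw [← hε, hr]
    have e : g ≫ Stage.vert x hx = Stage.vert r hr' ≫ f := by
      ext
      · simpa using h
      · simpa using h'
    rw [Stage.map_op_map_op, e, ← Stage.map_op_map_op, hζ, Stage.map_op_map_op,
      Stage.vert_comp_vert]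
  -- The object of pairs of matching families with a common arrow of their covering sieves.
  let π₁ := pullback.fst M.a M.a
  let π₂ := pullback.snd M.a M.a
  have hπ : π₁ ≫ M.a = π₂ ≫ M.a := pullback.condition
  let W₀ := pullback (pullback.fst π₁ f.map) (pullback.fst π₂ f.map)
  let a₁ : W₀ ⟶ P.T := pullback.fst _ _ ≫ pullback.snd π₁ f.map
  let a₂ : W₀ ⟶ P.T := pullback.snd _ _ ≫ pullback.snd π₂ f.map
  let φ₀ : W₀ ⟶ pullback M.a M.a := pullback.fst _ _ ≫ pullback.fst π₁ f.map
  have small_φ₀ : S φ₀ :=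
    hS'.comp _ _ (hS'.pullback_fst (hS'.pullback_fst small_f _) _) (hS'.pullback_fst small_f _)
  have ha₁ : a₁ ≫ f.map = φ₀ ≫ π₁ := by
    simp only [a₁, φ₀, Category.assoc, ← pullback.condition (f := π₁) (g := f.map)]
  have ha₂ : a₂ ≫ f.map = φ₀ ≫ π₂ := by
    simp only [a₂, φ₀, Category.assoc, ← pullback.condition]
    rw [pullback.condition_assoc]
  have hW₀ : ∀ {V : E} (t : V ⟶ pullback M.a M.a) (r₁ r₂ : V ⟶ P.T), r₁ ≫ f.map = t ≫ π₁ →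
      r₂ ≫ f.map = t ≫ π₂ → ∃ y : V ⟶ W₀, y ≫ φ₀ = t ∧ y ≫ a₁ = r₁ ∧ y ≫ a₂ = r₂ := by
    intro V t r₁ r₂ h₁ h₂
    exact ⟨pullback.lift (pullback.lift t r₁ h₁.symm) (pullback.lift t r₂ h₂.symm) (by simp),
      by simp [φ₀], by simp [a₁], by simp [a₂]⟩
  clear_value a₁ a₂ φ₀
  let w := equalizer.ι (a₁ ≫ f.arr) (a₂ ≫ f.arr)
  have hw : w ≫ a₁ ≫ f.arr = w ≫ a₂ ≫ f.arr := equalizer.condition _ _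
  let m := equalizer.ι (w ≫ a₁ ≫ ε) (w ≫ a₂ ≫ ε)
  have hm : m ≫ w ≫ a₁ ≫ ε = m ≫ w ≫ a₂ ≫ ε := equalizer.condition _ _
  obtain ⟨N, n, hn, hN, small_n⟩ := exists_forall (w ≫ φ₀) m
  refine hF.exists_subRepresents hS (hF.isLocal (hF.closure hS' hcod (hA.isLocal hF))).cover
    (V := M) (ζ := ζ) ?_ ?_ n
    (small_n S hS' (hS'.comp _ _ (hS'.equalizer_ι _ _) small_φ₀) (hS'.equalizer_ι _ _)) ?_
  · refine ⟨M.T, 𝟙 _, u, .of_isIso _, by simp [hu], fun V s g l h hg hg' => ?_⟩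
    obtain ⟨r, hr, hr'⟩ : ∃ r : V.T ⟶ P.T, r ≫ f.map = s ∧ r ≫ k = l :=
      ⟨hP.lift s l h, hP.lift_fst _ _ _, hP.lift_snd _ _ _⟩
    have hra : r ≫ ε ≫ Q.a = V.a := by
      rw [hε, ← f.arr_dom, ← hk, Category.assoc, reassoc_of% hr', ← Category.assoc, ← hg',
        g.arr_dom]
    have := hval r hra (𝟙 _) (Category.id_comp _) g (by
      rw [hg, hr, Category.comp_id]; exact Category.comp_id _)
      (by rw [hg', ← hr', Category.assoc, hk])
    rw [Stage.vert_id, op_id, Functor.map_id_apply] at this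
    rw [this]
    exact A.map _ hA.mem
  · rintro X z ⟨T, c, u', hc, hu', H⟩
    obtain ⟨t, ht, e⟩ := huniv (X := ⟨T, c ≫ X.a⟩) u'
      (F.map (Stage.vert (X := ⟨T, c ≫ X.a⟩) c rfl).op z) hu' (by
        intro V s g l h hg hg'
        rw [Stage.map_op_map_op]
        refine H s _ l h ?_ (by simpa using hg')
        have hg : g.map = s := by simpa using hg
        simp [hg])
    exact ⟨⟨T, c ≫ X.a⟩, c, rfl, t, ht, hc, e.symm⟩
  · intro T t
    have hpa : (t ≫ π₁) ≫ M.a = (t ≫ π₂) ≫ M.a := by simp [hπ]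
    let X : Stage C := ⟨T, (t ≫ π₂) ≫ M.a⟩
    rw [hN]
    constructor
    · intro H
      have H' : ∀ {V : E} (s : V ⟶ T) (r₁ r₂ : V ⟶ P.T), r₁ ≫ f.map = s ≫ t ≫ π₁ →
          r₂ ≫ f.map = s ≫ t ≫ π₂ → r₁ ≫ f.arr = r₂ ≫ f.arr → r₁ ≫ ε = r₂ ≫ ε := by
        intro V s r₁ r₂ h₁ h₂ h
        obtain ⟨y, hy, rfl, rfl⟩ := hW₀ (s ≫ t) r₁ r₂ (by simp [h₁]) (by simp [h₂])
        obtain ⟨l, hl⟩ := H s (equalizer.lift y (by simpa using h)) (by simp [w, hy])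
        have := congr(l ≫ $hm)
        rw [reassoc_of% hl, reassoc_of% hl] at this
        simpa [w] using this
      refine (identifies_iff (X := X) hpa rfl).2 ?_
      -- It suffices to compare the restrictions along the arrows `f₁` of the first sieve, and then
      -- along the arrows `f₂` of the pullback of the second sieve along `f₁`.
      have hu₁ : ((t ≫ π₁) ≫ u) ≫ J.Cov.base = X.a := by rw [Category.assoc, hu, hpa]
      have hu₂ : ((t ≫ π₂) ≫ u) ≫ J.Cov.base = X.a := by rw [Category.assoc, hu]
      let k₁ := pullback.snd ((t ≫ π₁) ≫ u) J.Cov.proj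
      have hk₁ : pullback.fst _ _ ≫ (t ≫ π₁) ≫ u = k₁ ≫ J.Cov.proj := pullback.condition
      let Y₁ : Stage C := ⟨pullback ((t ≫ π₁) ≫ u) J.Cov.proj, k₁ ≫ J.Cov.arrow ≫ C.dom⟩
      let f₁ : Y₁ ⟶ X := Stage.homMk (X := Y₁) (Y := X) (pullback.fst _ _) (k₁ ≫ J.Cov.arrow)
        (by rw [Category.assoc, SieveClass.arrow_cod, ← reassoc_of% hk₁, ← hu₁]; simp)
        (by simp [Y₁])
      refine hF.site_ext (Y := Y₁) (f := f₁) hu₁ (IsPullback.of_hasPullback _ _) rfl ?_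
      obtain ⟨v, hv, Hv⟩ := J.exists_pullback ((t ≫ π₂) ≫ u) hu₂ f₁.map f₁.arr f₁.arr_cod.symm
      let k₂ := pullback.snd v J.Cov.proj
      have hk₂ : pullback.fst v J.Cov.proj ≫ v = k₂ ≫ J.Cov.proj := pullback.condition
      let Y₂ : Stage C := ⟨pullback v J.Cov.proj, k₂ ≫ J.Cov.arrow ≫ C.dom⟩
      let f₂ : Y₂ ⟶ Y₁ := Stage.homMk (X := Y₂) (Y := Y₁) (pullback.fst _ _) (k₂ ≫ J.Cov.arrow)
        (by rw [Category.assoc, SieveClass.arrow_cod, ← reassoc_of% hk₂, hv, f₁.arr_dom])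
        (by simp [Y₂])
      refine hF.site_ext (X := Y₁) (Y := Y₂) (f := f₂) (hv.trans f₁.arr_dom)
        (IsPullback.of_hasPullback _ _) rfl ?_
      rw [Stage.map_op_map_op _ f₂, Stage.map_op_map_op _ f₂]
      obtain ⟨l₁, hl₁, hl₁'⟩ := SieveClass.total_comp (k := f₂.map ≫ k₁) (g := f₂.arr)
        (by rw [f₂.arr_cod]; simp [Y₁])
      obtain ⟨l₂, hl₂, hl₂'⟩ := Hv k₂ f₂.map (by
        rw [Category.assoc, f₁.arr_dom]; exact f₂.arr_cod.symm) hk₂.symm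
      have hr₁ : (f₂.map ≫ f₁.map ≫ t ≫ π₁) ≫ u = l₁ ≫ J.Cov.proj := by
        have hk₁' : f₁.map ≫ (t ≫ π₁) ≫ u = k₁ ≫ J.Cov.proj := hk₁
        rw [hl₁]
        simp only [Category.assoc] at hk₁' ⊢
        exact congr(f₂.map ≫ $hk₁')
      have hr₂ : (f₂.map ≫ f₁.map ≫ t ≫ π₂) ≫ u = l₂ ≫ J.Cov.proj := by
        rw [hl₂]; simp
      obtain ⟨r₁, hr₁, hr₁'⟩ : ∃ r₁ : Y₂.T ⟶ P.T, r₁ ≫ f.map = f₂.map ≫ f₁.map ≫ t ≫ π₁ ∧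
          r₁ ≫ f.arr = (f₂ ≫ f₁).arr := ⟨hP.lift _ l₁ hr₁, hP.lift_fst _ _ _, by
            rw [← hk, hP.lift_snd_assoc, hl₁', Stage.comp_arr]
            simp only [Category.assoc]
            rfl⟩
      obtain ⟨r₂, hr₂, hr₂'⟩ : ∃ r₂ : Y₂.T ⟶ P.T, r₂ ≫ f.map = f₂.map ≫ f₁.map ≫ t ≫ π₂ ∧
          r₂ ≫ f.arr = (f₂ ≫ f₁).arr := ⟨hP.lift _ l₂ hr₂, hP.lift_fst _ _ _, by
            rw [← hk, hP.lift_snd_assoc, hl₂', Stage.comp_arr]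
            rfl⟩
      have hdom : ∀ {r : Y₂.T ⟶ P.T}, r ≫ f.arr = (f₂ ≫ f₁).arr → r ≫ ε ≫ Q.a = Y₂.a := by
        intro r h
        rw [hε, ← f.arr_dom, reassoc_of% h, Stage.Hom.arr_dom]
      rw [hval r₁ (hdom hr₁') (t ≫ π₁) hpa (f₂ ≫ f₁) (by simp [hr₁]) hr₁'.symm,
        hval r₂ (hdom hr₂') (t ≫ π₂) rfl (f₂ ≫ f₁) (by simp [hr₂]) hr₂'.symm]
      have := H' (f₂.map ≫ f₁.map) r₁ r₂ (by simp [hr₁]) (by simp [hr₂]) (hr₁'.trans hr₂'.symm)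
      simp only [this]
    · intro H T' s y hy
      have H := (identifies_iff (X := X) hpa rfl).1 H
      suffices h : y ≫ w ≫ a₁ ≫ ε = y ≫ w ≫ a₂ ≫ ε from
        ⟨equalizer.lift y h, equalizer.lift_ι _ _⟩
      let r₁ := y ≫ w ≫ a₁
      let r₂ := y ≫ w ≫ a₂
      have hr : r₁ ≫ f.arr = r₂ ≫ f.arr := by simp [r₁, r₂, hw]
      have hr₁ : r₁ ≫ f.map = s ≫ t ≫ π₁ := by
        simp only [r₁, Category.assoc, ha₁]
        simpa using congr($hy ≫ π₁)
      have hr₂ : r₂ ≫ f.map = s ≫ t ≫ π₂ := by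
        simp only [r₂, Category.assoc, ha₂]
        simpa using congr($hy ≫ π₂)
      let V : Stage C := ⟨T', r₁ ≫ f.arr ≫ C.dom⟩
      have h₁ : r₁ ≫ ε ≫ Q.a = V.a := by rw [hε, ← f.arr_dom]
      have h₂ : r₂ ≫ ε ≫ Q.a = V.a := by
        rw [hε, ← f.arr_dom, ← reassoc_of% hr]
      let g : V ⟶ X := Stage.homMk (X := V) (Y := X) s (r₂ ≫ f.arr)
        (by rw [Category.assoc, f.arr_cod, reassoc_of% hr₂]; simp [X])
        (by rw [← hr]; simp [V])
      have e₁ := hval (V := V) (X := X) r₁ h₁ (t ≫ π₁) hpa g (by simp [g, hr₁]) (by simp [g, hr])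
      have e₂ := hval (V := V) (X := X) r₂ h₂ (t ≫ π₂) rfl g (by simp [g, hr₂]) (by simp [g])
      have := hA.unique (X := V) _ _ _ _ (e₁.symm.trans (congr(F.map g.op $H).trans e₂))
      simpa [r₁, r₂] using this

end ClosureRepresentable

/-! ### The topos of sheaves on stages -/

section Topos

variable {E : Type u} [Category.{v} E] [PositiveHeytingCategory E] {S : MorphismProperty E}
  {C : InternalCategory E} (J : Topology S C)

/-- The topos of external sheaves on the category of stages. -/
abbrev SheafTopos := Sheaf J.coverage.toGrothendieck (Type (max u v))

-- Shortcuts for instance search, which is slow on categories of sheaves.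
instance : HasSheafify J.coverage.toGrothendieck (Type (max u v)) := inferInstance
instance : FinitaryExtensive (SheafTopos J) := inferInstance
instance : Balanced (SheafTopos J) := inferInstance
instance : HasFiniteLimits (SheafTopos J) := inferInstance
instance : HasFiniteColimits (SheafTopos J) := inferInstance

variable {J} in
lemma SheafTopos.isStageSheaf (G : SheafTopos J) : J.IsStageSheaf G.obj :=
  (isSheaf_iff_isSheaf_of_type _ _).1 G.property

/-- Internal sheaves, as external sheaves on the category of stages. -/
def toTopos : Sheaves J ⥤ SheafTopos J :=
  ObjectProperty.lift _ (ObjectProperty.ι _ ⋙ Presheaf.elems) fun P =>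
    (isSheaf_iff_isSheaf_of_type _ _).2 (Presheaf.IsSheaf.isStageSheaf P.property)

instance : (toTopos J).Full :=
  have : (Presheaf.elems (C := C)).Full := Presheaf.fullyFaithfulElems.full
  inferInstanceAs (ObjectProperty.lift _ (ObjectProperty.ι _ ⋙ Presheaf.elems) _).Full

instance : (toTopos J).Faithful :=
  have : (Presheaf.elems (C := C)).Faithful := Presheaf.fullyFaithfulElems.faithful
  inferInstanceAs (ObjectProperty.lift _ (ObjectProperty.ι _ ⋙ Presheaf.elems) _).Faithful

variable {J}

lemma isRep_toTopos (P : Sheaves J) : IsRep ((toTopos J).obj P).obj :=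
  ⟨_, _, represents_elems P.obj⟩

/-- A sheaf on stages comes from an internal sheaf as soon as it is representable over `C₀`. -/
lemma exists_iso_toTopos (G : SheafTopos J) (hG : IsRep G.obj) :
    ∃ P : Sheaves J, Nonempty ((toTopos J).obj P ≅ G) := by
  obtain ⟨Z, ξ, h⟩ := hG
  exact ⟨⟨h.presheaf, Presheaf.IsSheaf.of_isStageSheaf
    (Presieve.isSheaf_iso _ h.elemsIso.symm G.isStageSheaf)⟩,
    ⟨ObjectProperty.isoMk _ h.elemsIso⟩⟩

/-- A map from a represented presheaf, on elements. -/
lemma Represents.app_eq {F : (Stage C)ᵒᵖ ⥤ Type w} {Z : Stage C} {ξ : F.obj (op Z)}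
    (hF : Represents F Z ξ) {G : (Stage C)ᵒᵖ ⥤ Type w} (f : F ⟶ G) {X : Stage C}
    (z : F.obj (op X)) : f.app _ z =
      G.map (Stage.vert (hF.classify z) (hF.classify_a z)).op (f.app _ ξ) := by
  conv_lhs => rw [← hF.map_classify z, NatTrans.naturality_apply]

lemma IsRep.of_iso {F G : (Stage C)ᵒᵖ ⥤ Type w} (i : F ≅ G) (h : IsRep F) : IsRep G := by
  obtain ⟨Z, ξ, h⟩ := h
  refine ⟨Z, i.hom.app _ ξ, fun X z => ?_⟩
  obtain ⟨q, ⟨hq, e⟩, huniq⟩ := h (i.inv.app _ z)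
  have key : ∀ (y : F.obj (op X)), i.hom.app _ y = z ↔ y = i.inv.app _ z := fun y =>
    ⟨fun h => by rw [← h]; simp, fun h => by rw [h]; simp⟩
  refine ⟨q, ⟨hq, ?_⟩, ?_⟩
  · rw [← NatTrans.naturality_apply, key, e]
  · rintro q' ⟨hq', e'⟩
    rw [← NatTrans.naturality_apply, key] at e'
    exact huniq q' ⟨hq', e'⟩

/-- Sections of a pullback of sheaves. -/
lemma SheafTopos.isPullback_app {P F G H : SheafTopos J} {p : P ⟶ F} {q : P ⟶ G} {f : F ⟶ H}
    {g : G ⟶ H} (h : IsPullback p q f g) (X : Stage C) :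
    IsPullback (p.hom.app (op X)) (q.hom.app (op X)) (f.hom.app (op X)) (g.hom.app (op X)) :=
  h.map (sheafToPresheaf _ _ ⋙ (evaluation _ _).obj (op X))

lemma IsRep.of_isPullback {P F G H : SheafTopos J} {p : P ⟶ F} {q : P ⟶ G} {f : F ⟶ H}
    {g : G ⟶ H} (h : IsPullback p q f g) (hF : IsRep F.obj) (hG : IsRep G.obj) (hH : IsRep H.obj) :
    IsRep P.obj := by
  obtain ⟨Z₁, ξ₁, h₁⟩ := hF
  obtain ⟨Z₂, ξ₂, h₂⟩ := hG
  obtain ⟨Z, ξ, hZ⟩ := hH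
  let φ : Z₁.T ⟶ Z.T := hZ.classify (f.hom.app _ ξ₁)
  let ψ : Z₂.T ⟶ Z.T := hZ.classify (g.hom.app _ ξ₂)
  have hφ : φ ≫ Z.a = Z₁.a := hZ.classify_a _
  have hψ : ψ ≫ Z.a = Z₂.a := hZ.classify_a _
  have key : ∀ {X : Stage C} (x : X.T ⟶ Z₁.T) (y : X.T ⟶ Z₂.T) (hx : x ≫ Z₁.a = X.a)
      (hy : y ≫ Z₂.a = X.a), f.hom.app _ (F.obj.map (Stage.vert x hx).op ξ₁) =
        g.hom.app _ (G.obj.map (Stage.vert y hy).op ξ₂) ↔ x ≫ φ = y ≫ ψ := by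
    intro X x y hx hy
    rw [NatTrans.naturality_apply, NatTrans.naturality_apply, hZ.comp_classify x hx,
      hZ.comp_classify y hy]
    exact ⟨fun h => by rw [h], hZ.classify_injective⟩
  let W : Stage C := ⟨pullback φ ψ, pullback.fst φ ψ ≫ Z₁.a⟩
  have hW : pullback.snd φ ψ ≫ Z₂.a = W.a := by simp [W, ← hφ, ← hψ, pullback.condition_assoc]
  obtain ⟨ω, hω₁, hω₂⟩ := Types.exists_of_isPullback (SheafTopos.isPullback_app h W) _ _
    ((key (X := W) (pullback.fst φ ψ) (pullback.snd φ ψ) rfl hW).2 pullback.condition)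
  have res : ∀ {X : Stage C} (t : X.T ⟶ W.T) (ht : t ≫ W.a = X.a),
      p.hom.app _ (P.obj.map (Stage.vert t ht).op ω) =
        F.obj.map (Stage.vert (t ≫ pullback.fst φ ψ) (by simpa [W] using ht)).op ξ₁ ∧
      q.hom.app _ (P.obj.map (Stage.vert t ht).op ω) =
        G.obj.map (Stage.vert (t ≫ pullback.snd φ ψ) (by rw [Category.assoc, hW, ht])).op ξ₂ := by
    intro X t ht
    rw [NatTrans.naturality_apply, NatTrans.naturality_apply, hω₁, hω₂, Stage.map_op_map_op,
      Stage.map_op_map_op, Stage.vert_comp_vert, Stage.vert_comp_vert]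
    exact ⟨rfl, rfl⟩
  refine ⟨W, ω, fun X z => ?_⟩
  have h₁z := h₁.map_classify (p.hom.app _ z)
  have h₂z := h₂.map_classify (q.hom.app _ z)
  obtain ⟨t, ht₁, ht₂⟩ : ∃ t : X.T ⟶ W.T, t ≫ pullback.fst φ ψ = h₁.classify (p.hom.app _ z) ∧
      t ≫ pullback.snd φ ψ = h₂.classify (q.hom.app _ z) :=
    ⟨pullback.lift _ _ ((key _ _ (h₁.classify_a _) (h₂.classify_a _)).1 (by
      rw [h₁z, h₂z]
      exact ConcreteCategory.congr_hom (SheafTopos.isPullback_app h X).w z)),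
      pullback.lift_fst _ _ _, pullback.lift_snd _ _ _⟩
  have hta : t ≫ W.a = X.a := by simp only [W, reassoc_of% ht₁, h₁.classify_a]
  refine ⟨t, ⟨hta, Types.ext_of_isPullback (SheafTopos.isPullback_app h X) ?_ ?_⟩, ?_⟩
  · refine (res t hta).1.trans (Eq.trans ?_ h₁z)
    simp only [ht₁]
  · refine (res t hta).2.trans (Eq.trans ?_ h₂z)
    simp only [ht₂]
  · rintro t' ⟨ht', rfl⟩
    refine pullback.hom_ext ?_ ?_
    · exact ht₁.trans (h₁.eq_classify _ _ (res t' ht').1.symm).symm |>.symm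
    · exact ht₂.trans (h₂.eq_classify _ _ (res t' ht').2.symm).symm |>.symm

lemma isRep_of_unique {F : (Stage C)ᵒᵖ ⥤ Type w} (h : ∀ X, Nonempty (Unique (F.obj X))) :
    IsRep F := by
  have h' := fun X => (h X).some
  refine ⟨⟨C.C₀, 𝟙 _⟩, (h' _).default, fun X z => ⟨X.a, ⟨by simp, ?_⟩, ?_⟩⟩
  · exact ((h' _).uniq _).trans ((h' _).uniq _).symm
  · rintro q ⟨hq, -⟩
    simpa using hq

lemma SheafTopos.unique_of_isTerminal {F : SheafTopos J} (h : IsTerminal F) (X : Stage C) :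
    Nonempty (Unique (F.obj.obj (op X))) := by
  have := IsTerminal.isTerminalObj (sheafToPresheaf _ _ ⋙ (evaluation _ _).obj (op X)) _ h
  exact ⟨(Types.isTerminalEquivUnique _).1 this⟩

end Topos

/-! ### Images and the initial sheaf -/

section Images

variable {E : Type u} [Category.{v} E] [PositiveHeytingCategory E] {S : MorphismProperty E}
  {C : InternalCategory E} {J : Topology S C}

section

variable {F : (Stage C)ᵒᵖ ⥤ Type w} {V : Stage C} {ζ : F.obj (op V)}

lemma LocallyRestricts.of_eq {X : Stage C} {z : F.obj (op X)} (t : X.T ⟶ V.T)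
    (ht : t ≫ V.a = X.a) (h : z = F.map (Stage.vert t ht).op ζ) : LocallyRestricts ζ z :=
  ⟨X, 𝟙 _, Category.id_comp _, t, ht, .of_isIso _, by rw [Stage.vert_id]; simpa using h⟩

lemma LocallyRestricts.of_cover {X Y : Stage C} {c : Y.T ⟶ X.T} (hc : IsCover c)
    (h : c ≫ X.a = Y.a) {z : F.obj (op X)}
    (hz : LocallyRestricts ζ (F.map (Stage.vert c h).op z)) : LocallyRestricts ζ z := by
  obtain ⟨Y', d, h', t, ht, hd, e⟩ := hz
  refine ⟨Y', d ≫ c, by rw [Category.assoc, h, h'], t, ht, hd.comp hc, ?_⟩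
  rw [← e, Stage.map_op_map_op, Stage.vert_comp_vert]

/-- The subfunctor of the elements which are locally vertical restrictions of `ζ`, provided that
all restrictions of `ζ` are. -/
def localImage (ζ : F.obj (op V))
    (h : ∀ ⦃W : Stage C⦄ (g : W ⟶ V), LocallyRestricts ζ (F.map g.op ζ)) : Subfunctor F where
  obj X := {z | LocallyRestricts (X := X.unop) ζ z}
  map := by
    rintro ⟨X⟩ ⟨Y⟩ ⟨f⟩ z ⟨X', c, hc', t, ht, hc, e⟩
    let Y' : Stage C := ⟨pullback c f.map, pullback.snd c f.map ≫ Y.a⟩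
    let g : Y' ⟶ X' := Stage.homMk (X := Y') (pullback.fst c f.map) (pullback.snd c f.map ≫ f.arr)
      (by
        rw [Category.assoc, f.arr_cod, ← hc']
        exact (pullback.condition_assoc _).symm) (by simp [Y', f.arr_dom])
    refine LocallyRestricts.of_cover (Y := Y') (hc.pullback_snd f.map) rfl ?_
    have e' : Stage.vert (X := Y') (Y := Y) (pullback.snd c f.map) rfl ≫ f =
        g ≫ Stage.vert c hc' := by
      ext
      · exact pullback.condition.symm
      · simp [g]
    have : F.map (Stage.vert (X := Y') (Y := Y) (pullback.snd c f.map) rfl).op (F.map f.op z) =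
        F.map (g ≫ Stage.vert t ht).op ζ := by
      rw [Stage.map_op_map_op, e', ← Stage.map_op_map_op]
      exact (congr_arg (F.map g.op) e).trans (Stage.map_op_map_op _ _ _ _)
    exact this ▸ h _

variable (hS : IsPredicative S) (hcod : S C.cod) (hF : J.IsStageSheaf F)
include hS hcod hF

/-- The sheaf generated by the vertical restrictions of `ζ` is representable over `C₀`, provided
that the relation of having equal restrictions of `ζ` is given by a small mono. -/
lemma isRep_sheafify_localImage
    (h : ∀ ⦃W : Stage C⦄ (g : W ⟶ V), LocallyRestricts ζ (F.map g.op ζ))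
    {N : E} (n : N ⟶ pullback V.a V.a) [Mono n] (hn : S n)
    (hker : ∀ ⦃T : E⦄ (t : T ⟶ pullback V.a V.a), (∃ k, k ≫ n = t) ↔
      Identifies ζ (t ≫ pullback.fst V.a V.a) (t ≫ pullback.snd V.a V.a)) :
    IsRep ((localImage ζ h).sheafify J.coverage.toGrothendieck).toFunctor := by
  obtain ⟨Q, ξ, hA⟩ := hF.exists_subRepresents hS (A := localImage ζ h)
    (fun X Y c h hc z hz => .of_cover hc h hz)
    (.of_eq (𝟙 _) (Category.id_comp _) (by rw [Stage.vert_id]; simp)) (fun X z hz => hz) n hn hker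
  rw [isRep_toFunctor_iff, hF.sheafify_eq_closure hS.toIsClassOfSmallMaps hcod (hA.isLocal hF)]
  exact hF.exists_subRepresents_closure hS hcod hA

end

/-- The image of a map between representable sheaves is representable. -/
lemma isRep_image (hS : IsPredicative S) (hcod : S C.cod) {F G : SheafTopos J} (f : F ⟶ G)
    (hF : IsRep F.obj) (hG : IsRep G.obj) : IsRep (Sheaf.image f).obj := by
  have hS' := hS.toIsClassOfSmallMaps
  obtain ⟨Z, ξ, hF⟩ := hF
  obtain ⟨Y, η, hG⟩ := hG
  let ζ := f.hom.app _ ξ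
  have h : ∀ {X : Stage C} (z : F.obj.obj (op X)), LocallyRestricts ζ (f.hom.app _ z) := fun z =>
    .of_eq _ _ (hF.app_eq f.hom z)
  have h' : ∀ ⦃W : Stage C⦄ (g : W ⟶ Z), LocallyRestricts ζ (G.obj.map g.op ζ) := by
    intro W g
    rw [← NatTrans.naturality_apply]
    exact h _
  have e : (Subfunctor.range f.hom).sheafify J.coverage.toGrothendieck =
      (localImage ζ h').sheafify J.coverage.toGrothendieck := by
    refine le_antisymm (Subfunctor.sheafify_le _ _ ?_ G.isStageSheaf
      (Subfunctor.sheafify_isSheaf _ G.isStageSheaf)) (Subfunctor.sheafify_le _ _ ?_ G.isStageSheaf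
      (Subfunctor.sheafify_isSheaf _ G.isStageSheaf))
    · refine le_trans ?_ (Subfunctor.le_sheafify _ _)
      rintro ⟨X⟩ _ ⟨z, rfl⟩
      exact h z
    · rintro ⟨X⟩ z ⟨X', c, hc', t, ht, hc, e⟩
      refine (G.isStageSheaf.isLocal (Subfunctor.sheafify_isSheaf _ G.isStageSheaf)).cover
        c hc' hc z ?_
      refine Subfunctor.le_sheafify _ _ _ ?_
      rw [e, ← NatTrans.naturality_apply]
      exact ⟨_, rfl⟩
  change IsRep ((Subfunctor.range f.hom).sheafify J.coverage.toGrothendieck).toFunctor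
  rw [e]
  let φ := hG.classify ζ
  have hφ : φ ≫ Y.a = Z.a := hG.classify_a _
  let n : pullback φ φ ⟶ pullback Z.a Z.a := pullback.lift (pullback.fst _ _) (pullback.snd _ _)
    (by rw [← hφ, pullback.condition_assoc])
  have : Mono n := ⟨fun x y h => by
    ext
    · simpa [n] using congr($h ≫ pullback.fst _ _)
    · simpa [n] using congr($h ≫ pullback.snd _ _)⟩
  refine isRep_sheafify_localImage hS hcod G.isStageSheaf h' n ?_ fun T t => ?_
  · refine hS'.of_comp n (prod.lift (pullback.fst _ _) (pullback.snd _ _)) ?_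
    have : n ≫ prod.lift (pullback.fst _ _) (pullback.snd _ _) =
        prod.lift (pullback.fst φ φ) (pullback.snd φ φ) := by ext <;> simp [n]
    rw [this]
    exact hS'.lift_pullback φ φ
  · let X : Stage C := ⟨T, (t ≫ pullback.snd _ _) ≫ Z.a⟩
    have hx : (t ≫ pullback.fst Z.a Z.a) ≫ Z.a = X.a := by simp [X, pullback.condition]
    have hy : (t ≫ pullback.snd Z.a Z.a) ≫ Z.a = X.a := rfl
    rw [identifies_iff (X := X) hx hy]
    have key : G.obj.map (Stage.vert (X := X) _ hx).op ζ =
        G.obj.map (Stage.vert (X := X) _ hy).op ζ ↔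
        (t ≫ pullback.fst Z.a Z.a) ≫ φ = (t ≫ pullback.snd Z.a Z.a) ≫ φ := by
      rw [hG.comp_classify (X := X) _ hx, hG.comp_classify (X := X) _ hy]
      exact ⟨fun h => by rw [h], hG.classify_injective⟩
    rw [key]
    constructor
    · rintro ⟨k, rfl⟩
      simp [n, pullback.condition]
    · exact fun h => ⟨pullback.lift _ _ h, by ext <;> simp [n]⟩

end Images

section EmptyCovers

variable {E : Type u} [Category.{v} E] [PositiveHeytingCategory E] {S : MorphismProperty E}
  {C : InternalCategory E} {J : Topology S C}

/-- The empty sieve. -/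
def InternalCategory.emptySieve {T : E} (a : T ⟶ C.C₀) : Subobject (C.arrowsInto a) :=
  have := isEmptyObj_initial.mono (initial.to (C.arrowsInto a))
  Subobject.mk (initial.to (C.arrowsInto a))

open InternalCategory

lemma InternalCategory.mem_emptySieve {T T' : E} {a : T ⟶ C.C₀} {t : T' ⟶ T} {f : T' ⟶ C.C₁}
    {h : t ≫ a = f ≫ C.cod} : C.Mem (emptySieve a) t f h ↔ IsEmptyObj T' := by
  have := isEmptyObj_initial.mono (initial.to (C.arrowsInto a))
  rw [Mem, emptySieve, Subobject.mk_factors_iff]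
  change (∃ k : T' ⟶ ⊥_ E, k ≫ initial.to (C.arrowsInto a) = _) ↔ _
  exact ⟨fun ⟨k, _⟩ => isEmptyObj_initial.of_hom k, fun h => ⟨h.some.to _, h.hom_ext _ _⟩⟩

lemma InternalCategory.isSieve_emptySieve (hS : IsClassOfSmallMaps S) {T : E} (a : T ⟶ C.C₀) :
    C.IsSieve S a (emptySieve a) := by
  refine ⟨?_, fun T' t f g h h' hm => mem_emptySieve.2 (mem_emptySieve.1 hm)⟩
  have := isEmptyObj_initial.mono (initial.to (C.arrowsInto a))
  exact hS.of_isEmptyObj (isEmptyObj_initial.of_hom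
    (Subobject.underlyingIso (initial.to (C.arrowsInto a))).hom) _ _

namespace Topology

variable (J) in
/-- The empty sieve covers the object `a`. -/
def IsDegenerate {T : E} (a : T ⟶ C.C₀) : Prop := J.Cov.Contains a (emptySieve a)

lemma IsDegenerate.restrict {T T' : E} {a : T ⟶ C.C₀} (h : J.IsDegenerate a) (t : T' ⟶ T)
    (f : T' ⟶ C.C₁) (e : t ≫ a = f ≫ C.cod) : J.IsDegenerate (f ≫ C.dom) := by
  have := J.stability a _ h t f e
  have e' : C.sievePullback (emptySieve a) t f e = emptySieve (f ≫ C.dom) := by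
    refine le_antisymm (le_of_mem fun T'' s g e h => ?_) (le_of_mem fun T'' s g e h => ?_)
    · rw [mem_sievePullback] at h
      exact mem_emptySieve.2 (mem_emptySieve.1 h)
    · rw [mem_sievePullback]
      exact mem_emptySieve.2 (mem_emptySieve.1 h)
  rwa [e'] at this

/-- An object is degenerate if the domains of the arrows in a covering sieve are. -/
lemma IsDegenerate.of_site (hS : IsClassOfSmallMaps S) {X Y : Stage C} {u : X.T ⟶ J.Cov.index}
    (hu : u ≫ J.Cov.base = X.a) {f : Y ⟶ X} {k : Y.T ⟶ J.Cov.total}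
    (h : IsPullback f.map k u J.Cov.proj) (hk : k ≫ J.Cov.arrow = f.arr)
    (hY : J.IsDegenerate Y.a) : J.IsDegenerate X.a := by
  refine J.local_character X.a _ (C.reindex J.Cov.sieve u X.a hu) (isSieve_emptySieve hS _)
    ⟨u, hu, rfl⟩ fun {T} t g e hm => ?_
  rw [mem_reindex, ← SieveClass.exists_total_iff] at hm
  obtain ⟨l, hl, hl'⟩ := hm
  obtain ⟨y, hy, hy'⟩ : ∃ y : T ⟶ Y.T, y ≫ f.map = t ∧ y ≫ k = l :=
    ⟨h.lift t l hl.symm, h.lift_fst _ _ _, h.lift_snd _ _ _⟩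
  have hya : y ≫ Y.a = g ≫ C.dom := by
    rw [← f.arr_dom, ← hk, Category.assoc, reassoc_of% hy', reassoc_of% hl']
  have hg : J.IsDegenerate (g ≫ C.dom) := by
    have := hY.restrict y ((g ≫ C.dom) ≫ C.ident) (by simp [hya])
    rwa [show ((g ≫ C.dom) ≫ C.ident) ≫ C.dom = g ≫ C.dom by simp] at this
  have e' : C.sievePullback (emptySieve X.a) t g e = emptySieve (g ≫ C.dom) := by
    refine le_antisymm (le_of_mem fun T'' s g e h => ?_) (le_of_mem fun T'' s g e h => ?_)
    · rw [mem_sievePullback] at h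
      exact mem_emptySieve.2 (mem_emptySieve.1 h)
    · rw [mem_sievePullback]
      exact mem_emptySieve.2 (mem_emptySieve.1 h)
  rw [e']
  exact hg

/-- For a presentable topology, the subobject of degenerate objects exists and is small. -/
lemma IsPresentable.exists_degenerate (hS : IsClassOfSmallMaps S) (hJ : J.IsPresentable) :
    ∃ (D : E) (d : D ⟶ C.C₀), Mono d ∧ S d ∧
      ∀ ⦃T : E⦄ (a : T ⟶ C.C₀), (∃ k, k ≫ d = a) ↔ J.IsDegenerate a := by
  obtain ⟨B, hB, H⟩ := hJ
  have := isEmptyObj_initial.mono (initial.to B.total)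
  obtain ⟨N, n, hn, hN, small_n⟩ := exists_forall B.proj (initial.to B.total)
  obtain ⟨D, e, d, he, hd, hed⟩ := PositiveHeytingCategory.exists_factorisation (n ≫ B.base)
  refine ⟨D, d, hd, hS.quotients e d he (hed ▸ hS.comp _ _ (small_n S hS B.small_proj
    (hS.of_isEmptyObj isEmptyObj_initial _ _)) hB), fun T a => ?_⟩
  rw [IsDegenerate, H _ _ (isSieve_emptySieve hS a)]
  constructor
  · rintro ⟨k, rfl⟩
    have hu : (pullback.fst e k ≫ n) ≫ B.base = pullback.snd e k ≫ k ≫ d := by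
      rw [Category.assoc, ← hed, pullback.condition_assoc]
    refine ⟨pullback e k, pullback.snd e k, _, he.pullback_snd k,
      SieveClass.contains_reindex (pullback.fst e k ≫ n) _ hu, le_of_mem fun T' t f h hm => ?_⟩
    rw [mem_reindex, ← SieveClass.exists_total_iff] at hm
    obtain ⟨l, hl, -⟩ := hm
    obtain ⟨y, -⟩ := (hN n).1 ⟨𝟙 _, Category.id_comp _⟩ (t ≫ pullback.fst e k) l
      (by rw [hl, Category.assoc])
    rw [mem_reindex, mem_emptySieve]
    exact isEmptyObj_initial.of_hom y
  · rintro ⟨T', c, R, hc, ⟨u, hu, rfl⟩, hR⟩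
    obtain ⟨l, hl⟩ := (hN u).2 fun T'' s y hy => by
      have hm : C.Mem (C.reindex B.sieve u (c ≫ a) hu) s (y ≫ B.arrow)
          (by rw [Category.assoc, B.arrow_cod, reassoc_of% hy, hu]) := by
        rw [mem_reindex, ← SieveClass.exists_total_iff]
        exact ⟨y, hy, rfl⟩
      have := Mem.of_le hR hm
      rw [mem_reindex, mem_emptySieve] at this
      exact ⟨this.some.to _, this.hom_ext _ _⟩
    exact hc.exists_lift (m := d) ⟨l ≫ e, by rw [Category.assoc, hed, reassoc_of% hl, hu]⟩

namespace IsStageSheaf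

variable {F : (Stage C)ᵒᵖ ⥤ Type w} (hF : J.IsStageSheaf F)
include hF

lemma exists_of_isDegenerate {X : Stage C} (h : J.IsDegenerate X.a) :
    Nonempty (F.obj (op X)) ∧ ∀ z z' : F.obj (op X), z = z' := by
  obtain ⟨u, hu, e⟩ := h
  let k := pullback.snd u J.Cov.proj
  let Y : Stage C := ⟨pullback u J.Cov.proj, k ≫ J.Cov.arrow ≫ C.dom⟩
  have he : (pullback.fst u J.Cov.proj) ≫ X.a = (k ≫ J.Cov.arrow) ≫ C.cod := by
    rw [← hu, pullback.condition_assoc, Category.assoc, SieveClass.arrow_cod]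
  let f : Y ⟶ X := Stage.homMk (X := Y) (pullback.fst _ _) (k ≫ J.Cov.arrow) he.symm (by simp [Y])
  have hY : IsEmptyObj Y.T := by
    have : C.Mem (C.reindex J.Cov.sieve u X.a hu) (pullback.fst _ _) (k ≫ J.Cov.arrow) he := by
      rw [mem_reindex, ← SieveClass.exists_total_iff]
      exact ⟨k, pullback.condition.symm, rfl⟩
    rw [e] at this
    exact mem_emptySieve.1 this
  constructor
  · obtain ⟨z⟩ := hF.empty_exists hY
    obtain ⟨z', -⟩ := hF.site_glue (Y := Y) (f := f) hu (IsPullback.of_hasPullback _ _) rfl z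
      fun V p q _ => hF.empty_ext (hY.of_hom p.map) _ _
    exact ⟨z'⟩
  · exact fun z z' => hF.site_ext (Y := Y) (f := f) hu (IsPullback.of_hasPullback _ _) rfl
      (hF.empty_ext hY _ _)

end IsStageSheaf
end Topology

/-- The initial sheaf is the subterminal sheaf of degenerate objects, and it is representable. -/
lemma exists_isInitial (hS : IsClassOfSmallMaps S) (hJ : J.IsPresentable) :
    ∃ I : SheafTopos J, Nonempty (IsInitial I) ∧ IsRep I.obj ∧
      ∀ X : Stage C, I.obj.obj (op X) → J.IsDegenerate X.a := by
  obtain ⟨D, d, hd, -, H⟩ := hJ.exists_degenerate hS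
  let G : SheafTopos J := ⊤_ _
  have hG := fun X => (SheafTopos.unique_of_isTerminal (terminalIsTerminal : IsTerminal G) X).some
  let A : Subfunctor G.obj :=
    { obj X := {_z | J.IsDegenerate X.unop.a}
      map := by
        rintro ⟨X⟩ ⟨Y⟩ ⟨f⟩ z (hz : J.IsDegenerate X.a)
        have := hz.restrict f.map f.arr f.arr_cod.symm
        rw [f.arr_dom] at this
        exact this }
  have hA : J.IsStageSheaf A.toFunctor := by
    refine G.isStageSheaf.subfunctor A fun X R hR z hz => ?_
    change J.IsDegenerate X.a
    cases hR with
    | @cover Y c h hc =>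
      have : J.IsDegenerate Y.a := hz _ ⟨⟩
      rw [← H, ← h] at this
      rw [← H]
      exact hc.exists_lift this
    | @sum Y Z i j hi hj hij =>
      have h₁ : J.IsDegenerate Y.a := hz _ (Or.inl ⟨⟩)
      have h₂ : J.IsDegenerate Z.a := hz _ (Or.inr ⟨⟩)
      rw [← H, ← hi] at h₁
      rw [← H, ← hj] at h₂
      rw [← H]
      exact hij.exists_lift h₁ h₂
    | empty h => exact (H _).1 ⟨h.some.to _, h.hom_ext _ _⟩
    | @site Y u hu f k h hk => exact .of_site hS hu h hk (hz _ ⟨⟩)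
  let I : SheafTopos J := ⟨A.toFunctor, (isSheaf_iff_isSheaf_of_type _ _).2 hA⟩
  have hI : ∀ {X : Stage C}, I.obj.obj (op X) → J.IsDegenerate X.a := fun z => z.2
  refine ⟨I, ⟨IsInitial.ofUniqueHom (fun K => ⟨{
      app X := TypeCat.ofHom fun z => (K.isStageSheaf.exists_of_isDegenerate (hI z)).1.some
      naturality X Y f := by
        ext z
        exact (K.isStageSheaf.exists_of_isDegenerate (hI (I.obj.map f z))).2 _ _ }⟩)
    fun K m => ?_⟩, ⟨⟨D, d⟩, ⟨(hG _).default, (H d).1 ⟨𝟙 _, Category.id_comp _⟩⟩, fun X z => ?_⟩,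
    fun X => hI⟩
  · ext X z
    exact (K.isStageSheaf.exists_of_isDegenerate (hI z)).2 _ _
  · obtain ⟨q, hq⟩ := (H X.a).2 (hI z)
    refine ⟨q, ⟨hq, Subtype.ext (((hG X).uniq _).trans ((hG X).uniq _).symm)⟩, ?_⟩
    rintro q' ⟨hq', -⟩
    rw [← cancel_mono d]
    exact hq'.trans hq.symm

end EmptyCovers

/-! ### Sums of sheaves -/

section Sums

variable {E : Type u} [Category.{v} E] [PositiveHeytingCategory E] {S : MorphismProperty E}
  {C : InternalCategory E} {J : Topology S C}

variable (J) in
instance : HasFiniteCoproducts (SheafTopos J) := hasFiniteCoproducts_of_hasFiniteColimits _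

variable (J) in
instance : HasInitial (SheafTopos J) := hasColimitsOfShape_discrete _ PEmpty

variable (J) in
instance : HasBinaryCoproducts (SheafTopos J) := hasColimitsOfShape_discrete _ WalkingPair

lemma isSum_id_initial (T : E) : IsSum (𝟙 T) (initial.to T) :=
  .of_existsUnique fun W f g => ⟨f, ⟨Category.id_comp _, Subsingleton.elim _ _⟩,
    fun k hk => by simpa using hk.1⟩

lemma isSum_initial_id (T : E) : IsSum (initial.to T) (𝟙 T) :=
  .of_existsUnique fun W f g => ⟨g, ⟨Subsingleton.elim _ _, Category.id_comp _⟩,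
    fun k hk => by simpa using hk.2⟩

lemma SheafTopos.injective_of_mono {F G : SheafTopos J} (f : F ⟶ G) [Mono f] {X : Stage C}
    {z z' : F.obj.obj (op X)} (h : f.hom.app _ z = f.hom.app _ z') : z = z' := by
  have := (Sheaf.Hom.mono_iff_presheaf_mono _ _ f).1 inferInstance
  exact (mono_iff_injective _).1 ((NatTrans.mono_iff_mono_app f.hom).1 this (op X)) h

/-- A sheaf which contains two representable subsheaves, disjoint over nondegenerate objects, has a
representable subsheaf containing both: it is the quotient of the sum in `E` by the relation which,
over degenerate objects, identifies everything. -/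
lemma exists_isRep_of_disjoint (hS : IsPredicative S) (hcod : S C.cod) (hJ : J.IsPresentable)
    {F G H : (Stage C)ᵒᵖ ⥤ Type w} {ι₁ : F ⟶ H} {ι₂ : G ⟶ H} (hH : J.IsStageSheaf H)
    (inj₁ : ∀ {X : Stage C} {z z' : F.obj (op X)}, ι₁.app _ z = ι₁.app _ z' → z = z')
    (inj₂ : ∀ {X : Stage C} {z z' : G.obj (op X)}, ι₂.app _ z = ι₂.app _ z' → z = z')
    (hdisj : ∀ {X : Stage C} (z : F.obj (op X)) (z' : G.obj (op X)),
      ι₁.app _ z = ι₂.app _ z' → J.IsDegenerate X.a) (hF : IsRep F) (hG : IsRep G) :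
    ∃ A : Subfunctor H, J.IsStageSheaf A.toFunctor ∧ IsRep A.toFunctor ∧
      Subfunctor.range ι₁ ≤ A ∧ Subfunctor.range ι₂ ≤ A := by
  have hS' := hS.toIsClassOfSmallMaps
  obtain ⟨Z₁, ξ₁, h₁⟩ := hF
  obtain ⟨Z₂, ξ₂, h₂⟩ := hG
  obtain ⟨D, d, hd, small_d, hD⟩ := hJ.exists_degenerate hS'
  let V : Stage C := ⟨Z₁.T ⨿ Z₂.T, coprod.desc Z₁.a Z₂.a⟩
  have hi : coprod.inl ≫ V.a = Z₁.a := by simp [V]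
  have hj : coprod.inr ≫ V.a = Z₂.a := by simp [V]
  obtain ⟨ζ, hζ₁, hζ₂⟩ := hH.sum_glue (X := V) hi hj (isSum_coprod _ _) (ι₁.app _ ξ₁)
    (ι₂.app _ ξ₂)
  have res₁ : ∀ {W : Stage C} (q : W.T ⟶ Z₁.T) (g : W ⟶ Z₁) (g' : W ⟶ V), g.map = q →
      g'.map = q ≫ coprod.inl → g'.arr = g.arr →
      H.map g'.op ζ = ι₁.app _ (F.map g.op ξ₁) := by
    intro W q g g' h h' h''
    rw [NatTrans.naturality_apply, ← hζ₁, Stage.map_op_map_op]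
    refine Stage.map_op_congr _ ?_ ?_ ζ
    · simp [h, h']
    · simp [h'']
  have res₂ : ∀ {W : Stage C} (q : W.T ⟶ Z₂.T) (g : W ⟶ Z₂) (g' : W ⟶ V), g.map = q →
      g'.map = q ≫ coprod.inr → g'.arr = g.arr →
      H.map g'.op ζ = ι₂.app _ (G.map g.op ξ₂) := by
    intro W q g g' h h' h''
    rw [NatTrans.naturality_apply, ← hζ₂, Stage.map_op_map_op]
    refine Stage.map_op_congr _ ?_ ?_ ζ
    · simp [h, h']
    · simp [h'']
  have elt₁ : ∀ {X : Stage C} (z : F.obj (op X)), ∃ (t : X.T ⟶ V.T) (ht : t ≫ V.a = X.a),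
      ι₁.app _ z = H.map (Stage.vert t ht).op ζ := by
    intro X z
    refine ⟨h₁.classify z ≫ coprod.inl, by rw [Category.assoc, hi, h₁.classify_a], ?_⟩
    rw [res₁ (h₁.classify z) (Stage.vert _ (h₁.classify_a z)) _ rfl rfl rfl, h₁.map_classify]
  have elt₂ : ∀ {X : Stage C} (z : G.obj (op X)), ∃ (t : X.T ⟶ V.T) (ht : t ≫ V.a = X.a),
      ι₂.app _ z = H.map (Stage.vert t ht).op ζ := by
    intro X z
    refine ⟨h₂.classify z ≫ coprod.inr, by rw [Category.assoc, hj, h₂.classify_a], ?_⟩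
    rw [res₂ (h₂.classify z) (Stage.vert _ (h₂.classify_a z)) _ rfl rfl rfl, h₂.map_classify]
  -- Any map to the sum in `E` splits its source as a sum.
  have split : ∀ {T : E} (x : T ⟶ V.T), ∃ (T₁ T₂ : E) (i : T₁ ⟶ T) (j : T₂ ⟶ T)
      (x₁ : T₁ ⟶ Z₁.T) (x₂ : T₂ ⟶ Z₂.T), IsSum i j ∧ i ≫ x = x₁ ≫ coprod.inl ∧
        j ≫ x = x₂ ≫ coprod.inr := fun {T} x =>
    ⟨_, _, pullback.fst x coprod.inl, pullback.fst x coprod.inr, pullback.snd _ _,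
      pullback.snd _ _, (isSum_coprod _ _).of_isPullback (IsPullback.of_hasPullback _ _)
        (IsPullback.of_hasPullback _ _), pullback.condition, pullback.condition⟩
  have h : ∀ ⦃W : Stage C⦄ (g : W ⟶ V), LocallyRestricts ζ (H.map g.op ζ) := by
    intro W g
    obtain ⟨T₁, T₂, i, j, x₁, x₂, hs, e₁, e₂⟩ := split g.map
    let W₁ : Stage C := ⟨T₁, i ≫ W.a⟩
    let W₂ : Stage C := ⟨T₂, j ≫ W.a⟩
    have hc₁ : (i ≫ g.arr) ≫ C.cod = x₁ ≫ Z₁.a := by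
      rw [Category.assoc, g.arr_cod, reassoc_of% e₁, hi]
    have hc₂ : (j ≫ g.arr) ≫ C.cod = x₂ ≫ Z₂.a := by
      rw [Category.assoc, g.arr_cod, reassoc_of% e₂, hj]
    obtain ⟨t₁, ht₁, E₁⟩ := elt₁ (F.map (Stage.homMk (X := W₁) x₁ (i ≫ g.arr) hc₁
      (by simp [W₁, g.arr_dom])).op ξ₁)
    obtain ⟨t₂, ht₂, E₂⟩ := elt₂ (G.map (Stage.homMk (X := W₂) x₂ (j ≫ g.arr) hc₂
      (by simp [W₂, g.arr_dom])).op ξ₂)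
    obtain ⟨t, rfl, rfl⟩ := hs.exists_desc t₁ t₂
    refine .of_eq t (hs.hom_ext ?_ ?_) (hH.sum_ext (Y := W₁) (Z := W₂) (i := i) (j := j) rfl rfl hs
      ?_ ?_)
    · exact (Category.assoc _ _ _).symm.trans ht₁
    · exact (Category.assoc _ _ _).symm.trans ht₂
    · rw [Stage.map_op_map_op, Stage.map_op_map_op, Stage.vert_comp_vert, ← E₁]
      exact res₁ x₁ _ _ rfl (by simpa using e₁) (by simp)
    · rw [Stage.map_op_map_op, Stage.map_op_map_op, Stage.vert_comp_vert, ← E₂]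
      exact res₂ x₂ _ _ rfl (by simpa using e₂) (by simp)
  let π₁ := pullback.fst V.a V.a
  let π₂ := pullback.snd V.a V.a
  have hπ : π₁ ≫ V.a = π₂ ≫ V.a := pullback.condition
  let δ : V.T ⟶ pullback V.a V.a := pullback.lift (𝟙 _) (𝟙 _) rfl
  obtain ⟨N, n, hn, hN, small_n⟩ := exists_union δ (pullback.fst (π₁ ≫ V.a) d)
  have hδ : ∀ {T : E} (t : T ⟶ pullback V.a V.a), (∃ k, k ≫ δ = t) ↔ t ≫ π₁ = t ≫ π₂ := by
    intro T t
    constructor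
    · rintro ⟨k, rfl⟩
      simp [δ, π₁, π₂]
    · exact fun h => ⟨t ≫ π₁, by ext <;> simp [δ, π₁]; exact h⟩
  have hd' : ∀ {T : E} (t : T ⟶ pullback V.a V.a), (∃ k, k ≫ pullback.fst (π₁ ≫ V.a) d = t) ↔
      J.IsDegenerate ((t ≫ π₁) ≫ V.a) := by
    intro T t
    rw [← hD]
    constructor
    · rintro ⟨k, rfl⟩
      exact ⟨k ≫ pullback.snd _ _, by simp [← pullback.condition]⟩
    · exact fun ⟨k, hk⟩ => ⟨pullback.lift t k (by rw [hk, Category.assoc]), pullback.lift_fst _ _ _⟩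
  have hN₁ : ∀ {T : E} (t : T ⟶ pullback V.a V.a), t ≫ π₁ = t ≫ π₂ → ∃ k, k ≫ n = t :=
    fun {T} t ht => (hN t).2 ⟨T, T, ⊥_ E, 𝟙 _, 𝟙 _, initial.to _, .of_isIso _, isSum_id_initial _,
      by simpa using (hδ t).2 ht, initial.to _, Subsingleton.elim _ _⟩
  have hN₂ : ∀ {T : E} (t : T ⟶ pullback V.a V.a), J.IsDegenerate ((t ≫ π₁) ≫ V.a) →
      ∃ k, k ≫ n = t :=
    fun {T} t ht => (hN t).2 ⟨T, ⊥_ E, T, 𝟙 _, initial.to _, 𝟙 _, .of_isIso _, isSum_initial_id _,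
      ⟨initial.to _, Subsingleton.elim _ _⟩, by simpa using (hd' t).2 ht⟩
  have small : S n := by
    refine small_n S hS' ?_ (hS'.pullback_fst small_d _)
    refine hS'.of_comp δ (prod.lift π₁ π₂) ?_
    have : δ ≫ prod.lift π₁ π₂ = diag V.T := by ext <;> simp [δ, π₁, π₂]
    rw [this]
    exact hS'.diagonals _
  have hker : ∀ ⦃T : E⦄ (t : T ⟶ pullback V.a V.a), (∃ k, k ≫ n = t) ↔
      Identifies ζ (t ≫ π₁) (t ≫ π₂) := by
    intro T t
    constructor
    · intro hk
      obtain ⟨T', T₁, T₂, c, i, j, hc, hs, hi, hj⟩ := (hN t).1 hk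
      rw [hδ] at hi
      rw [hd'] at hj
      let X : Stage C := ⟨T, (t ≫ π₁) ≫ V.a⟩
      let X' : Stage C := ⟨T', c ≫ X.a⟩
      let X₁ : Stage C := ⟨T₁, i ≫ X'.a⟩
      let X₂ : Stage C := ⟨T₂, j ≫ X'.a⟩
      refine (identifies_iff (X := X) rfl (by simp [X, hπ])).2 (hH.cover_ext (Y := X') (c := c) rfl
        hc (hH.sum_ext (Y := X₁) (Z := X₂) (i := i) (j := j) rfl rfl hs ?_ ?_))
      · simp only [Stage.map_op_map_op, Stage.vert_comp_vert]
        have hi' : i ≫ c ≫ t ≫ π₁ = i ≫ c ≫ t ≫ π₂ := by simpa using hi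
        simp only [hi']
      · refine (hH.exists_of_isDegenerate (X := X₂) ?_).2 _ _
        simpa [X₂, X', X] using hj
    · -- Split `T` according to the summands to which the two maps go.
      rintro ⟨a, hx, hy, e⟩
      have e' : ∀ {T' : E} (s : T' ⟶ T), H.map (Stage.vert (X := ⟨T', s ≫ a⟩)
          (s ≫ t ≫ π₁) (by simp [← hx])).op ζ = H.map (Stage.vert (X := ⟨T', s ≫ a⟩)
          (s ≫ t ≫ π₂) (by simp [← hy])).op ζ := by
        intro T' s
        have := congr(H.map (Stage.vert (X := ⟨T', s ≫ a⟩) (Y := ⟨T, a⟩) s rfl).op $e)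
        simpa only [Stage.map_op_map_op, Stage.vert_comp_vert] using this
      obtain ⟨T₁, T₂, i, j, x₁, x₂, hs, hi₁, hj₁⟩ := split (t ≫ π₁)
      refine hs.exists_lift ?_ ?_
      · obtain ⟨T₃, T₄, i', j', y₁, y₂, hs', hi₂, hj₂⟩ := split (i ≫ t ≫ π₂)
        have hx₁ : x₁ ≫ Z₁.a = i ≫ a := by rw [← hx, ← Category.assoc, hi₁, Category.assoc, hi]
        refine hs'.exists_lift (hN₁ _ ?_) (hN₂ _ ?_)
        · have hy₁ : y₁ ≫ Z₁.a = (i' ≫ i) ≫ a := by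
            rw [← hi, ← reassoc_of% hi₂, ← hy]; simp
          have E := e' (i' ≫ i)
          rw [res₁ (W := ⟨T₃, (i' ≫ i) ≫ a⟩) (i' ≫ x₁)
              (Stage.vert (X := ⟨T₃, (i' ≫ i) ≫ a⟩) (i' ≫ x₁) (by simp [hx₁])) _ rfl
              (by simp [hi₁]) rfl,
            res₁ (W := ⟨T₃, (i' ≫ i) ≫ a⟩) y₁ (Stage.vert (X := ⟨T₃, (i' ≫ i) ≫ a⟩) y₁ hy₁) _ rfl
              (by simp [hi₂]) rfl] at E
          have := (h₁.eq_classify (X := ⟨T₃, (i' ≫ i) ≫ a⟩) _ _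
            (inj₁ E)).trans
            (h₁.eq_classify (X := ⟨T₃, (i' ≫ i) ≫ a⟩) _ hy₁ rfl).symm
          simp only [Category.assoc]
          rw [hi₂, hi₁, ← this, Category.assoc]
        · have hy₂ : y₂ ≫ Z₂.a = (j' ≫ i) ≫ a := by
            rw [← hj, ← reassoc_of% hj₂, ← hy]; simp
          have E := e' (j' ≫ i)
          rw [res₁ (W := ⟨T₄, (j' ≫ i) ≫ a⟩) (j' ≫ x₁)
              (Stage.vert (X := ⟨T₄, (j' ≫ i) ≫ a⟩) (j' ≫ x₁) (by simp [hx₁])) _ rfl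
              (by simp [hi₁]) rfl,
            res₂ (W := ⟨T₄, (j' ≫ i) ≫ a⟩) y₂ (Stage.vert (X := ⟨T₄, (j' ≫ i) ≫ a⟩) y₂ hy₂) _ rfl
              (by simp [hj₂]) rfl] at E
          have := hdisj (X := ⟨T₄, (j' ≫ i) ≫ a⟩) _ _ E
          simpa [← hx] using this
      · obtain ⟨T₃, T₄, i', j', y₁, y₂, hs', hi₂, hj₂⟩ := split (j ≫ t ≫ π₂)
        have hx₂ : x₂ ≫ Z₂.a = j ≫ a := by rw [← hx, ← Category.assoc, hj₁, Category.assoc, hj]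
        refine hs'.exists_lift (hN₂ _ ?_) (hN₁ _ ?_)
        · have hy₁ : y₁ ≫ Z₁.a = (i' ≫ j) ≫ a := by
            rw [← hi, ← reassoc_of% hi₂, ← hy]; simp
          have E := e' (i' ≫ j)
          rw [res₂ (W := ⟨T₃, (i' ≫ j) ≫ a⟩) (i' ≫ x₂)
              (Stage.vert (X := ⟨T₃, (i' ≫ j) ≫ a⟩) (i' ≫ x₂) (by simp [hx₂])) _ rfl
              (by simp [hj₁]) rfl,
            res₁ (W := ⟨T₃, (i' ≫ j) ≫ a⟩) y₁ (Stage.vert (X := ⟨T₃, (i' ≫ j) ≫ a⟩) y₁ hy₁) _ rfl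
              (by simp [hi₂]) rfl] at E
          have := hdisj (X := ⟨T₃, (i' ≫ j) ≫ a⟩) _ _ E.symm
          simpa [← hx] using this
        · have hy₂ : y₂ ≫ Z₂.a = (j' ≫ j) ≫ a := by
            rw [← hj, ← reassoc_of% hj₂, ← hy]; simp
          have E := e' (j' ≫ j)
          rw [res₂ (W := ⟨T₄, (j' ≫ j) ≫ a⟩) (j' ≫ x₂)
              (Stage.vert (X := ⟨T₄, (j' ≫ j) ≫ a⟩) (j' ≫ x₂) (by simp [hx₂])) _ rfl
              (by simp [hj₁]) rfl,
            res₂ (W := ⟨T₄, (j' ≫ j) ≫ a⟩) y₂ (Stage.vert (X := ⟨T₄, (j' ≫ j) ≫ a⟩) y₂ hy₂) _ rfl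
              (by simp [hj₂]) rfl] at E
          have := (h₂.eq_classify (X := ⟨T₄, (j' ≫ j) ≫ a⟩) _ _
            (inj₂ E)).trans
            (h₂.eq_classify (X := ⟨T₄, (j' ≫ j) ≫ a⟩) _ hy₂ rfl).symm
          simp only [Category.assoc]
          rw [hj₂, hj₁, ← this, Category.assoc]
  have hB := isRep_sheafify_localImage hS hcod hH h n small hker
  refine ⟨_, Subfunctor.sheafify_isSheaf _ hH, hB, ?_, ?_⟩
  · rintro ⟨X⟩ _ ⟨z, rfl⟩
    obtain ⟨t, ht, e⟩ := elt₁ z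
    exact Subfunctor.le_sheafify _ _ _ (.of_eq t ht e)
  · rintro ⟨X⟩ _ ⟨z, rfl⟩
    obtain ⟨t, ht, e⟩ := elt₂ z
    exact Subfunctor.le_sheafify _ _ _ (.of_eq t ht e)

/-- The sum of two representable sheaves is representable. -/
lemma isRep_of_isColimit (hS : IsPredicative S) (hcod : S C.cod) (hJ : J.IsPresentable)
    {F G H : SheafTopos J} {ι₁ : F ⟶ H} {ι₂ : G ⟶ H} (hc : IsColimit (BinaryCofan.mk ι₁ ι₂))
    (hF : IsRep F.obj) (hG : IsRep G.obj) : IsRep H.obj := by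
  have : Mono ι₁ := FinitaryExtensive.mono_inl_of_isColimit hc
  have : Mono ι₂ := FinitaryExtensive.mono_inr_of_isColimit hc
  obtain ⟨A, hA, hB, hi₁, hi₂⟩ := exists_isRep_of_disjoint hS hcod hJ H.isStageSheaf
    (ι₁ := ι₁.hom) (ι₂ := ι₂.hom) (SheafTopos.injective_of_mono ι₁)
    (SheafTopos.injective_of_mono ι₂) (fun {X} z z' h => by
      obtain ⟨I, ⟨hI⟩, -, hdeg⟩ := exists_isInitial (J := J) hS.toIsClassOfSmallMaps hJ
      obtain ⟨y, -, -⟩ := Types.exists_of_isPullback (SheafTopos.isPullback_app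
        (FinitaryExtensive.isPullback_initial_to_binaryCofan hc) X) z z' h
      exact hdeg X ((initialIsInitial.to I).hom.app _ y)) hF hG
  -- The subsheaf which contains both summands is the whole sum.
  let B : SheafTopos J := ⟨A.toFunctor, (isSheaf_iff_isSheaf_of_type _ _).2 hA⟩
  let b : B ⟶ H := ⟨A.ι⟩
  have hb : Mono b := (sheafToPresheaf _ _).mono_of_mono_map (inferInstanceAs (Mono A.ι))
  let l₁ : F ⟶ B := ⟨A.lift ι₁.hom hi₁⟩
  let l₂ : G ⟶ B := ⟨A.lift ι₂.hom hi₂⟩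
  have hl₁ : l₁ ≫ b = ι₁ := rfl
  have hl₂ : l₂ ≫ b = ι₂ := rfl
  obtain ⟨l, e₁, e₂⟩ : ∃ l : H ⟶ B, ι₁ ≫ l = l₁ ∧ ι₂ ≫ l = l₂ :=
    have l := BinaryCofan.IsColimit.desc' hc l₁ l₂
    ⟨l.1, l.2⟩
  have : IsSplitEpi b := ⟨⟨l, BinaryCofan.IsColimit.hom_ext hc
    (show ι₁ ≫ l ≫ b = ι₁ ≫ 𝟙 H by rw [reassoc_of% e₁, hl₁, Category.comp_id])
    (show ι₂ ≫ l ≫ b = ι₂ ≫ 𝟙 H by rw [reassoc_of% e₂, hl₂, Category.comp_id])⟩⟩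
  have : IsIso b := isIso_of_mono_of_isSplitEpi b
  exact hB.of_iso ((sheafToPresheaf _ _).mapIso (asIso b))

end Sums

/-! ### Universal quantification of subsheaves -/

section UniversalQuantification

variable {E : Type u} [Category.{v} E] [PositiveHeytingCategory E] {S : MorphismProperty E}
  {C : InternalCategory E} {J : Topology S C}

/-- A map of sheaves factors through a mono if and only if it does so on elements. -/
lemma SheafTopos.exists_lift_iff {K A F : SheafTopos J} (m : A ⟶ F) [Mono m] (q : K ⟶ F) :
    (∃ l, l ≫ m = q) ↔
      ∀ ⦃X : Stage C⦄ (z : K.obj.obj (op X)), ∃ a, m.hom.app _ a = q.hom.app _ z := by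
  constructor
  · rintro ⟨l, rfl⟩ X z
    exact ⟨l.hom.app _ z, rfl⟩
  · intro h
    choose a ha using h
    refine ⟨⟨{ app X := TypeCat.ofHom fun z => a (X := X.unop) z, naturality := ?_ }⟩, ?_⟩
    · rintro ⟨X⟩ ⟨Y⟩ ⟨f⟩
      ext z
      refine SheafTopos.injective_of_mono m ((ha _).trans ?_)
      change _ = m.hom.app (op Y) (A.obj.map f.op (a z))
      rw [NatTrans.naturality_apply, ha, ← NatTrans.naturality_apply]
      rfl
    · ext X z
      exact ha (X := X.unop) z

/-- Universal quantification along `f : F ⟶ G` of the subsheaf of elements satisfying `A`. -/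
def forallSubfunctor {F G : (Stage C)ᵒᵖ ⥤ Type w} (f : F ⟶ G) (A : Subfunctor F) :
    Subfunctor G where
  obj X := {y | ∀ ⦃W : Stage C⦄ (d : W ⟶ X.unop) (x : F.obj (op W)),
    f.app _ x = G.map d.op y → x ∈ A.obj (op W)}
  map := by
    rintro ⟨X⟩ ⟨Y⟩ ⟨g⟩ y hy W d x hx
    exact hy (d ≫ g) x (hx.trans (Stage.map_op_map_op G d g y))

lemma isStageSheaf_forallSubfunctor {F G : (Stage C)ᵒᵖ ⥤ Type w} (f : F ⟶ G) {A : Subfunctor F}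
    (hF : J.IsStageSheaf F) (hG : J.IsStageSheaf G) (hA : J.IsStageSheaf A.toFunctor) :
    J.IsStageSheaf (forallSubfunctor f A).toFunctor := by
  refine (Subfunctor.isSheaf_iff _ hG).2 ?_
  rintro ⟨X⟩ y hy W d x hx
  refine (Subfunctor.isSheaf_iff _ hF).1 hA _ x ?_
  refine J.coverage.toGrothendieck.superset_covering ?_
    (J.coverage.toGrothendieck.pullback_stable d hy)
  intro V r hr
  refine hr (𝟙 _) (F.map r.op x) ?_
  rw [NatTrans.naturality_apply, hx, Stage.map_op_map_op, Stage.map_op_map_op, Category.id_comp]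

/-- Universal quantification preserves representability, because it is computed by universal
quantification in `E` along the object of triples `(y, g, x)` with `f x = y · g`. -/
lemma isRep_forallSubfunctor {F G A : (Stage C)ᵒᵖ ⥤ Type w} (f : F ⟶ G) (m : A ⟶ F)
    (hm : ∀ {X : Stage C} {z z' : A.obj (op X)}, m.app _ z = m.app _ z' → z = z')
    (hF : IsRep F) (hG : IsRep G) (hA : IsRep A) :
    IsRep (forallSubfunctor f (Subfunctor.range m)).toFunctor := by
  obtain ⟨Z, ξ, hF⟩ := hF
  obtain ⟨Y, η, hG⟩ := hG
  obtain ⟨M, α, hA⟩ := hA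
  let φ : Z.T ⟶ Y.T := hG.classify (f.app _ ξ)
  have hφ : φ ≫ Y.a = Z.a := hG.classify_a _
  let μ : M.T ⟶ Z.T := hF.classify (m.app _ α)
  have hμ : μ ≫ Z.a = M.a := hF.classify_a _
  have f_map : ∀ {X : Stage C} (x : X.T ⟶ Z.T) (hx : x ≫ Z.a = X.a),
      hG.classify (f.app _ (F.map (Stage.vert x hx).op ξ)) = x ≫ φ := fun x hx => by
    rw [NatTrans.naturality_apply, hG.comp_classify x hx]
  have m_map : ∀ {X : Stage C} (x : X.T ⟶ M.T) (hx : x ≫ M.a = X.a),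
      hF.classify (m.app _ (A.map (Stage.vert x hx).op α)) = x ≫ μ := fun x hx => by
    rw [NatTrans.naturality_apply, hF.comp_classify x hx]
  have mem_range : ∀ {X : Stage C} (x : X.T ⟶ Z.T) (hx : x ≫ Z.a = X.a),
      F.map (Stage.vert x hx).op ξ ∈ (Subfunctor.range m).obj (op X) ↔ ∃ k, k ≫ μ = x := by
    intro X x hx
    constructor
    · rintro ⟨a, ha⟩
      refine ⟨hA.classify a, ?_⟩
      rw [← m_map _ (hA.classify_a a), hA.map_classify, ha]
      exact (hF.eq_classify x hx rfl).symm
    · rintro ⟨k, rfl⟩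
      have hk : k ≫ M.a = X.a := by rw [← hμ, ← hx, Category.assoc]
      refine ⟨A.map (Stage.vert k hk).op α, hF.classify_injective ?_⟩
      rw [m_map]
      exact hF.eq_classify _ hx rfl
  have : Mono μ := ⟨fun {T} x y h => by
    have hy : y ≫ M.a = x ≫ M.a := by rw [← hμ, reassoc_of% h]
    have e := hm (hF.classify_injective ((m_map (X := ⟨T, x ≫ M.a⟩) x rfl).trans
      (h.trans (m_map (X := ⟨T, x ≫ M.a⟩) y hy).symm)))
    exact (hA.eq_classify (X := ⟨T, x ≫ M.a⟩) x rfl e).trans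
      (hA.eq_classify (X := ⟨T, x ≫ M.a⟩) y hy rfl).symm⟩
  let P := pullback hG.act φ
  obtain ⟨N, n, hn, hN, -⟩ := exists_forall (pullback.fst hG.act φ ≫ pullback.fst Y.a C.cod)
    (pullback.fst (pullback.snd hG.act φ) μ)
  have mem_iff : ∀ {X : Stage C} (y : X.T ⟶ Y.T) (hy : y ≫ Y.a = X.a),
      G.map (Stage.vert y hy).op η ∈ (forallSubfunctor f (Subfunctor.range m)).obj (op X) ↔
        ∃ k, k ≫ n = y := by
    intro X y hy
    rw [hN]
    constructor
    · intro h T' s p hp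
      let g : T' ⟶ C.C₁ := (p ≫ pullback.fst hG.act φ) ≫ pullback.snd Y.a C.cod
      let x : T' ⟶ Z.T := p ≫ pullback.snd hG.act φ
      have hp' : (p ≫ pullback.fst hG.act φ) ≫ pullback.fst Y.a C.cod = s ≫ y := by simpa using hp
      have hg : (s ≫ y) ≫ Y.a = g ≫ C.cod := by
        rw [← hp', Category.assoc _ _ Y.a, pullback.condition]; simp only [g, Category.assoc]
      have hact : pullback.lift (s ≫ y) g hg ≫ hG.act = x ≫ φ := by
        have : pullback.lift (s ≫ y) g hg = p ≫ pullback.fst hG.act φ := by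
          ext
          · simp [← hp]
          · simp [g]
        rw [this, Category.assoc, pullback.condition, Category.assoc]
      let W : Stage C := ⟨T', g ≫ C.dom⟩
      rw [hG.lift_act _ _ hg (g ≫ C.dom) rfl] at hact
      have hx : x ≫ Z.a = W.a := by
        rw [← hφ, ← Category.assoc, ← hact]
        exact hG.classify_a (X := W) _
      have key := h (Stage.homMk (X := W) (Y := X) s g (by rw [← hg, ← hy, Category.assoc]) rfl)
        (F.map (Stage.vert x hx).op ξ) (hG.classify_injective (by
          rw [f_map, ← hact, Stage.map_op_map_op]
          congr 1
          exact Stage.map_op_congr _ (by simp) (by simp) η))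
      rw [mem_range] at key
      obtain ⟨k, hk⟩ := key
      exact ⟨pullback.lift p k hk.symm, pullback.lift_fst _ _ _⟩
    · intro h W d x hx
      have hr : (d.map ≫ y) ≫ Y.a = d.arr ≫ C.cod := by rw [Category.assoc, hy, d.arr_cod]
      have e : pullback.lift (d.map ≫ y) d.arr hr ≫ hG.act = hF.classify x ≫ φ := by
        rw [hG.lift_act _ _ hr W.a d.arr_dom, ← f_map _ (hF.classify_a x), hF.map_classify, hx,
          Stage.map_op_map_op]
        congr 1
        exact Stage.map_op_congr _ (by simp) (by simp) η
      obtain ⟨k, hk⟩ := h d.map (pullback.lift _ _ e) (by simp)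
      rw [← hF.map_classify x, mem_range]
      refine ⟨k ≫ pullback.snd _ _, ?_⟩
      rw [Category.assoc, ← pullback.condition, reassoc_of% hk, pullback.lift_snd]
  rw [isRep_toFunctor_iff]
  refine ⟨⟨N, n ≫ Y.a⟩, G.map (Stage.vert n rfl).op η,
    (mem_iff (X := ⟨N, n ≫ Y.a⟩) n rfl).2 ⟨𝟙 _, Category.id_comp _⟩,
    fun X z hz => ?_, fun X q q' h h' e => ?_⟩
  · rw [← hG.map_classify z, mem_iff] at hz
    obtain ⟨k, hk⟩ := hz
    have hka : k ≫ n ≫ Y.a = X.a := by rw [reassoc_of% hk, hG.classify_a]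
    refine ⟨k, hka, ?_⟩
    rw [Stage.map_op_map_op, Stage.vert_comp_vert]
    refine Eq.trans ?_ (hG.map_classify z)
    simp only [hk]
  · rw [Stage.map_op_map_op, Stage.map_op_map_op, Stage.vert_comp_vert, Stage.vert_comp_vert] at e
    rw [← cancel_mono n]
    exact (hG.eq_classify _ _ e).trans (hG.eq_classify _ _ rfl).symm

/-- Universal quantification of representable subsheaves along maps of representable sheaves. -/
lemma SheafTopos.exists_forall {F G A : SheafTopos J} (f : F ⟶ G) (m : A ⟶ F) [Mono m]
    (hF : IsRep F.obj) (hG : IsRep G.obj) (hA : IsRep A.obj) :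
    ∃ (B : SheafTopos J) (n : B ⟶ G), Mono n ∧ IsRep B.obj ∧
      ∀ ⦃K P : SheafTopos J⦄ (k : K ⟶ G) (p : P ⟶ K) (q : P ⟶ F), IsPullback p q k f →
        ((∃ l, l ≫ m = q) ↔ ∃ l, l ≫ n = k) := by
  let R := forallSubfunctor f.hom (Subfunctor.range m.hom)
  have : Mono m.hom := (Sheaf.Hom.mono_iff_presheaf_mono _ _ m).1 inferInstance
  have hm : J.IsStageSheaf (Subfunctor.range m.hom).toFunctor :=
    Presieve.isSheaf_iso _ (asIso (Subfunctor.toRange m.hom)) A.isStageSheaf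
  let B : SheafTopos J := ⟨R.toFunctor, (isSheaf_iff_isSheaf_of_type _ _).2
    (isStageSheaf_forallSubfunctor f.hom F.isStageSheaf G.isStageSheaf hm)⟩
  let n : B ⟶ G := ⟨R.ι⟩
  have hn : Mono n := (sheafToPresheaf _ _).mono_of_mono_map (inferInstanceAs (Mono R.ι))
  refine ⟨B, n, hn, isRep_forallSubfunctor f.hom m.hom (SheafTopos.injective_of_mono m) hF hG hA,
    fun K P k p q h => ?_⟩
  rw [SheafTopos.exists_lift_iff, SheafTopos.exists_lift_iff]
  constructor
  · intro H X z
    refine ⟨⟨k.hom.app _ z, fun W d x hx => ?_⟩, rfl⟩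
    obtain ⟨w, hw, rfl⟩ := Types.exists_of_isPullback (SheafTopos.isPullback_app h W)
      (K.obj.map d.op z) x (by rw [hx, NatTrans.naturality_apply])
    exact H w
  · intro H X w
    obtain ⟨b, hb⟩ := H (p.hom.app _ w)
    refine b.2 (𝟙 _) (q.hom.app _ w) ?_
    have e := ConcreteCategory.congr_hom (SheafTopos.isPullback_app h X).w w
    rw [op_id, Functor.map_id_apply]
    exact e.symm.trans hb.symm

end UniversalQuantification

/-! ### Transfer from the topos to internal sheaves -/

section Transfer

variable {E : Type u} [Category.{v} E] [PositiveHeytingCategory E] {S : MorphismProperty E}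
  {C : InternalCategory E} {J : Topology S C}

/-- Epimorphisms of sheaves are stable under pullback. -/
lemma SheafTopos.epi_of_isPullback {P F G H : SheafTopos J} {p : P ⟶ F} {q : P ⟶ G} {f : F ⟶ H}
    {g : G ⟶ H} (h : IsPullback p q f g) [Epi f] : Epi q := by
  rw [← Sheaf.isLocallySurjective_iff_epi]
  have : Sheaf.IsLocallySurjective f := (Sheaf.isLocallySurjective_iff_epi f).2 inferInstance
  refine ⟨fun {X} z => J.coverage.toGrothendieck.superset_covering ?_
    (Presheaf.imageSieve_mem J.coverage.toGrothendieck f.hom (g.hom.app (op X) z))⟩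
  rintro V r ⟨x, hx⟩
  obtain ⟨w, -, hw⟩ := Types.exists_of_isPullback (SheafTopos.isPullback_app h V) x
    (G.obj.map r.op z) (hx.trans (NatTrans.naturality_apply _ _ _).symm)
  exact ⟨w, hw⟩

/-- A limit of representable sheaves which is representable is created from the topos. -/
@[reducible]
def createsLimitOfIsRep {I : Type*} [Category* I] {K : I ⥤ Sheaves J} {l : Cone (K ⋙ toTopos J)}
    (hl : IsLimit l) (h : IsRep l.pt.obj) : CreatesLimit K (toTopos J) :=
  createsLimitOfFullyFaithfulOfIso' hl _ (exists_iso_toTopos _ h).choose_spec.some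

/-- A colimit of representable sheaves which is representable is created from the topos. -/
@[reducible]
def createsColimitOfIsRep {I : Type*} [Category* I] {K : I ⥤ Sheaves J}
    {l : Cocone (K ⋙ toTopos J)} (hl : IsColimit l) (h : IsRep l.pt.obj) :
    CreatesColimit K (toTopos J) :=
  createsColimitOfFullyFaithfulOfIso' hl _ (exists_iso_toTopos _ h).choose_spec.some

/-- The terminal sheaf is created from the topos. -/
instance createsTerminal : CreatesLimitsOfShape (Discrete PEmpty.{1}) (toTopos J) where
  CreatesLimit {K} := createsLimitOfIsRep (limit.isLimit _) (isRep_of_unique fun X =>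
    SheafTopos.unique_of_isTerminal
      (isLimitChangeEmptyCone _ (limit.isLimit (K ⋙ toTopos J)) _ (Iso.refl _)) X.unop)

/-- Pullbacks of sheaves are created from the topos. -/
instance createsPullbacks : CreatesLimitsOfShape WalkingCospan (toTopos J) where
  CreatesLimit {K} := createsLimitOfIsRep (limit.isLimit _)
    (.of_isPullback (IsPullback.of_isLimit_cone (limit.isLimit (K ⋙ toTopos J)))
      (isRep_toTopos _) (isRep_toTopos _) (isRep_toTopos _))

variable (J) in
instance : HasFiniteLimits (Sheaves J) :=
  have : HasTerminal (Sheaves J) :=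
    hasLimitsOfShape_of_hasLimitsOfShape_createsLimitsOfShape (toTopos J)
  have : HasPullbacks (Sheaves J) :=
    hasLimitsOfShape_of_hasLimitsOfShape_createsLimitsOfShape (toTopos J)
  hasFiniteLimits_of_hasTerminal_and_pullbacks

variable (hS : IsPredicative S) (hcod : S C.cod)
include hS

/-- The initial sheaf is created from the topos; presentability of the site makes it
representable. -/
@[reducible]
def createsInitial (hJ : J.IsPresentable) :
    CreatesColimitsOfShape (Discrete PEmpty.{1}) (toTopos J) where
  CreatesColimit {K} :=
    have h := exists_isInitial (J := J) hS.toIsClassOfSmallMaps hJ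
    createsColimitOfIsRep (colimit.isColimit _) (h.choose_spec.2.1.of_iso
      ((sheafToPresheaf _ _).mapIso (h.choose_spec.1.some.uniqueUpToIso
        (isColimitChangeEmptyCocone _ (colimit.isColimit (K ⋙ toTopos J)) _ (Iso.refl _)))))

include hcod

/-- Binary sums of sheaves are created from the topos. -/
@[reducible]
def createsBinaryCoproducts (hJ : J.IsPresentable) :
    CreatesColimitsOfShape (Discrete WalkingPair) (toTopos J) where
  CreatesColimit {K} := createsColimitOfIsRep (colimit.isColimit _) (isRep_of_isColimit hS hcod hJ
    (IsColimit.ofIsoColimit ((IsColimit.precomposeInvEquiv (diagramIsoPair _) _).symm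
      (colimit.isColimit (K ⋙ toTopos J))) (isoBinaryCofanMk _)) (isRep_toTopos _)
      (isRep_toTopos _))

lemma hasFiniteCoproducts_sheaves (hJ : J.IsPresentable) : HasFiniteCoproducts (Sheaves J) :=
  have := createsInitial hS hJ
  have := createsBinaryCoproducts hS hcod hJ
  have : HasInitial (Sheaves J) :=
    hasColimitsOfShape_of_hasColimitsOfShape_createsColimitsOfShape (toTopos J)
  have : HasBinaryCoproducts (Sheaves J) :=
    hasColimitsOfShape_of_hasColimitsOfShape_createsColimitsOfShape (toTopos J)
  hasFiniteCoproducts_of_has_binary_and_initial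

lemma finitaryExtensive_sheaves (hJ : J.IsPresentable) : FinitaryExtensive (Sheaves J) :=
  have := hasFiniteCoproducts_sheaves hS hcod hJ
  have := createsBinaryCoproducts hS hcod hJ
  finitaryExtensive_of_preserves_and_reflects_isomorphism (toTopos J)

/-- A map of sheaves factors as an epimorphism of the topos followed by a mono. -/
lemma exists_factorisation_sheaves {P Q : Sheaves J} (f : P ⟶ Q) :
    ∃ (I : Sheaves J) (e : P ⟶ I) (m : I ⟶ Q), Epi ((toTopos J).map e) ∧ Mono m ∧ e ≫ m = f := by
  obtain ⟨I, ⟨i⟩⟩ := exists_iso_toTopos _ (isRep_image hS hcod ((toTopos J).map f)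
    (isRep_toTopos P) (isRep_toTopos Q))
  refine ⟨I, (toTopos J).preimage (Sheaf.toImage _ ≫ i.inv),
    (toTopos J).preimage (i.hom ≫ Sheaf.imageι _), ?_, (toTopos J).mono_of_mono_map ?_,
    (toTopos J).map_injective ?_⟩
  · rw [Functor.map_preimage]
    infer_instance
  · rw [Functor.map_preimage]
    infer_instance
  · simp

/-- The covers of internal sheaves are the epimorphisms of the topos. -/
lemma isCover_iff_epi_map {P Q : Sheaves J} (f : P ⟶ Q) :
    IsCover f ↔ Epi ((toTopos J).map f) := by
  constructor
  · intro h
    obtain ⟨I, e, m, he, hm, rfl⟩ := exists_factorisation_sheaves hS hcod f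
    have : IsIso m := h m e hm rfl
    rw [Functor.map_comp]
    infer_instance
  · rintro h I m e hm rfl
    rw [Functor.map_comp] at h
    have := epi_of_epi ((toTopos J).map e) ((toTopos J).map m)
    have : IsIso ((toTopos J).map m) := isIso_of_mono_of_epi _
    exact isIso_of_reflects_iso m (toTopos J)

omit hS hcod in
/-- Universal quantification along maps of internal sheaves is computed in the topos. -/
lemma isLeftAdjoint_pullback_sheaves {P Q : Sheaves J} (f : P ⟶ Q) :
    (Subobject.pullback f).IsLeftAdjoint := by
  have key : ∀ A : Subobject P, ∃ B : Subobject Q, ∀ K : Subobject Q,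
      (Subobject.pullback f).obj K ≤ A ↔ K ≤ B := by
    intro A
    obtain ⟨B', n', hn', hB, H⟩ := SheafTopos.exists_forall ((toTopos J).map f)
      ((toTopos J).map A.arrow) (isRep_toTopos _) (isRep_toTopos _) (isRep_toTopos _)
    obtain ⟨B, ⟨i⟩⟩ := exists_iso_toTopos B' hB
    let n : B ⟶ Q := (toTopos J).preimage (i.hom ≫ n')
    have hn : (toTopos J).map n = i.hom ≫ n' := Functor.map_preimage _ _
    have : Mono n := (toTopos J).mono_of_mono_map (by rw [hn]; infer_instance)
    refine ⟨Subobject.mk n, fun K => ?_⟩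
    have h := H _ _ _ ((Subobject.isPullback f K).map (toTopos J))
    have h₁ : (∃ l, l ≫ (toTopos J).map A.arrow =
        (toTopos J).map ((Subobject.pullback f).obj K).arrow) ↔
        (Subobject.pullback f).obj K ≤ A := by
      constructor
      · rintro ⟨l, hl⟩
        refine Subobject.le_of_comm ((toTopos J).preimage l) ((toTopos J).map_injective ?_)
        rw [Functor.map_comp, Functor.map_preimage, hl]
      · intro h
        exact ⟨(toTopos J).map (Subobject.ofLE _ _ h), by
          rw [← Functor.map_comp, Subobject.ofLE_arrow]⟩
    have h₂ : (∃ l, l ≫ n' = (toTopos J).map K.arrow) ↔ K ≤ Subobject.mk n := by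
      constructor
      · rintro ⟨l, hl⟩
        refine Subobject.le_mk_of_comm ((toTopos J).preimage (l ≫ i.inv))
          ((toTopos J).map_injective ?_)
        rw [Functor.map_comp, Functor.map_preimage, hn, Category.assoc, i.inv_hom_id_assoc, hl]
      · intro h
        refine ⟨(toTopos J).map (Subobject.ofLEMk _ _ h) ≫ i.hom, ?_⟩
        rw [Category.assoc, ← hn, ← Functor.map_comp, Subobject.ofLEMk_comp]
    rw [← h₁, h, h₂]
  choose B hB using key
  have gc : GaloisConnection (Subobject.pullback f).obj B := fun K A => hB A K
  exact (gc.adjunction.ofNatIsoLeft (NatIso.ofComponents fun _ => Iso.refl _)).isLeftAdjoint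

end Transfer

end

end AlgSetTheory

theorem mainTheorem10 {E : Type*} [Category E] [AlgSetTheory.PositiveHeytingCategory E]
    (S : MorphismProperty E) (hS : AlgSetTheory.IsPredicative S)
    (C : AlgSetTheory.InternalCategory E) (hcod : S C.cod)
    (J : AlgSetTheory.Topology S C) (hJ : J.IsPresentable) :
    AlgSetTheory.PositiveHeytingCategory (AlgSetTheory.Sheaves J) := by
  have := AlgSetTheory.finitaryExtensive_sheaves hS hcod hJ
  exact
    { exists_factorisation f := by
        obtain ⟨I, e, m, he, hm, h⟩ := AlgSetTheory.exists_factorisation_sheaves hS hcod f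
        exact ⟨I, e, m, (AlgSetTheory.isCover_iff_epi_map hS hcod e).2 he, hm, h⟩
      cover_stable {_ _} f {_ _} q g p h hf := by
        rw [AlgSetTheory.isCover_iff_epi_map hS hcod] at hf ⊢
        exact AlgSetTheory.SheafTopos.epi_of_isPullback (h.map (AlgSetTheory.toTopos J))
      mono_inl X Y := inferInstance
      mono_inr X Y := inferInstance
      disjoint X Y := FinitaryExtensive.isPullback_initial_to_binaryCofan (colimit.isColimit _)
      initial_stable f := inferInstance
      coprod_stable {X Y Z} f := ((BinaryCofan.isVanKampen_iff _).1 (FinitaryExtensive.vanKampen _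
        (coprodIsCoprod X Y)) (BinaryCofan.mk _ _) _ _ f pullback.condition.symm
        pullback.condition.symm).2 ⟨.of_hasPullback _ _, .of_hasPullback _ _⟩
      forall_exists f := AlgSetTheory.isLeftAdjoint_pullback_sheaves f }
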